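/- **Setting.** Let $\mathcal H$ be a separable complex Hilbert space, $\mathcal H_N=\mathcal H^{\otimes N}$, and let $h$ be a self-adjoint operator on $\mathcal H$ with compact resolvent; $H_N=\sum_{j=1}^N h_j$ is the $N$-particle Hamiltonian. A *collision specification* $(\mathcal C,U,\nu)$ consists of a compact metric space $\mathcal C$, a (strongly) continuous one-to-one map $U$ from $\mathcal C$ to the unitary operators on $\mathcal H_2$, and a Borel probability measure $\nu$ on $\mathcal C$ charging all non-empty open sets, such that (i) each $U(\sigma)$ commutes with $H_2$; (ii) $U(\sigma_0)=1$ for some $\sigma_0$; (iii) $\{U(\sigma)\}=\{U(\sigma)^*\}$, and the map $\sigma\mapsto\sigma'$ with $U(\sigma)^*=U(\sigma')$ is measurable and preserves $\nu$; (iv) with $V$ the swap of the two factors of $\mathcal H_2$, $\{U(\sigma)\}=\{VU(\sigma)V^*\}$, and the map $\sigma\mapsto\sigma'$ with $VU(\sigma)V^*=U(\sigma')$ is measurable and preserves $\nu$. For $N\ge 2$ and $i<j$ let $U_{i,j}(\sigma)$ be $U(\sigma)$ acting on the $i$-th and $j$-th factors of $\mathcal H_N$. For bounded operators $A$ on $\mathcal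 H_N$ put $$\mathscr Q_{i,j}A=\int_{\mathcal C}U_{i,j}(\sigma)AU_{i,j}(\sigma)^*\,d\nu(\sigma),\qquad \mathscr Q_N=\binom N2^{-1}\sum_{i<j}\mathscr Q_{i,j},\qquad \mathscr L_N=N(\mathscr Q_N-1).$$ Let $\mathscr QA=\int_{\mathcal C}U(\sigma)AU(\sigma)^*\,d\nu(\sigma)$ on $\mathcal H_2$. The quantum Wild convolution of trace class operators $A,B$ on $\mathcal H$ is $A\star B=\mathrm{Tr}_2[\mathscr Q(A\otimes B)]$. A density matrix is a positive trace class operator of trace $1$. It is symmetric if it is invariant under all permutations of the factors. A sequence $\{\varrho_N\}_{N\ge 2}$ of symmetric density matrices on $\mathcal H_N$ is *$\rho$-chaotic*, for a density matrix $\rho$ on $\mathcal H$, if for each $k\ge1$ the reduced density matrices $\varrho_N^{(k)}=\mathrm{Tr}_{k+1,\dots,N}\,\varrho_N$ converge to $\rho^{\otimes k}$ in trace norm as $N\to\infty$. **Theorem.** Suppose that $\{\varrho_N(0)\}$ is $\rho(0)$-chaotic and that $\varrho_N(t)=e^{t\mathscr L_N}\varrho_N(0)$ for each $N$ and all $t\ge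 0$. Then there are density matrices $\rho(t)$ on $\mathcal H$, $t\ge 0$, equal to the given $\rho(0)$ at $t=0$, such that for every $t\ge0$ the sequence $\{\varrho_N(t)\}$ is $\rho(t)$-chaotic (in particular $\rho(t)=\lim_{N\to\infty}\varrho_N(t)^{(1)}$), and $\rho(t)$ satisfies the Quantum Kac–Boltzmann Equation $$\frac{d}{dt}\rho(t)=2\bigl(\rho(t)\star\rho(t)-\rho(t)\bigr),\qquad t\ge0,$$ where the derivative is taken in trace norm (one-sided at $t=0$). -/

import Mathlib

open scoped InnerProductSpace ENNReal Topology
open MeasureTheory Filter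

noncomputable section


namespace QuantumKac

section Traces
variable {K : Type*} [NormedAddCommGroup K] [InnerProductSpace ℂ K] [CompleteSpace K]

/-- The index set of a fixed orthonormal basis of the Hilbert space `K`. -/
def basisIdx (K : Type*) [NormedAddCommGroup K] [InnerProductSpace ℂ K] [CompleteSpace K] :
    Set K := (exists_hilbertBasis ℂ K).choose

/-- A fixed orthonormal basis of the Hilbert space `K`. It serves to realize tensor powers in
coordinates; another choice changes them only by a canonical unitary. -/
def basis (K : Type*) [NormedAddCommGroup K] [InnerProductSpace ℂ K] [CompleteSpace K] :
    HilbertBasis (basisIdx K) ℂ K := (exists_hilbertBasis ℂ K).choose_spec.choose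

/-- The trace norm `‖T‖₁ = Tr (T* T)^(1/2)`, as the supremum of `∑ᵢ |⟨fᵢ, T eᵢ⟩|` over finite
orthonormal families `e`, `f`; it is `∞` exactly when `T` is not trace class. -/
def traceNorm (T : K →L[ℂ] K) : ℝ≥0∞ :=
  ⨆ (n : ℕ) (e : Fin n → K) (f : Fin n → K) (_ : Orthonormal ℂ e) (_ : Orthonormal ℂ f),
    ∑ i, ‖⟪f i, T (e i)⟫_ℂ‖ₑ

/-- Density matrices: positive trace class operators of trace one. -/
def IsDensityMatrix (T : K →L[ℂ] K) : Prop :=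
  T.IsPositive ∧ HasSum (fun j => ⟪basis K j, T (basis K j)⟫_ℂ) 1

end Traces

section Isometries
variable {X E : Type*} [NormedAddCommGroup E] [InnerProductSpace ℂ E] [CompleteSpace E]

theorem orthogonalFamily_of_orthonormal {v : X → E} (hv : Orthonormal ℂ v) :
    OrthogonalFamily ℂ (fun _ : X => ℂ)
      (fun x => LinearIsometry.toSpanSingleton ℂ E (hv.1 x)) := by
  intro x y hxy a b
  simp [LinearIsometry.toSpanSingleton_apply, inner_smul_left, inner_smul_right, hv.2 hxy]

/-- The isometry from `ℓ²(X)` that sends the unit vector at `x` to `v x`, for `v` orthonormal. -/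
def isometryOfOrthonormal {v : X → E} (hv : Orthonormal ℂ v) :
    lp (fun _ : X => ℂ) 2 →ₗᵢ[ℂ] E :=
  (orthogonalFamily_of_orthonormal hv).linearIsometry

theorem inner_isometryOfOrthonormal {v : X → E} (hv : Orthonormal ℂ v) {a : E}
    (ha : ∀ x, ⟪a, v x⟫_ℂ = 0) (w : lp (fun _ : X => ℂ) 2) :
    ⟪a, isometryOfOrthonormal hv w⟫_ℂ = 0 := by
  have h := ((orthogonalFamily_of_orthonormal hv).hasSum_linearIsometry w).mapL (innerSL ℂ a)
  refine h.unique ?_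
  simp [LinearIsometry.toSpanSingleton_apply, ha, hasSum_zero]

end Isometries

section Fiberwise
variable {Y K : Type*} [NormedAddCommGroup K] [InnerProductSpace ℂ K] [CompleteSpace K]

theorem memℓp_fiberwise (A : K →L[ℂ] K) (w : lp (fun _ : Y => K) 2) :
    Memℓp (fun y => A (w y)) 2 := by
  apply memℓp_gen
  have h := ((lp.memℓp w).summable (by norm_num)).mul_left (‖A‖ ^ (2 : ℝ≥0∞).toReal)
  refine h.of_nonneg_of_le (fun y => by positivity) (fun y => ?_)
  rw [← Real.mul_rpow (norm_nonneg _) (norm_nonneg _)]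
  exact Real.rpow_le_rpow (norm_nonneg _) (A.le_opNorm _) (by norm_num)

theorem norm_sq_lp (w : lp (fun _ : Y => K) 2) : ‖w‖ ^ 2 = ∑' y, ‖w y‖ ^ 2 := by
  have := lp.norm_rpow_eq_tsum (p := 2) (by norm_num) w
  simpa using this

theorem summable_sq_lp (w : lp (fun _ : Y => K) 2) : Summable fun y => ‖w y‖ ^ 2 := by
  have := (lp.memℓp w).summable (by norm_num)
  simpa using this

/-- `A` applied at each point of `Y`, on `ℓ²(Y; K)`. -/
def fiberwise (A : K →L[ℂ] K) : lp (fun _ : Y => K) 2 →L[ℂ] lp (fun _ : Y => K) 2 :=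
  LinearMap.mkContinuous
    { toFun := fun w => ⟨fun y => A (w y), memℓp_fiberwise A w⟩
      map_add' := fun v w => by ext y; exact map_add A (v y) (w y)
      map_smul' := fun c w => by ext y; exact map_smul A c (w y) } ‖A‖ <| by
    intro w
    refine le_of_sq_le_sq ?_ (by positivity)
    rw [mul_pow, norm_sq_lp, norm_sq_lp, ← tsum_mul_left]
    refine Summable.tsum_le_tsum (fun y => ?_) (summable_sq_lp _) ((summable_sq_lp w).mul_left _)
    rw [← mul_pow]
    exact pow_le_pow_left₀ (norm_nonneg _) (A.le_opNorm _) 2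

@[simp]
theorem fiberwise_apply (A : K →L[ℂ] K) (w : lp (fun _ : Y => K) 2) (y : Y) :
    fiberwise A w y = A (w y) := rfl

theorem norm_fiberwise_le (A : K →L[ℂ] K) : ‖(fiberwise A : lp (fun _ : Y => K) 2 →L[ℂ] _)‖ ≤ ‖A‖ :=
  LinearMap.mkContinuous_norm_le _ (norm_nonneg _) _

theorem adjoint_fiberwise (A : K →L[ℂ] K) :
    (fiberwise A : lp (fun _ : Y => K) 2 →L[ℂ] _).adjoint = fiberwise A.adjoint := by
  symm
  rw [ContinuousLinearMap.eq_adjoint_iff]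
  intro v w
  simp [lp.inner_eq_tsum, ContinuousLinearMap.adjoint_inner_left]

theorem continuous_fiberwise {C : Type*} [TopologicalSpace C] (A : C → K →L[ℂ] K)
    (hA : ∀ x, Continuous fun σ => A σ x) (hb : ∀ σ, ‖A σ‖ ≤ 1) (w : lp (fun _ : Y => K) 2) :
    Continuous fun σ => fiberwise (A σ) w := by
  rw [continuous_iff_continuousAt]
  intro σ₀
  rw [ContinuousAt, tendsto_iff_norm_sub_tendsto_zero]
  have h1 : Continuous fun σ => ∑' y, ‖A σ (w y) - A σ₀ (w y)‖ ^ 2 := by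
    refine continuous_tsum (u := fun y => 4 * ‖w y‖ ^ 2)
      (fun y => (((hA (w y)).sub continuous_const).norm.pow 2))
      ((summable_sq_lp w).mul_left 4) (fun y σ => ?_)
    have h2 : ∀ τ, ‖A τ (w y)‖ ≤ ‖w y‖ := fun τ =>
      ((A τ).le_opNorm _).trans (mul_le_of_le_one_left (norm_nonneg _) (hb τ))
    have h3 : ‖A σ (w y) - A σ₀ (w y)‖ ≤ 2 * ‖w y‖ :=
      (norm_sub_le _ _).trans (by linarith [h2 σ, h2 σ₀])
    rw [Real.norm_of_nonneg (by positivity)]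
    calc _ ≤ (2 * ‖w y‖) ^ 2 := pow_le_pow_left₀ (norm_nonneg _) h3 2
      _ = _ := by ring
  have h4 : (fun σ => ‖fiberwise (A σ) w - fiberwise (A σ₀) w‖) =
      fun σ => √(∑' y, ‖A σ (w y) - A σ₀ (w y)‖ ^ 2) := by
    ext σ
    rw [← Real.sqrt_sq (norm_nonneg (fiberwise (A σ) w - fiberwise (A σ₀) w)), norm_sq_lp]
    rfl
  rw [h4]
  have h5 := (Real.continuous_sqrt.comp h1).tendsto σ₀
  simpa [Function.comp_def] using h5

end Fiberwise

section Tensor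
variable (H : Type*) [NormedAddCommGroup H] [InnerProductSpace ℂ H] [CompleteSpace H]

/-- The Hilbert space tensor product `⨂_{i ∈ ι} H`, with orthonormal basis the product vectors
`⨂ᵢ ψ_{α i}`, `α : ι → basisIdx H`, where `ψ` is the fixed basis of `H`.
The `N`-particle space `H_N` is `TensorPow H (Fin N)`. -/
abbrev TensorPow (ι : Type) := lp (fun _ : ι → basisIdx H => ℂ) 2

variable {H} {ι κ : Type}

/-- The basis vector `⨂ᵢ ψ_{α i}`. -/
def basisVec (α : ι → basisIdx H) : TensorPow H ι :=
  HilbertBasis.ofRepr (LinearIsometryEquiv.refl ℂ (TensorPow H ι)) α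

theorem orthonormal_basisVec : Orthonormal ℂ (basisVec : (ι → basisIdx H) → TensorPow H ι) :=
  HilbertBasis.orthonormal _

theorem sum_prod_le {J : Type*} [Fintype ι] (c : ι → J → ℝ) (B : ι → ℝ) (hc : ∀ i j, 0 ≤ c i j)
    (hB : ∀ i (s : Finset J), ∑ j ∈ s, c i j ≤ B i) (s : Finset (ι → J)) :
    ∑ α ∈ s, ∏ i, c i (α i) ≤ ∏ i, B i := by
  classical
  have hs : s ⊆ Fintype.piFinset (fun i => s.image (fun α => α i)) := by
    intro α hα
    rw [Fintype.mem_piFinset]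
    exact fun i => Finset.mem_image_of_mem (fun α => α i) hα
  calc _ ≤ ∑ α ∈ Fintype.piFinset (fun i => s.image (fun α => α i)), ∏ i, c i (α i) :=
        Finset.sum_le_sum_of_subset_of_nonneg hs fun _ _ _ =>
          Finset.prod_nonneg fun _ _ => hc _ _
    _ = ∏ i, ∑ j ∈ s.image (fun α => α i), c i j := (Finset.prod_univ_sum _ _).symm
    _ ≤ _ := Finset.prod_le_prod (fun _ _ => Finset.sum_nonneg fun _ _ => hc _ _)
        fun i _ => hB i _

theorem memℓp_tprod [Fintype ι] (φ : ι → H) :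
    Memℓp (fun α : ι → basisIdx H => ∏ i, ⟪basis H (α i), φ i⟫_ℂ) 2 := by
  refine memℓp_gen' (C := ∏ i, ‖φ i‖ ^ 2) fun s => ?_
  refine le_trans (le_of_eq (Finset.sum_congr rfl fun α _ => ?_)) (sum_prod_le (fun i j => ‖⟪basis H j, φ i⟫_ℂ‖ ^ 2) _
    (fun _ _ => sq_nonneg _) (fun i _ => (basis H).orthonormal.sum_inner_products_le _) s)
  rw [norm_prod, Finset.prod_pow, ENNReal.toReal_ofNat, Real.rpow_ofNat]

/-- The product vector `⨂ᵢ φᵢ`; its coordinate at `α` is `∏ᵢ ⟨ψ_{α i}, φᵢ⟩`. -/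
def tprod [Fintype ι] (φ : ι → H) : TensorPow H ι :=
  ⟨fun α => ∏ i, ⟪basis H (α i), φ i⟫_ℂ, memℓp_tprod φ⟩

open scoped Classical in
/-- The function on `ι` that is `x k` at `f k` and `y i` at each `i` outside the range of `f`. -/
def merge (f : κ ↪ ι) (y : {i // i ∉ Set.range f} → basisIdx H) (x : κ → basisIdx H) :
    ι → basisIdx H :=
  fun i => if hi : i ∈ Set.range f then x hi.choose else y ⟨i, hi⟩

theorem merge_apply_mem (f : κ ↪ ι) (y : {i // i ∉ Set.range f} → basisIdx H)
    (x : κ → basisIdx H) (k : κ) : merge f y x (f k) = x k := by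
  have hk : f k ∈ Set.range f := ⟨k, rfl⟩
  rw [merge, dif_pos hk, f.injective hk.choose_spec]

theorem merge_apply_not_mem (f : κ ↪ ι) (y : {i // i ∉ Set.range f} → basisIdx H)
    (x : κ → basisIdx H) (i : {i // i ∉ Set.range f}) : merge f y x i = y i := by
  rw [merge, dif_neg i.2]

theorem merge_injective (f : κ ↪ ι) {y y' : {i // i ∉ Set.range f} → basisIdx H}
    {x x' : κ → basisIdx H} (h : merge f y x = merge f y' x') : y = y' ∧ x = x' := by
  constructor
  · ext1 i
    rw [← merge_apply_not_mem f y x, h, merge_apply_not_mem]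
  · ext1 k
    rw [← merge_apply_mem f y x, h, merge_apply_mem]

/-- `x ↦ x ⊗ Ψ_y`: the vector `x` is placed in the factors `f k`, `k : κ`, and the basis vector
`⨂ ψ_{y i}` in the remaining ones. -/
def insertVec (f : κ ↪ ι) (y : {i // i ∉ Set.range f} → basisIdx H) :
    TensorPow H κ →ₗᵢ[ℂ] TensorPow H ι :=
  isometryOfOrthonormal (orthonormal_basisVec.comp (merge f y)
    fun _ _ h => (merge_injective f h).2)

theorem orthogonalFamily_insertVec (f : κ ↪ ι) :
    OrthogonalFamily ℂ (fun _ : {i // i ∉ Set.range f} → basisIdx H => TensorPow H κ)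
      (insertVec f) := by
  intro y y' hy v w
  refine inner_isometryOfOrthonormal _ (fun x' => ?_) w
  rw [inner_eq_zero_symm]
  refine inner_isometryOfOrthonormal _ (fun x => ?_) v
  exact orthonormal_basisVec.2 fun h => hy (merge_injective f h).1.symm

/-- The identification of `ℓ²(Y; ⨂_κ H)` with `⨂_ι H`, where `Y` indexes the basis of the tensor
product of the factors outside the range of `f`: `w ↦ ∑_y w_y ⊗ Ψ_y`. -/
def fibration (f : κ ↪ ι) :
    lp (fun _ : {i // i ∉ Set.range f} → basisIdx H => TensorPow H κ) 2 →ₗᵢ[ℂ] TensorPow H ι :=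
  (orthogonalFamily_insertVec f).linearIsometry

/-- `A` acting on the factors `f k`, `k : κ`, tensored with the identity on all the others. -/
def amplify (f : κ ↪ ι) (A : TensorPow H κ →L[ℂ] TensorPow H κ) :
    TensorPow H ι →L[ℂ] TensorPow H ι :=
  (fibration f).toContinuousLinearMap ∘L fiberwise A ∘L
    (fibration f).toContinuousLinearMap.adjoint

/-- The defining property of `amplify`: `(A ⊗ 1)(x ⊗ Ψ_y) = (A x) ⊗ Ψ_y`. -/
theorem amplify_insertVec (f : κ ↪ ι) (A : TensorPow H κ →L[ℂ] TensorPow H κ)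
    (y : {i // i ∉ Set.range f} → basisIdx H) (x : TensorPow H κ) :
    amplify f A (insertVec f y x) = insertVec f y (A x) := by
  classical
  have h1 : ∀ x : TensorPow H κ, insertVec f y x = fibration f (lp.single 2 y x) := fun x =>
    ((orthogonalFamily_insertVec f).linearIsometry_apply_single x).symm
  have h2 : (fibration f).toContinuousLinearMap.adjoint (fibration f (lp.single 2 y x)) =
      lp.single 2 y x :=
    congrArg (fun T => T (lp.single 2 y x)) (fibration f).adjoint_comp_self
  have h3 : fiberwise A (lp.single 2 y x) = lp.single 2 y (A x) := by
    ext z : 2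
    by_cases hz : z = y
    · subst hz; simp
    · simp [hz]
  rw [h1, h1, amplify, ContinuousLinearMap.comp_apply, ContinuousLinearMap.comp_apply, h2, h3]
  rfl

theorem adjoint_amplify (f : κ ↪ ι) (A : TensorPow H κ →L[ℂ] TensorPow H κ) :
    (amplify f A).adjoint = amplify f A.adjoint := by
  simp [amplify, ContinuousLinearMap.adjoint_comp, adjoint_fiberwise,
    ContinuousLinearMap.comp_assoc]

theorem norm_amplify_le (f : κ ↪ ι) (A : TensorPow H κ →L[ℂ] TensorPow H κ) :
    ‖amplify f A‖ ≤ ‖A‖ := by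
  have h1 := (fibration (H := H) f).norm_toContinuousLinearMap_le
  have h2 : ‖(fibration (H := H) f).toContinuousLinearMap.adjoint‖ ≤ 1 := by
    rwa [LinearIsometryEquiv.norm_map]
  calc ‖amplify f A‖ ≤ 1 * (‖A‖ * 1) := by
        refine (ContinuousLinearMap.opNorm_comp_le _ _).trans ?_
        refine mul_le_mul h1 ?_ (norm_nonneg _) zero_le_one
        refine (ContinuousLinearMap.opNorm_comp_le _ _).trans ?_
        exact mul_le_mul (norm_fiberwise_le A) h2 (norm_nonneg _) (norm_nonneg _)
    _ = ‖A‖ := by ring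

theorem continuous_amplify {C : Type*} [TopologicalSpace C] (f : κ ↪ ι)
    (A : C → TensorPow H κ →L[ℂ] TensorPow H κ) (hA : ∀ x, Continuous fun σ => A σ x)
    (hb : ∀ σ, ‖A σ‖ ≤ 1) (x : TensorPow H ι) : Continuous fun σ => amplify f (A σ) x :=
  (fibration f).continuous.comp (continuous_fiberwise A hA hb _)

/-- Partial trace over the factors outside the range of `f`: the sum of `V_y* T V_y` with
`V_y x = x ⊗ Ψ_y`. It converges absolutely in operator norm for trace class `T`. -/
def partialTrace (f : κ ↪ ι) (T : TensorPow H ι →L[ℂ] TensorPow H ι) :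
    TensorPow H κ →L[ℂ] TensorPow H κ :=
  ∑' y, (insertVec f y).toContinuousLinearMap.adjoint ∘L T ∘L
    (insertVec f y).toContinuousLinearMap

/-- The unitary `U_π (φ_1 ⊗ ⋯ ⊗ φ_N) = φ_{π 1} ⊗ ⋯ ⊗ φ_{π N}`. -/
def permute (π : Equiv.Perm ι) : TensorPow H ι →ₗᵢ[ℂ] TensorPow H ι :=
  isometryOfOrthonormal (orthonormal_basisVec.comp (fun α => α ∘ π)
    fun _ _ h => π.surjective.injective_comp_right h)

/-- The identification of `H` with its first tensor power. -/
def oneParticle : H →ₗᵢ[ℂ] TensorPow H (Fin 1) :=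
  (isometryOfOrthonormal (orthonormal_basisVec.comp (fun (j : basisIdx H) (_ : Fin 1) => j)
    fun _ _ h => congrFun h 0)).comp (basis H).repr.toLinearIsometry

/-- An operator on `H` as an operator on the first tensor power. -/
def liftOp (A : H →L[ℂ] H) : TensorPow H (Fin 1) →L[ℂ] TensorPow H (Fin 1) :=
  oneParticle.toContinuousLinearMap ∘L A ∘L oneParticle.toContinuousLinearMap.adjoint

/-- An operator on the first tensor power as an operator on `H`. -/
def lowerOp (T : TensorPow H (Fin 1) →L[ℂ] TensorPow H (Fin 1)) : H →L[ℂ] H :=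
  oneParticle.toContinuousLinearMap.adjoint ∘L T ∘L oneParticle.toContinuousLinearMap

/-- `A_i`: the operator `A` acting on the `i`-th factor only. -/
def atFactor (i : ι) (A : H →L[ℂ] H) : TensorPow H ι →L[ℂ] TensorPow H ι :=
  amplify ⟨fun _ : Fin 1 => i, fun _ _ _ => Subsingleton.elim _ _⟩ (liftOp A)

/-- `A ⊗ ⋯ ⊗ A` (`k` factors). -/
def tensorPowOp (k : ℕ) (A : H →L[ℂ] H) : TensorPow H (Fin k) →L[ℂ] TensorPow H (Fin k) :=
  (List.ofFn fun i => atFactor i A).prod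

/-- `A ⊗ B` on the two-particle space. -/
def tensorOp (A B : H →L[ℂ] H) : TensorPow H (Fin 2) →L[ℂ] TensorPow H (Fin 2) :=
  atFactor 0 A * atFactor 1 B

end Tensor

section Average
variable {C K : Type*} [MetricSpace C] [CompactSpace C] [MeasurableSpace C] [BorelSpace C]
  [NormedAddCommGroup K] [InnerProductSpace ℂ K] [CompleteSpace K]

/-- Families of contractions for which `W(σ) A W(σ)*` can be averaged strongly over `σ`. -/
structure IsContractiveFamily (W : C → K →L[ℂ] K) : Prop where
  cont : ∀ x, Continuous fun σ => W σ x
  cont_adjoint : ∀ x, Continuous fun σ => (W σ).adjoint x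
  norm_le : ∀ σ, ‖W σ‖ ≤ 1

variable {W : C → K →L[ℂ] K}

theorem IsContractiveFamily.continuous_conj (hW : IsContractiveFamily W) (A : K →L[ℂ] K) (x : K) :
    Continuous fun σ => W σ (A ((W σ).adjoint x)) := by
  have h : Continuous fun p : C × K => W p.1 p.2 := by
    refine continuous_prod_of_continuous_lipschitzWith' _ 1 (fun σ => ?_) hW.cont
    exact (W σ).lipschitz.weaken (hW.norm_le σ)
  exact h.comp (continuous_id.prodMk (A.continuous.comp (hW.cont_adjoint x)))

theorem IsContractiveFamily.integrable (hW : IsContractiveFamily W) (ν : Measure C)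
    [IsFiniteMeasure ν] (A : K →L[ℂ] K) (x : K) :
    Integrable (fun σ => W σ (A ((W σ).adjoint x))) ν :=
  (hW.continuous_conj A x).integrable_of_hasCompactSupport (HasCompactSupport.of_compactSpace _)

theorem IsContractiveFamily.norm_conj_le (hW : IsContractiveFamily W) (A : K →L[ℂ] K) (x : K)
    (σ : C) : ‖W σ (A ((W σ).adjoint x))‖ ≤ ‖A‖ * ‖x‖ := by
  have h1 : ‖(W σ).adjoint‖ ≤ 1 := by
    rw [LinearIsometryEquiv.norm_map]; exact hW.norm_le σ
  calc _ ≤ ‖A ((W σ).adjoint x)‖ := (W σ).le_of_opNorm_le_of_le (hW.norm_le σ) le_rfl |>.trans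
            (by rw [one_mul])
    _ ≤ ‖A‖ * ‖(W σ).adjoint x‖ := A.le_opNorm _
    _ ≤ ‖A‖ * ‖x‖ := by
        gcongr
        exact ((W σ).adjoint.le_of_opNorm_le h1 x).trans (by rw [one_mul])

theorem IsContractiveFamily.norm_integral_le (hW : IsContractiveFamily W) (ν : Measure C)
    [IsProbabilityMeasure ν] (A : K →L[ℂ] K) (x : K) :
    ‖∫ σ, W σ (A ((W σ).adjoint x)) ∂ν‖ ≤ ‖A‖ * ‖x‖ := by
  have h := norm_integral_le_of_norm_le_const (μ := ν)
    (Filter.Eventually.of_forall (hW.norm_conj_le A x))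
  simpa using h

/-- The operator `∫ W(σ) A W(σ)* dν(σ)` (strong integral). -/
def averageOp (hW : IsContractiveFamily W) (ν : Measure C) [IsProbabilityMeasure ν]
    (A : K →L[ℂ] K) : K →L[ℂ] K :=
  LinearMap.mkContinuous
    { toFun := fun x => ∫ σ, W σ (A ((W σ).adjoint x)) ∂ν
      map_add' := fun x y => by
        simp only [map_add]
        exact integral_add (hW.integrable ν A x) (hW.integrable ν A y)
      map_smul' := fun c x => by
        simp only [map_smul, RingHom.id_apply]
        exact integral_smul _ _ } ‖A‖ (hW.norm_integral_le ν A)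

theorem norm_averageOp_le (hW : IsContractiveFamily W) (ν : Measure C) [IsProbabilityMeasure ν]
    (A : K →L[ℂ] K) : ‖averageOp hW ν A‖ ≤ ‖A‖ :=
  LinearMap.mkContinuous_norm_le _ (norm_nonneg _) (hW.norm_integral_le ν A)

/-- The linear map `A ↦ ∫ W(σ) A W(σ)* dν(σ)` on bounded operators. -/
def average (hW : IsContractiveFamily W) (ν : Measure C) [IsProbabilityMeasure ν] :
    (K →L[ℂ] K) →L[ℂ] (K →L[ℂ] K) :=
  LinearMap.mkContinuous
    { toFun := averageOp hW ν
      map_add' := fun A B => by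
        ext x
        exact (integral_congr_ae (Filter.Eventually.of_forall fun σ => by simp)).trans
          (integral_add (hW.integrable ν A x) (hW.integrable ν B x))
      map_smul' := fun c A => by
        ext x
        exact (integral_congr_ae (Filter.Eventually.of_forall fun σ => by simp)).trans
          (integral_smul c _) } 1 fun A => by
    rw [one_mul]
    exact norm_averageOp_le hW ν A

theorem norm_unitary_le (u : unitary (K →L[ℂ] K)) : ‖(u : K →L[ℂ] K)‖ ≤ 1 := by
  refine ContinuousLinearMap.opNorm_le_bound _ zero_le_one fun x => ?_
  rw [one_mul, Unitary.norm_map]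

theorem continuous_adjoint_unitary (U : C → unitary (K →L[ℂ] K))
    (hU : ∀ x, Continuous fun σ => (U σ : K →L[ℂ] K) x) (x : K) :
    Continuous fun σ => (U σ : K →L[ℂ] K).adjoint x := by
  have key : ∀ σ y, (U σ : K →L[ℂ] K) ((U σ : K →L[ℂ] K).adjoint y) = y := fun σ y =>
    congrArg (fun T : K →L[ℂ] K => T y) (Unitary.mul_star_self_of_mem (U σ).2)
  rw [continuous_iff_continuousAt]
  intro σ₀
  rw [ContinuousAt, tendsto_iff_norm_sub_tendsto_zero]
  have h1 : ∀ σ, ‖(U σ : K →L[ℂ] K).adjoint x - (U σ₀ : K →L[ℂ] K).adjoint x‖ =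
      ‖x - (U σ : K →L[ℂ] K) ((U σ₀ : K →L[ℂ] K).adjoint x)‖ := fun σ => by
    rw [← Unitary.norm_map (U σ), map_sub, key]
  simp only [h1]
  have h2 : Continuous fun σ => ‖x - (U σ : K →L[ℂ] K) ((U σ₀ : K →L[ℂ] K).adjoint x)‖ :=
    (continuous_const.sub (hU _)).norm
  have h3 := h2.tendsto σ₀
  simpa only [key, sub_self, norm_zero] using h3

end Average

section Model
variable {H : Type*} [NormedAddCommGroup H] [InnerProductSpace ℂ H] [CompleteSpace H]

/-- The exponential of a bounded linear map of the Banach space of bounded operators on `K`. -/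
def expSuperOp {K : Type*} [NormedAddCommGroup K] [InnerProductSpace ℂ K] [CompleteSpace K]
    (L : (K →L[ℂ] K) →L[ℂ] (K →L[ℂ] K)) : (K →L[ℂ] K) →L[ℂ] (K →L[ℂ] K) :=
  NormedSpace.exp L

/-- `h` has a compact resolvent: `(h - z)⁻¹` exists and is compact for some `z`. -/
def HasCompactResolvent (h : H →ₗ.[ℂ] H) : Prop :=
  ∃ (z : ℂ) (R : H →L[ℂ] H), IsCompactOperator R ∧
    (∀ x, ∃ hx : R x ∈ h.domain, h ⟨R x, hx⟩ - z • R x = x) ∧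
    ∀ y : h.domain, R (h y - z • (y : H)) = y

/-- The graph of the `N`-particle Hamiltonian `H_N = ∑ⱼ h_j`: the closure of the operator
`⨂ φᵢ ↦ ∑ⱼ φ_1 ⊗ ⋯ ⊗ h φ_j ⊗ ⋯ ⊗ φ_N` on the algebraic tensor power of the domain of `h`. -/
def hamiltonianGraph (h : H →ₗ.[ℂ] H) (N : ℕ) :
    Submodule ℂ (TensorPow H (Fin N) × TensorPow H (Fin N)) :=
  (Submodule.span ℂ {p | ∃ φ : Fin N → h.domain,
    p = (tprod fun i => (φ i : H),
      ∑ j, tprod (Function.update (fun i => (φ i : H)) j (h (φ j))))}).topologicalClosure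

/-- A collision specification `(C, U, ν)` for the one-particle Hamiltonian `h`. -/
structure CollisionSpec (h : H →ₗ.[ℂ] H) (C : Type*) [MetricSpace C] [CompactSpace C]
    [MeasurableSpace C] [BorelSpace C] where
  /-- The scattering matrices, unitaries on `H ⊗ H`. -/
  U : C → unitary (TensorPow H (Fin 2) →L[ℂ] TensorPow H (Fin 2))
  /-- Continuity in the strong operator topology. -/
  continuous_U : ∀ x, Continuous fun σ => (U σ : TensorPow H (Fin 2) →L[ℂ] TensorPow H (Fin 2)) x
  injective_U : Function.Injective U
  /-- A Borel probability measure charging every non-empty open set. -/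
  ν : Measure C
  isProbabilityMeasure_ν : IsProbabilityMeasure ν
  isOpenPosMeasure_ν : ν.IsOpenPosMeasure
  /-- `U(σ)` commutes with `H_2`: `(x, y)` lies in the graph iff `(U(σ) x, U(σ) y)` does, that is,
  `U(σ)* H_2 U(σ) = H_2`. -/
  commutes : ∀ σ (p : TensorPow H (Fin 2) × TensorPow H (Fin 2)),
    ((U σ : TensorPow H (Fin 2) →L[ℂ] TensorPow H (Fin 2)) p.1,
      (U σ : TensorPow H (Fin 2) →L[ℂ] TensorPow H (Fin 2)) p.2) ∈ hamiltonianGraph h 2 ↔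
    p ∈ hamiltonianGraph h 2
  exists_one : ∃ σ₀, U σ₀ = 1
  /-- Time reversal: `U(σ)* = U(σ')` with `σ ↦ σ'` measurable and `ν`-preserving (hence
  `{U(σ)} = {U(σ)*}`). -/
  reversible : ∃ τ : C → C, MeasurePreserving τ ν ν ∧ ∀ σ, star (U σ) = U (τ σ)
  /-- Exchange of the particles: `V U(σ) V* = U(σ')` with `V` the swap and `σ ↦ σ'` measurable and
  `ν`-preserving (hence `{U(σ)} = {V U(σ) V*}`). -/
  swap_symm : ∃ τ : C → C, MeasurePreserving τ ν ν ∧ ∀ σ,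
    (permute (Equiv.swap 0 1)).toContinuousLinearMap ∘L
      (U σ : TensorPow H (Fin 2) →L[ℂ] TensorPow H (Fin 2)) ∘L
      (permute (Equiv.swap 0 1)).toContinuousLinearMap.adjoint =
    (U (τ σ) : TensorPow H (Fin 2) →L[ℂ] TensorPow H (Fin 2))

attribute [instance] CollisionSpec.isProbabilityMeasure_ν

variable {h : H →ₗ.[ℂ] H} {C : Type*} [MetricSpace C] [CompactSpace C] [MeasurableSpace C]
  [BorelSpace C]

/-- `U(σ)` as a bounded operator. -/
def CollisionSpec.op (S : CollisionSpec h C) (σ : C) :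
    TensorPow H (Fin 2) →L[ℂ] TensorPow H (Fin 2) := S.U σ

theorem CollisionSpec.isContractiveFamily_op (S : CollisionSpec h C) :
    IsContractiveFamily S.op where
  cont := S.continuous_U
  norm_le σ := norm_unitary_le (S.U σ)
  cont_adjoint := continuous_adjoint_unitary S.U S.continuous_U

/-- `U_{i,j}(σ)`: the operator `U(σ)` acting on the factors `p 0 = i` and `p 1 = j`. -/
def CollisionSpec.opAt (S : CollisionSpec h C) {ι : Type} (p : Fin 2 ↪ ι) (σ : C) :
    TensorPow H ι →L[ℂ] TensorPow H ι := amplify p (S.op σ)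

theorem CollisionSpec.isContractiveFamily_opAt (S : CollisionSpec h C) {ι : Type} (p : Fin 2 ↪ ι) :
    IsContractiveFamily (S.opAt p) where
  cont := continuous_amplify p S.op S.isContractiveFamily_op.cont S.isContractiveFamily_op.norm_le
  norm_le σ := (norm_amplify_le p _).trans (S.isContractiveFamily_op.norm_le σ)
  cont_adjoint x := by
    simp only [CollisionSpec.opAt, adjoint_amplify]
    exact continuous_amplify p _ S.isContractiveFamily_op.cont_adjoint (fun σ => by
      rw [LinearIsometryEquiv.norm_map]; exact S.isContractiveFamily_op.norm_le σ) x

/-- `Q_{i,j} A = ∫ U_{i,j}(σ) A U_{i,j}(σ)* dν(σ)`, for `p 0 = i` and `p 1 = j`. -/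
def CollisionSpec.collision (S : CollisionSpec h C) {ι : Type} (p : Fin 2 ↪ ι) :
    (TensorPow H ι →L[ℂ] TensorPow H ι) →L[ℂ] (TensorPow H ι →L[ℂ] TensorPow H ι) :=
  average (S.isContractiveFamily_opAt p) S.ν

/-- The pair of particles `i < j`. -/
def pairEmb {N : ℕ} (i j : Fin N) (hij : i < j) : Fin 2 ↪ Fin N :=
  ⟨![i, j], by
    intro a b
    fin_cases a <;> fin_cases b <;> simp [hij.ne, hij.ne']⟩

/-- `Q_N = (N choose 2)⁻¹ ∑_{i<j} Q_{i,j}` (of interest for `N ≥ 2`). -/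
def CollisionSpec.kacAverage (S : CollisionSpec h C) (N : ℕ) :
    (TensorPow H (Fin N) →L[ℂ] TensorPow H (Fin N)) →L[ℂ]
      (TensorPow H (Fin N) →L[ℂ] TensorPow H (Fin N)) :=
  (N.choose 2 : ℂ)⁻¹ • ∑ i : Fin N, ∑ j : Fin N,
    if hij : i < j then S.collision (pairEmb i j hij) else 0

/-- The quantum Kac generator `L_N = N (Q_N - 1)` (of interest for `N ≥ 2`). -/
def CollisionSpec.kacGenerator (S : CollisionSpec h C) (N : ℕ) :
    (TensorPow H (Fin N) →L[ℂ] TensorPow H (Fin N)) →L[ℂ]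
      (TensorPow H (Fin N) →L[ℂ] TensorPow H (Fin N)) :=
  (N : ℂ) • (S.kacAverage N - 1)

/-- `exp (t L_N)`. -/
def CollisionSpec.kacSemigroup (S : CollisionSpec h C) (N : ℕ) (t : ℝ) :
    (TensorPow H (Fin N) →L[ℂ] TensorPow H (Fin N)) →L[ℂ]
      (TensorPow H (Fin N) →L[ℂ] TensorPow H (Fin N)) :=
  expSuperOp ((t : ℂ) • S.kacGenerator N)

/-- The collision operator `Q A = ∫ U(σ) A U(σ)* dν(σ)` on the two-particle space. -/
def CollisionSpec.collisionOp (S : CollisionSpec h C) :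
    (TensorPow H (Fin 2) →L[ℂ] TensorPow H (Fin 2)) →L[ℂ]
      (TensorPow H (Fin 2) →L[ℂ] TensorPow H (Fin 2)) :=
  average S.isContractiveFamily_op S.ν

/-- The quantum Wild convolution `A ⋆ B = Tr_2 [Q (A ⊗ B)]`. -/
def CollisionSpec.wild (S : CollisionSpec h C) (A B : H →L[ℂ] H) : H →L[ℂ] H :=
  lowerOp (partialTrace (Fin.castAddEmb 1 : Fin 1 ↪ Fin (1 + 1))
    (S.collisionOp (tensorOp A B)))

/-- The `k`-particle reduced density matrix of a state of `k + M` particles: the last `M` factors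
are traced out. -/
def marginal (k M : ℕ) (T : TensorPow H (Fin (k + M)) →L[ℂ] TensorPow H (Fin (k + M))) :
    TensorPow H (Fin k) →L[ℂ] TensorPow H (Fin k) :=
  partialTrace (Fin.castAddEmb M) T

/-- Invariance under the action of all permutations of the factors. -/
def IsPermSymmetric {ι : Type} (T : TensorPow H ι →L[ℂ] TensorPow H ι) : Prop :=
  ∀ π : Equiv.Perm ι,
    (permute π).toContinuousLinearMap ∘L T ∘L (permute π).toContinuousLinearMap.adjoint = T

/-- `{ϱ_N}` is `ρ`-chaotic: `ϱ_N^{(k)} → ρ^{⊗k}` in trace norm for each `k ≥ 1`, the `ϱ_N` being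
symmetric density matrices. Systems of `N ≥ 2` particles are meant; `N` is `k + M` in the limit. -/
def IsChaotic (ρ : H →L[ℂ] H)
    (ϱ : ∀ N : ℕ, TensorPow H (Fin N) →L[ℂ] TensorPow H (Fin N)) : Prop :=
  IsDensityMatrix ρ ∧
  (∀ N, 2 ≤ N → IsDensityMatrix (ϱ N) ∧ IsPermSymmetric (ϱ N)) ∧
  ∀ k, 1 ≤ k → Tendsto (fun M => traceNorm (marginal k M (ϱ (k + M)) - tensorPowOp k ρ))
    atTop (𝓝 0)

/-- `ρ` has derivative `G` at `t` within `s`, with respect to the trace norm. -/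
def HasTraceNormDerivWithinAt (ρ : ℝ → H →L[ℂ] H) (G : H →L[ℂ] H) (s : Set ℝ) (t : ℝ) : Prop :=
  Tendsto (fun r : ℝ => traceNorm (((r - t : ℝ) : ℂ)⁻¹ • (ρ r - ρ t) - G)) (𝓝[s \ {t}] t) (𝓝 0)

/-- `ρ(t)`, `t ≥ 0`, are density matrices with `dρ/dt = 2 (ρ ⋆ ρ - ρ)` in trace norm (from the right
at `t = 0`). -/
def CollisionSpec.SolvesQKBE (S : CollisionSpec h C) (ρ : ℝ → H →L[ℂ] H) : Prop :=
  ∀ t, 0 ≤ t → IsDensityMatrix (ρ t) ∧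
    HasTraceNormDerivWithinAt ρ ((2 : ℂ) • (S.wild (ρ t) (ρ t) - ρ t)) (Set.Ici 0) t

end Model
end QuantumKac

end

open QuantumKac
open scoped InnerProductSpace ENNReal Topology
open MeasureTheory Filter

/-!
Trace class operators, with the trace norm, form a Banach space on which the collision averages, the
partial traces and the Kac generator are bounded. The partial trace to `k` particles of the
generator applied to a symmetric state is, up to an error of order `k² / N`, a fixed linear
expression in the reduced density matrices of orders `k` and `k + 1`. The tensor powers of a
solution of the Kac–Boltzmann equation solve this limiting hierarchy exactly. Hence the differences
between the reduced density matrices and the tensor powers satisfy a closed chain of differential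
inequalities, which is iterated from the trivial bound `2 · 2 ^ k`: on a time interval of length
`τ`, `m` iterations multiply this bound by `(8 τ) ^ m` and a binomial coefficient, which is at most
`2 ^ (k + m)`, so the differences vanish in the limit when `τ` is small. The admissible `τ`, and the
time for which the Kac–Boltzmann equation can be solved by Picard iteration, depend only on the
trace norm of the initial state, which is `1`, so the semigroup property carries chaos over to all
times.
-/

noncomputable section

namespace QuantumKac

section RussoDye
variable {A : Type*} [CStarAlgebra A] [PartialOrder A] [StarOrderedRing A] {a : A}

theorem exists_unitary_mul_abs_eq (ha : IsUnit a) : ∃ u ∈ unitary A, u * CFC.abs a = a := by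
  have habs : IsUnit (CFC.abs a) := by
    rw [← isUnit_pow_iff two_ne_zero, CFC.abs_sq]
    exact ha.star.mul ha
  obtain ⟨p, hp⟩ := habs
  have hp_star : star (↑p⁻¹ : A) = ↑p⁻¹ := by
    have : star p = p := Units.ext (by rw [Units.coe_star, hp, (CFC.abs_nonneg a).star_eq])
    rw [← Units.coe_star, star_inv, this]
  have hleft : star (a * ↑p⁻¹) * (a * ↑p⁻¹) = 1 := by
    rw [star_mul, hp_star, mul_assoc, ← mul_assoc (star a), ← CFC.abs_sq, ← hp, sq,
      Units.mul_inv_cancel_right, Units.inv_mul]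
  have hunit : IsUnit (a * ↑p⁻¹) := ha.mul p⁻¹.isUnit
  refine ⟨a * ↑p⁻¹, Unitary.mem_iff.mpr ⟨hleft, ?_⟩, by rw [← hp, Units.inv_mul_cancel_right]⟩
  exact hunit.mul_right_cancel (by rw [mul_assoc, hleft, mul_one, one_mul])

theorem exists_unitary_add_unitary_eq (hsa : IsSelfAdjoint a) (ha : ‖a‖ ≤ 2) :
    ∃ v ∈ unitary A, ∃ w ∈ unitary A, v + w = a := by
  let b : selfAdjoint A := ⟨(2⁻¹ : ℝ) • a, (IsSelfAdjoint.all _).smul hsa⟩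
  have hb : ‖b‖ ≤ 1 := by
    change ‖(2⁻¹ : ℝ) • a‖ ≤ 1
    rw [norm_smul, Real.norm_of_nonneg (by norm_num)]
    linarith
  let v := selfAdjoint.unitarySelfAddISMul b hb
  refine ⟨v, v.2, ↑(star v), (star v).2, ?_⟩
  rw [Unitary.coe_star, selfAdjoint.star_coe_unitarySelfAddISMul,
    selfAdjoint.unitarySelfAddISMul_coe]
  change (2⁻¹ : ℝ) • a + _ + ((2⁻¹ : ℝ) • a - _) = a
  module

theorem exists_unitary_add_unitary_eq_add {u : A} (hu : u ∈ unitary A) (ha : ‖a‖ < 1) :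
    ∃ v ∈ unitary A, ∃ w ∈ unitary A, v + w = u + a := by
  set b := star u * a
  have hb : ‖b‖ < 1 := by rwa [CStarRing.norm_mem_unitary_mul a (Unitary.star_mem hu)]
  have hunit : IsUnit (1 + b) := by
    simpa using isUnit_one_sub_of_norm_lt_one (x := -b) (by rwa [norm_neg])
  obtain ⟨c, hc, hcb⟩ := exists_unitary_mul_abs_eq hunit
  have habs : ‖CFC.abs (1 + b)‖ ≤ 2 := by
    nontriviality A
    rw [CFC.norm_abs]
    linarith [norm_add_le 1 b, CStarRing.norm_one (E := A)]
  obtain ⟨v, hv, w, hw, hvw⟩ :=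
    exists_unitary_add_unitary_eq (CFC.abs_nonneg (1 + b)).isSelfAdjoint habs
  refine ⟨u * c * v, mul_mem (mul_mem hu hc) hv, u * c * w, mul_mem (mul_mem hu hc) hw, ?_⟩
  rw [← mul_add, hvw, mul_assoc, hcb, mul_add, mul_one, ← mul_assoc,
    Unitary.mul_star_self_of_mem hu, one_mul]

/-- The map `d ↦ (d + a) / 2` preserves the convex hull, and its iterates converge to `a`. -/
theorem mem_closure_convexHull_unitary_of_norm_lt_one (ha : ‖a‖ < 1) :
    a ∈ closure (convexHull ℝ (unitary A : Set A)) := by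
  let f : A → A := fun d => (2⁻¹ : ℝ) • (d + a)
  have hf : Set.MapsTo f (convexHull ℝ (unitary A)) (convexHull ℝ (unitary A)) := by
    have hconv : Convex ℝ (f ⁻¹' convexHull ℝ (unitary A : Set A)) :=
      ((convex_convexHull ℝ _).smul_preimage _).translate_preimage_left a
    refine convexHull_min (fun u hu => ?_) hconv
    obtain ⟨v, hv, w, hw, hvw⟩ := exists_unitary_add_unitary_eq_add hu ha
    have := (convex_convexHull ℝ (unitary A : Set A)) (subset_convexHull ℝ _ hv)
      (subset_convexHull ℝ _ hw) (a := 2⁻¹) (b := 2⁻¹) (by norm_num) (by norm_num) (by norm_num)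
    rwa [← smul_add, hvw] at this
  have hiter : ∀ n, f^[n] 1 = a + (2⁻¹ ^ n : ℝ) • (1 - a) := by
    intro n
    induction n with
    | zero => simp
    | succ n ih =>
      rw [Function.iterate_succ_apply', ih, pow_succ]
      module
  refine mem_closure_of_tendsto (b := atTop) (f := fun n : ℕ => f^[n] 1) ?_
    (.of_forall fun n => hf.iterate n (subset_convexHull ℝ _ (one_mem _)))
  simp only [hiter]
  simpa using (tendsto_pow_atTop_nhds_zero_of_lt_one (r := (2⁻¹ : ℝ)) (by norm_num)
    (by norm_num)).smul_const (1 - a) |>.const_add a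

theorem closedBall_subset_closure_convexHull_unitary :
    Metric.closedBall (0 : A) 1 ⊆ closure (convexHull ℝ (unitary A)) := by
  rw [← closure_ball _ one_ne_zero]
  refine closure_minimal (fun a ha => ?_) isClosed_closure
  exact mem_closure_convexHull_unitary_of_norm_lt_one (mem_ball_zero_iff.mp ha)

end RussoDye

theorem norm_mul_abs_left {A : Type*} [CStarAlgebra A] [PartialOrder A] [StarOrderedRing A]
    (a x : A) : ‖CFC.abs a * x‖ = ‖a * x‖ := by
  have h : ‖star (CFC.abs a * x) * (CFC.abs a * x)‖ = ‖star (a * x) * (a * x)‖ := by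
    simp only [star_mul, (CFC.abs_nonneg a).star_eq]
    rw [mul_assoc, ← mul_assoc (CFC.abs a), CFC.abs_mul_abs, mul_assoc, mul_assoc]
  simpa only [CStarRing.norm_star_mul_self, mul_self_inj (norm_nonneg _) (norm_nonneg _)] using h

theorem exists_approx_polar {A : Type*} [CStarAlgebra A] [PartialOrder A] [StarOrderedRing A]
    (a : A) {ε : ℝ} (hε : 0 < ε) :
    ∃ v : A, ‖v‖ ≤ 1 ∧ ‖v * CFC.abs a - a‖ ≤ ε ∧ ‖star v * a - CFC.abs a‖ ≤ ε := by
  set p := CFC.abs a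
  have hspec : ∀ x ∈ spectrum ℝ p, 0 ≤ x := fun x hx =>
    spectrum_nonneg_of_nonneg (CFC.abs_nonneg a) hx
  have hcont : ContinuousOn (fun x : ℝ => (x + ε)⁻¹) (spectrum ℝ p) :=
    (continuousOn_id.add continuousOn_const).inv₀ fun x hx =>
      (add_pos_of_nonneg_of_pos (hspec x hx) hε).ne'
  let q := cfc (fun x : ℝ => (x + ε)⁻¹) p
  have hqp : q * p = cfc (fun x : ℝ => (x + ε)⁻¹ * x) p := by
    rw [cfc_mul _ _ p hcont, cfc_id' ℝ p]
  have hcomm : Commute p q := by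
    simpa only [cfc_id' ℝ p] using cfc_commute_cfc (fun x : ℝ => x) (fun x => (x + ε)⁻¹) p
  have hqp_norm : ‖q * p‖ ≤ 1 := by
    rw [hqp]
    refine norm_cfc_le zero_le_one fun x hx => ?_
    have := hspec x hx
    rw [Real.norm_of_nonneg (by positivity), inv_mul_le_one₀ (by positivity)]
    linarith
  have hqp_sub : q * p - 1 = -(ε • q) := by
    have hadd := cfc_add p (fun x : ℝ => (x + ε)⁻¹ * x) (fun x => ε * (x + ε)⁻¹)
      (hcont.mul continuousOn_id) (continuousOn_const.mul hcont)
    rw [cfc_const_mul ε _ p hcont, ← hqp] at hadd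
    rw [sub_eq_iff_eq_add, neg_add_eq_sub, eq_sub_iff_add_eq, ← hadd, ← cfc_const_one ℝ p]
    refine cfc_congr fun x hx => ?_
    have := hspec x hx
    field_simp
  have hv : ‖a * q‖ ≤ 1 := by rwa [← norm_mul_abs_left, hcomm.eq]
  refine ⟨a * q, hv, ?_, ?_⟩
  · have : a * q * p - a = -(ε • (a * q)) := by
      rw [mul_assoc, ← mul_sub_one, hqp_sub, mul_neg, mul_smul_comm]
    rw [this, norm_neg, norm_smul, Real.norm_of_nonneg hε.le]
    exact mul_le_of_le_one_right hε.le hv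
  · have : star (a * q) * a - p = -(ε • (q * p)) := by
      rw [star_mul, (cfc_predicate _ p : IsSelfAdjoint q).star_eq, mul_assoc, ← CFC.abs_mul_abs,
        ← mul_assoc, ← sub_one_mul, hqp_sub, neg_mul, smul_mul_assoc]
    rw [this, norm_neg, norm_smul, Real.norm_of_nonneg hε.le]
    exact mul_le_of_le_one_right hε.le hqp_norm

section TraceNorm
variable {K : Type*} [NormedAddCommGroup K] [InnerProductSpace ℂ K] {S T : K →L[ℂ] K}

theorem traceNorm_le {c : ℝ≥0∞} (h : ∀ (n : ℕ) (e f : Fin n → K), Orthonormal ℂ e →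
    Orthonormal ℂ f → ∑ i, ‖⟪f i, T (e i)⟫_ℂ‖ₑ ≤ c) : traceNorm T ≤ c := by
  simpa only [traceNorm, iSup_le_iff] using h

theorem sum_enorm_inner_le_traceNorm {ι : Type*} [Fintype ι] {e f : ι → K}
    (he : Orthonormal ℂ e) (hf : Orthonormal ℂ f) :
    ∑ i, ‖⟪f i, T (e i)⟫_ℂ‖ₑ ≤ traceNorm T := by
  let g := (Fintype.equivFin ι).symm
  rw [← Equiv.sum_comp g]
  exact le_iSup_of_le _ <| le_iSup_of_le (e ∘ g) <| le_iSup_of_le (f ∘ g) <|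
    le_iSup_of_le (he.comp g g.injective) <| le_iSup_of_le (hf.comp g g.injective) le_rfl

theorem tsum_enorm_inner_le_traceNorm {ι : Type*} {e f : ι → K}
    (he : Orthonormal ℂ e) (hf : Orthonormal ℂ f) :
    ∑' i, ‖⟪f i, T (e i)⟫_ℂ‖ₑ ≤ traceNorm T := by
  rw [ENNReal.tsum_eq_iSup_sum]
  refine iSup_le fun s => ?_
  rw [← Finset.sum_coe_sort s]
  exact sum_enorm_inner_le_traceNorm (he.comp _ Subtype.val_injective)
    (hf.comp _ Subtype.val_injective)

theorem traceNorm_zero : traceNorm (0 : K →L[ℂ] K) = 0 :=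
  le_antisymm (traceNorm_le fun n e f _ _ => by simp) zero_le

theorem traceNorm_add_le : traceNorm (S + T) ≤ traceNorm S + traceNorm T := by
  refine traceNorm_le fun n e f he hf => ?_
  calc ∑ i, ‖⟪f i, (S + T) (e i)⟫_ℂ‖ₑ
      ≤ ∑ i, (‖⟪f i, S (e i)⟫_ℂ‖ₑ + ‖⟪f i, T (e i)⟫_ℂ‖ₑ) :=
        Finset.sum_le_sum fun i _ => by
          rw [add_apply, inner_add_right]
          exact enorm_add_le _ _
    _ ≤ traceNorm S + traceNorm T := by
        rw [Finset.sum_add_distrib]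
        exact add_le_add (sum_enorm_inner_le_traceNorm he hf) (sum_enorm_inner_le_traceNorm he hf)

theorem traceNorm_smul (c : ℂ) : traceNorm (c • T) = ‖c‖ₑ * traceNorm T := by
  simp only [traceNorm, ENNReal.mul_iSup, Finset.mul_sum, smul_apply, inner_smul_right, enorm_mul]

theorem traceNorm_neg : traceNorm (-T) = traceNorm T := by
  simpa using traceNorm_smul (T := T) (-1)

theorem traceNorm_midpoint_le {c : ℝ≥0∞} (hS : traceNorm S ≤ c)
    (hT : traceNorm T ≤ c) : traceNorm ((2⁻¹ : ℂ) • (S + T)) ≤ c := by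
  have h2 : ‖(2⁻¹ : ℂ)‖ₑ = 2⁻¹ := by
    rw [enorm_inv two_ne_zero, ← ofReal_norm, Complex.norm_ofNat, ENNReal.ofReal_ofNat]
  calc traceNorm ((2⁻¹ : ℂ) • (S + T)) ≤ 2⁻¹ * (c + c) := by
        rw [traceNorm_smul, h2]
        gcongr
        exact traceNorm_add_le.trans (add_le_add hS hT)
    _ = c := by
        rw [← two_mul, ← mul_assoc, ENNReal.inv_mul_cancel two_ne_zero ENNReal.ofNat_ne_top,
          one_mul]

theorem enorm_inner_le_traceNorm {x y : K} (hx : ‖x‖ = 1) (hy : ‖y‖ = 1) :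
    ‖⟪x, T y⟫_ℂ‖ₑ ≤ traceNorm T := by
  have horth : ∀ z : K, ‖z‖ = 1 → Orthonormal ℂ fun _ : Unit => z := fun z hz =>
    ⟨fun _ => hz, fun _ _ h => (h rfl).elim⟩
  simpa using sum_enorm_inner_le_traceNorm (T := T) (horth y hy) (horth x hx)

theorem enorm_le_traceNorm : ‖T‖ₑ ≤ traceNorm T := by
  by_cases h : traceNorm T = ∞
  · simp [h]
  rw [← ofReal_norm, ENNReal.ofReal_le_iff_le_toReal h]
  refine ContinuousLinearMap.opNorm_le_of_unit_norm ENNReal.toReal_nonneg fun y hy => ?_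
  rcases eq_or_ne (T y) 0 with h0 | h0
  · simp [h0]
  have hle := enorm_inner_le_traceNorm (T := T) (x := (‖T y‖⁻¹ : ℂ) • T y)
    (norm_smul_inv_norm h0) hy
  have hinner : ⟪(‖T y‖⁻¹ : ℂ) • T y, T y⟫_ℂ = (‖T y‖ : ℂ) := by
    rw [inner_smul_left, inner_self_eq_norm_sq_to_K, map_inv₀, Complex.conj_ofReal, sq]
    exact inv_mul_cancel_left₀ (by simpa using h0) _
  rwa [hinner, ← ofReal_norm, ENNReal.ofReal_le_iff_le_toReal h, Complex.norm_real,
    norm_norm] at hle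

theorem traceNorm_le_of_tendsto_inner {ι : Type*} {l : Filter ι} [l.NeBot] {S : ι → K →L[ℂ] K}
    (h : ∀ x y, Tendsto (fun i => ⟪x, S i y⟫_ℂ) l (𝓝 ⟪x, T y⟫_ℂ)) {c : ℝ≥0∞}
    (hc : ∀ᶠ i in l, traceNorm (S i) ≤ c) : traceNorm T ≤ c := by
  refine traceNorm_le fun n e f he hf => ?_
  have hsum : Tendsto (fun i => ∑ j, ‖⟪f j, S i (e j)⟫_ℂ‖ₑ) l (𝓝 (∑ j, ‖⟪f j, T (e j)⟫_ℂ‖ₑ)) :=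
    tendsto_finsetSum _ fun j _ => (h _ _).enorm
  exact le_of_tendsto hsum (hc.mono fun i hi => (sum_enorm_inner_le_traceNorm he hf).trans hi)

theorem traceNorm_le_of_tendsto {ι : Type*} {l : Filter ι} [l.NeBot] {S : ι → K →L[ℂ] K}
    (h : Tendsto S l (𝓝 T)) {c : ℝ≥0∞} (hc : ∀ᶠ i in l, traceNorm (S i) ≤ c) : traceNorm T ≤ c :=
  traceNorm_le_of_tendsto_inner (fun _ y => tendsto_const_nhds.inner
    (((ContinuousLinearMap.apply ℂ K y).continuous.tendsto T).comp h)) hc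

variable [CompleteSpace K]

theorem traceNorm_adjoint : traceNorm T.adjoint = traceNorm T := by
  have h : ∀ R : K →L[ℂ] K, traceNorm R.adjoint ≤ traceNorm R := fun R => by
    refine traceNorm_le fun n e f he hf => ?_
    refine (Finset.sum_congr rfl fun i _ => ?_).trans_le
      (sum_enorm_inner_le_traceNorm (T := R) hf he)
    rw [ContinuousLinearMap.adjoint_inner_right, ← inner_conj_symm, RCLike.enorm_conj]
  exact le_antisymm (h T) (by simpa using h T.adjoint)

theorem traceNorm_conj_le {K' : Type*} [NormedAddCommGroup K'] [InnerProductSpace ℂ K']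
    [CompleteSpace K'] (V W : K' →ₗᵢ[ℂ] K) :
    traceNorm (V.toContinuousLinearMap.adjoint ∘L T ∘L W.toContinuousLinearMap) ≤ traceNorm T := by
  refine traceNorm_le fun n e f he hf => ?_
  simp only [ContinuousLinearMap.comp_apply, ContinuousLinearMap.adjoint_inner_right]
  exact sum_enorm_inner_le_traceNorm (he.comp_linearIsometry W) (hf.comp_linearIsometry V)

theorem orthonormal_unitary_apply {ι : Type*} {e : ι → K} (he : Orthonormal ℂ e)
    {u : K →L[ℂ] K} (hu : u ∈ unitary (K →L[ℂ] K)) : Orthonormal ℂ fun i => u (e i) :=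
  he.comp_linearIsometryEquiv (Unitary.linearIsometryEquiv ⟨u, hu⟩)

theorem traceNorm_unitary_mul_le {u : K →L[ℂ] K} (hu : u ∈ unitary (K →L[ℂ] K)) :
    traceNorm (u * T) ≤ traceNorm T := by
  refine traceNorm_le fun n e f he hf => ?_
  refine (Finset.sum_congr rfl fun i _ => ?_).trans_le (sum_enorm_inner_le_traceNorm (T := T) he
    (orthonormal_unitary_apply hf (Unitary.star_mem hu)))
  rw [ContinuousLinearMap.star_eq_adjoint, ContinuousLinearMap.adjoint_inner_left,
    mul_apply_eq_comp]

/-- The operators that act contractively on trace norms form a closed convex set, so by the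
Russo–Dye theorem it suffices that the unitaries do. -/
theorem traceNorm_mul_le_of_norm_le_one {A : K →L[ℂ] K} (hA : ‖A‖ ≤ 1) :
    traceNorm (A * T) ≤ traceNorm T := by
  let s : Set (K →L[ℂ] K) := {B | traceNorm (B * T) ≤ traceNorm T}
  have hconv : Convex ℝ s := by
    intro B hB B' hB' a b ha hb hab
    change traceNorm ((a • B + b • B') * T) ≤ traceNorm T
    rw [add_mul, smul_mul_assoc, smul_mul_assoc, ← Complex.coe_smul, ← Complex.coe_smul]
    calc _ ≤ ‖(a : ℂ)‖ₑ * traceNorm (B * T) + ‖(b : ℂ)‖ₑ * traceNorm (B' * T) :=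
          traceNorm_add_le.trans_eq (by rw [traceNorm_smul, traceNorm_smul])
      _ ≤ ‖(a : ℂ)‖ₑ * traceNorm T + ‖(b : ℂ)‖ₑ * traceNorm T := by gcongr <;> assumption
      _ = traceNorm T := by
          rw [← add_mul, ← ofReal_norm, ← ofReal_norm, Complex.norm_real, Complex.norm_real,
            Real.norm_of_nonneg ha, Real.norm_of_nonneg hb, ← ENNReal.ofReal_add ha hb, hab,
            ENNReal.ofReal_one, one_mul]
  have hclosed : IsClosed s := isClosed_of_closure_subset fun B hB => by
    obtain ⟨S, hS, hSB⟩ := mem_closure_iff_seq_limit.mp hB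
    exact traceNorm_le_of_tendsto (hSB.mul_const T) (.of_forall hS)
  exact (closure_minimal (convexHull_min (fun u hu => traceNorm_unitary_mul_le hu) hconv) hclosed)
    (closedBall_subset_closure_convexHull_unitary (mem_closedBall_zero_iff.mpr hA))

theorem traceNorm_mul_le (A T : K →L[ℂ] K) : traceNorm (A * T) ≤ ‖A‖ₑ * traceNorm T := by
  rcases eq_or_ne A 0 with rfl | hA
  · simp [traceNorm_zero]
  have hnorm : ((‖A‖ : ℝ) : ℂ) ≠ 0 := by simpa using hA
  calc traceNorm (A * T) = traceNorm ((‖A‖ : ℂ) • (((‖A‖ : ℂ)⁻¹ • A) * T)) := by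
        rw [smul_mul_assoc, smul_inv_smul₀ hnorm]
    _ ≤ ‖A‖ₑ * traceNorm T := by
        rw [traceNorm_smul, ← ofReal_norm, Complex.norm_real, norm_norm, ofReal_norm]
        gcongr
        exact traceNorm_mul_le_of_norm_le_one (norm_smul_inv_norm hA).le

theorem traceNorm_mul_le_mul_enorm (T A : K →L[ℂ] K) :
    traceNorm (T * A) ≤ traceNorm T * ‖A‖ₑ := by
  have h := traceNorm_mul_le (star A) (star T)
  rw [← star_mul, ← ofReal_norm (star A), norm_star, ofReal_norm, mul_comm] at h
  simpa only [ContinuousLinearMap.star_eq_adjoint, traceNorm_adjoint] using h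

theorem exists_seq_tendsto_polar (T : K →L[ℂ] K) : ∃ V : ℕ → K →L[ℂ] K, (∀ n, ‖V n‖ ≤ 1) ∧
    Tendsto (fun n => V n * CFC.abs T) atTop (𝓝 T) ∧
    Tendsto (fun n => star (V n) * T) atTop (𝓝 (CFC.abs T)) := by
  choose V hV hVabs hVT using fun n : ℕ => exists_approx_polar T (Nat.one_div_pos_of_nat (n := n))
  have hlim : ∀ {X : ℕ → K →L[ℂ] K} {Y : K →L[ℂ] K}, (∀ n, ‖X n - Y‖ ≤ 1 / ((n : ℝ) + 1)) →
      Tendsto X atTop (𝓝 Y) := fun h => tendsto_iff_norm_sub_tendsto_zero.mpr <|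
    squeeze_zero (fun _ => norm_nonneg _) h tendsto_one_div_add_atTop_nhds_zero_nat
  exact ⟨V, hV, hlim hVabs, hlim hVT⟩

theorem traceNorm_abs (T : K →L[ℂ] K) : traceNorm (CFC.abs T) = traceNorm T := by
  obtain ⟨V, hV, hVabs, hVT⟩ := exists_seq_tendsto_polar T
  exact le_antisymm
    (traceNorm_le_of_tendsto hVT (.of_forall fun n =>
      traceNorm_mul_le_of_norm_le_one ((norm_star _).trans_le (hV n))))
    (traceNorm_le_of_tendsto hVabs (.of_forall fun n => traceNorm_mul_le_of_norm_le_one (hV n)))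

theorem exists_isPositive_seq_tendsto_mul (T : K →L[ℂ] K) :
    ∃ (P : K →L[ℂ] K) (V : ℕ → K →L[ℂ] K), P.IsPositive ∧ traceNorm P = traceNorm T ∧
      (∀ n, ‖V n‖ ≤ 1) ∧ Tendsto (fun n => V n * P) atTop (𝓝 T) := by
  obtain ⟨V, hV, hVT, -⟩ := exists_seq_tendsto_polar T
  exact ⟨CFC.abs T, V, (ContinuousLinearMap.nonneg_iff_isPositive _).mp (CFC.abs_nonneg T),
    traceNorm_abs T, hV, hVT⟩

end TraceNorm

section HilbertSchmidt
variable {K : Type*} [NormedAddCommGroup K] [InnerProductSpace ℂ K] {T : K →L[ℂ] K}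

theorem tsum_enorm_sq_inner {ι : Type*} (b : HilbertBasis ι ℂ K) (x : K) :
    ∑' i, ‖⟪b i, x⟫_ℂ‖ₑ ^ 2 = ‖x‖ₑ ^ 2 := by
  have hsummable : Summable fun i => ‖⟪b i, x⟫_ℂ‖ ^ 2 := by
    simpa only [← b.repr_apply_apply] using summable_sq_lp (b.repr x)
  have hnorm : ∑' i, ‖⟪b i, x⟫_ℂ‖ ^ 2 = ‖x‖ ^ 2 := by
    simpa only [← b.repr_apply_apply, b.repr.norm_map] using (norm_sq_lp (b.repr x)).symm
  rw [← ofReal_norm, ← ENNReal.ofReal_pow (norm_nonneg _), ← hnorm,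
    ENNReal.ofReal_tsum_of_nonneg (fun _ => by positivity) hsummable]
  simp_rw [ENNReal.ofReal_pow (norm_nonneg _), ofReal_norm]

theorem tsum_enorm_sq_inner_le {ι : Type*} {e : ι → K} (he : Orthonormal ℂ e) (x : K) :
    ∑' i, ‖⟪e i, x⟫_ℂ‖ₑ ^ 2 ≤ ‖x‖ₑ ^ 2 := by
  have hbessel := ENNReal.ofReal_le_ofReal (he.tsum_inner_products_le x)
  rw [ENNReal.ofReal_tsum_of_nonneg (fun _ => by positivity) (he.inner_products_summable x)]
    at hbessel
  simpa only [ENNReal.ofReal_pow (norm_nonneg _), ofReal_norm] using hbessel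

variable [CompleteSpace K]

theorem tsum_enorm_sq_apply_le_adjoint {ι κ : Type*} {e : ι → K} (he : Orthonormal ℂ e)
    (b : HilbertBasis κ ℂ K) (X : K →L[ℂ] K) :
    ∑' i, ‖X (e i)‖ₑ ^ 2 ≤ ∑' j, ‖X.adjoint (b j)‖ₑ ^ 2 := by
  simp_rw [← tsum_enorm_sq_inner b (X (e _))]
  rw [ENNReal.tsum_comm]
  refine ENNReal.tsum_le_tsum fun j => ?_
  simpa only [← ContinuousLinearMap.adjoint_inner_left, ← inner_conj_symm (X.adjoint (b j)),
    RCLike.enorm_conj] using tsum_enorm_sq_inner_le he (X.adjoint (b j))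

theorem tsum_enorm_sq_apply_le {ι κ : Type*} {e : ι → K} (he : Orthonormal ℂ e)
    (b : HilbertBasis κ ℂ K) (X : K →L[ℂ] K) :
    ∑' i, ‖X (e i)‖ₑ ^ 2 ≤ ∑' j, ‖X (b j)‖ₑ ^ 2 := by
  refine (tsum_enorm_sq_apply_le_adjoint he b X).trans ?_
  simpa using tsum_enorm_sq_apply_le_adjoint b.orthonormal b X.adjoint

theorem traceNorm_adjoint_mul_le {ι : Type*} (b : HilbertBasis ι ℂ K) (X Y : K →L[ℂ] K) :
    traceNorm (X.adjoint * Y) ≤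
      (∑' j, ‖X (b j)‖ₑ ^ 2) ^ (1 / 2 : ℝ) * (∑' j, ‖Y (b j)‖ₑ ^ 2) ^ (1 / 2 : ℝ) := by
  have hsum : ∀ {n : ℕ} {e : Fin n → K}, Orthonormal ℂ e → ∀ Z : K →L[ℂ] K,
      ∑ i, ‖Z (e i)‖ₑ ^ (2 : ℝ) ≤ ∑' j, ‖Z (b j)‖ₑ ^ 2 := fun he Z => by
    simpa only [ENNReal.rpow_ofNat, tsum_fintype] using tsum_enorm_sq_apply_le he b Z
  refine traceNorm_le fun n e f he hf => ?_
  calc ∑ i, ‖⟪f i, (X.adjoint * Y) (e i)⟫_ℂ‖ₑ ≤ ∑ i, ‖X (f i)‖ₑ * ‖Y (e i)‖ₑ :=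
        Finset.sum_le_sum fun i _ => by
          rw [mul_apply_eq_comp, ContinuousLinearMap.adjoint_inner_right]
          simp only [← ofReal_norm, ← ENNReal.ofReal_mul (norm_nonneg _)]
          exact ENNReal.ofReal_le_ofReal (norm_inner_le_norm _ _)
    _ ≤ (∑ i, ‖X (f i)‖ₑ ^ (2 : ℝ)) ^ (1 / 2 : ℝ) * (∑ i, ‖Y (e i)‖ₑ ^ (2 : ℝ)) ^ (1 / 2 : ℝ) :=
        ENNReal.inner_le_Lp_mul_Lq _ _ _ .two_two
    _ ≤ _ := by gcongr <;> exact hsum ‹_› _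

theorem enorm_sqrt_apply_sq (hT : T.IsPositive) (x : K) :
    ‖CFC.sqrt T x‖ₑ ^ 2 = ‖⟪x, T x⟫_ℂ‖ₑ := by
  have hsa : (CFC.sqrt T).adjoint = CFC.sqrt T := (CFC.sqrt_nonneg T).isSelfAdjoint.adjoint_eq
  have hsq : CFC.sqrt T * CFC.sqrt T = T :=
    CFC.sqrt_mul_sqrt_self T ((ContinuousLinearMap.nonneg_iff_isPositive T).mpr hT)
  conv_rhs => rw [← hsq, mul_apply_eq_comp, ← ContinuousLinearMap.adjoint_inner_left, hsa,
    inner_self_eq_norm_sq_to_K, enorm_pow, ← ofReal_norm]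
  simp [ofReal_norm]

/-- A positive operator is the square of its root, so this is the equality case of
`traceNorm_adjoint_mul_le`. -/
theorem traceNorm_eq_tsum (hT : T.IsPositive) {ι : Type*} (b : HilbertBasis ι ℂ K) :
    traceNorm T = ∑' i, ‖⟪b i, T (b i)⟫_ℂ‖ₑ := by
  refine le_antisymm ?_ (tsum_enorm_inner_le_traceNorm b.orthonormal b.orthonormal)
  have hsa : (CFC.sqrt T).adjoint = CFC.sqrt T := (CFC.sqrt_nonneg T).isSelfAdjoint.adjoint_eq
  have hle := traceNorm_adjoint_mul_le b (CFC.sqrt T) (CFC.sqrt T)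
  rw [hsa, CFC.sqrt_mul_sqrt_self T ((ContinuousLinearMap.nonneg_iff_isPositive T).mpr hT),
    ← ENNReal.rpow_add_of_nonneg _ _ (by norm_num) (by norm_num), add_halves, ENNReal.rpow_one]
    at hle
  simpa only [enorm_sqrt_apply_sq hT] using hle

end HilbertSchmidt

section PositiveDecomposition
variable {K : Type*} [NormedAddCommGroup K] [InnerProductSpace ℂ K] [CompleteSpace K]
  {T : K →L[ℂ] K}

theorem traceNorm_posPart_le (hT : IsSelfAdjoint T) : traceNorm T⁺ ≤ traceNorm T := by
  have hpos : T⁺ = (2⁻¹ : ℂ) • (CFC.abs T + T) := by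
    rw [CFC.abs_add_self T hT]
    module
  rw [hpos]
  exact traceNorm_midpoint_le (traceNorm_abs T).le le_rfl

theorem traceNorm_negPart_le (hT : IsSelfAdjoint T) : traceNorm T⁻ ≤ traceNorm T := by
  rw [← CFC.posPart_neg, ← traceNorm_neg (T := T)]
  exact traceNorm_posPart_le hT.neg

theorem traceNorm_realPart_le (T : K →L[ℂ] K) :
    traceNorm (realPart T : K →L[ℂ] K) ≤ traceNorm T := by
  rw [realPart_apply_coe, ← Complex.coe_smul, Complex.ofReal_inv, Complex.ofReal_ofNat]
  exact traceNorm_midpoint_le le_rfl traceNorm_adjoint.le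

theorem traceNorm_imaginaryPart_le (T : K →L[ℂ] K) :
    traceNorm (imaginaryPart T : K →L[ℂ] K) ≤ traceNorm T := by
  have h := traceNorm_realPart_le (Complex.I • T)
  rwa [realPart_I_smul, AddSubgroup.coe_neg, traceNorm_neg, traceNorm_smul, ← ofReal_norm,
    Complex.norm_I, ENNReal.ofReal_one, one_mul] at h

theorem mem_span_isPositive_of_traceNorm_ne_top (hT : traceNorm T ≠ ∞) :
    T ∈ Submodule.span ℂ {S : K →L[ℂ] K | S.IsPositive ∧ traceNorm S ≠ ∞} := by
  have hsa : ∀ S : K →L[ℂ] K, IsSelfAdjoint S → traceNorm S ≤ traceNorm T →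
      S⁺ - S⁻ ∈ Submodule.span ℂ {S : K →L[ℂ] K | S.IsPositive ∧ traceNorm S ≠ ∞} :=
    fun S hS hle => sub_mem
      (Submodule.subset_span ⟨(ContinuousLinearMap.nonneg_iff_isPositive _).mp
        (CFC.posPart_nonneg S), ne_top_of_le_ne_top hT ((traceNorm_posPart_le hS).trans hle)⟩)
      (Submodule.subset_span ⟨(ContinuousLinearMap.nonneg_iff_isPositive _).mp
        (CFC.negPart_nonneg S), ne_top_of_le_ne_top hT ((traceNorm_negPart_le hS).trans hle)⟩)
  rw [← CStarAlgebra.linear_combination_nonneg T, ← smul_sub]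
  exact add_mem (hsa _ (realPart T).2 (traceNorm_realPart_le T))
    (Submodule.smul_mem _ _ (hsa _ (imaginaryPart T).2 (traceNorm_imaginaryPart_le T)))

end PositiveDecomposition

section TraceClass
variable (K : Type*) [NormedAddCommGroup K] [InnerProductSpace ℂ K]

/-- The trace class operators, as a subspace of the bounded operators. -/
def traceClassSubmodule : Submodule ℂ (K →L[ℂ] K) where
  carrier := {T | traceNorm T ≠ ∞}
  zero_mem' := by simp [traceNorm_zero]
  add_mem' hS hT := ne_top_of_le_ne_top (ENNReal.add_ne_top.mpr ⟨hS, hT⟩) traceNorm_add_le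
  smul_mem' c T hT := by
    simpa only [Set.mem_ofPred_eq, traceNorm_smul] using ENNReal.mul_ne_top enorm_ne_top hT

/-- The space of trace class operators with the trace norm. It is a type of its own, since
`traceClassSubmodule K` already carries the operator norm. -/
def TraceClass : Type _ := traceClassSubmodule K

namespace TraceClass

instance : AddCommGroup (TraceClass K) := inferInstanceAs (AddCommGroup (traceClassSubmodule K))
instance : Module ℂ (TraceClass K) := inferInstanceAs (Module ℂ (traceClassSubmodule K))
instance : Norm (TraceClass K) := ⟨fun T => (traceNorm T.1).toReal⟩

variable {K}

theorem normedSpaceCore : NormedSpace.Core ℂ (TraceClass K) where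
  norm_nonneg _ := ENNReal.toReal_nonneg
  norm_smul c T := (congrArg ENNReal.toReal (traceNorm_smul c)).trans
    (by rw [ENNReal.toReal_mul, toReal_enorm]; rfl)
  norm_triangle S T := (ENNReal.toReal_mono (ENNReal.add_ne_top.mpr ⟨S.2, T.2⟩)
    traceNorm_add_le).trans_eq (ENNReal.toReal_add S.2 T.2)
  norm_eq_zero_iff T := by
    refine ⟨fun h => Subtype.ext ?_, fun h => h ▸ congrArg ENNReal.toReal traceNorm_zero⟩
    have h0 : traceNorm T.1 = 0 := ((ENNReal.toReal_eq_zero_iff _).mp h).resolve_right T.2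
    have hle : ENNReal.ofReal ‖T.1‖ ≤ 0 :=
      (ofReal_norm T.1).trans_le (enorm_le_traceNorm.trans h0.le)
    exact norm_le_zero_iff.mp (ENNReal.ofReal_eq_zero.mp (nonpos_iff_eq_zero.mp hle))

instance : NormedAddCommGroup (TraceClass K) := NormedAddCommGroup.ofCore normedSpaceCore
instance : NormedSpace ℂ (TraceClass K) := NormedSpace.ofCore normedSpaceCore

/-- The bounded operator underlying a trace class operator. -/
def toCLM : TraceClass K →L[ℂ] (K →L[ℂ] K) :=
  LinearMap.mkContinuous (traceClassSubmodule K).subtype 1 fun T => by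
    rw [one_mul, ← toReal_enorm]
    exact ENNReal.toReal_mono T.2 enorm_le_traceNorm

theorem toCLM_injective : Function.Injective (toCLM : TraceClass K → K →L[ℂ] K) :=
  Subtype.val_injective

@[ext]
theorem ext {S T : TraceClass K} (h : toCLM S = toCLM T) : S = T := toCLM_injective h

/-- A bounded operator of finite trace norm as an element of `TraceClass K`. -/
def mk (T : K →L[ℂ] K) (h : traceNorm T ≠ ∞) : TraceClass K := ⟨T, h⟩

@[simp]
theorem toCLM_mk (T : K →L[ℂ] K) (h : traceNorm T ≠ ∞) : toCLM (mk T h) = T := rfl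

theorem traceNorm_toCLM_ne_top (T : TraceClass K) : traceNorm (toCLM T) ≠ ∞ := T.2

theorem enorm_eq (T : TraceClass K) : ‖T‖ₑ = traceNorm (toCLM T) := by
  rw [← ofReal_norm]
  exact ENNReal.ofReal_toReal T.2

theorem norm_le_iff {T : TraceClass K} {c : ℝ} (hc : 0 ≤ c) :
    ‖T‖ ≤ c ↔ traceNorm (toCLM T) ≤ ENNReal.ofReal c := by
  rw [← enorm_eq, ← ofReal_norm, ENNReal.ofReal_le_ofReal_iff hc]

theorem sum_norm_inner_le {ι : Type*} (T : TraceClass K) {e f : ι → K} (he : Orthonormal ℂ e)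
    (hf : Orthonormal ℂ f) (s : Finset ι) : ∑ i ∈ s, ‖⟪f i, toCLM T (e i)⟫_ℂ‖ ≤ ‖T‖ := by
  have hle := (ENNReal.sum_le_tsum s).trans (tsum_enorm_inner_le_traceNorm (T := toCLM T) he hf)
  rw [← enorm_eq, ← ofReal_norm] at hle
  rw [← ENNReal.ofReal_le_ofReal_iff (norm_nonneg _),
    ENNReal.ofReal_sum_of_nonneg fun _ _ => norm_nonneg _]
  simpa only [ofReal_norm] using hle

theorem summable_inner {ι : Type*} (T : TraceClass K) {e f : ι → K} (he : Orthonormal ℂ e)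
    (hf : Orthonormal ℂ f) : Summable fun i => ⟪f i, toCLM T (e i)⟫_ℂ :=
  .of_norm (summable_of_sum_le (fun _ => norm_nonneg _) (T.sum_norm_inner_le he hf))

/-- A linear map of trace class operators given on the underlying bounded operators, with a bound
for its trace norm. -/
def mkContinuous {K' : Type*} [NormedAddCommGroup K'] [InnerProductSpace ℂ K']
    (Φ : TraceClass K →ₗ[ℂ] (K' →L[ℂ] K')) (c : ℝ)
    (h : ∀ T, traceNorm (Φ T) ≤ ENNReal.ofReal (c * ‖T‖)) : TraceClass K →L[ℂ] TraceClass K' :=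
  LinearMap.mkContinuousOfExistsBound
    { toFun := fun T => mk (Φ T) (ne_top_of_le_ne_top ENNReal.ofReal_ne_top (h T))
      map_add' := fun S T => ext (map_add Φ S T)
      map_smul' := fun a T => ext (map_smul Φ a T) }
    ⟨max c 0, fun T => (norm_le_iff (by positivity)).mpr <| (h T).trans <| by
      gcongr
      exact le_max_left c 0⟩

variable [CompleteSpace K]

instance : CompleteSpace (TraceClass K) := by
  refine Metric.complete_of_cauchySeq_tendsto fun u hu => ?_
  obtain ⟨T, hT⟩ := cauchySeq_tendsto_of_complete (toCLM.uniformContinuous.comp_cauchySeq hu)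
  have hlim : ∀ ε > 0, ∃ N, ∀ n ≥ N, traceNorm (T - toCLM (u n)) ≤ ENNReal.ofReal ε := by
    intro ε hε
    obtain ⟨N, hN⟩ := Metric.cauchySeq_iff.mp hu ε hε
    refine ⟨N, fun n hn => traceNorm_le_of_tendsto (hT.sub_const (toCLM (u n))) ?_⟩
    filter_upwards [eventually_ge_atTop N] with m hm
    rw [Function.comp_apply, ← map_sub, ← norm_le_iff hε.le, ← dist_eq_norm]
    exact (hN m hm n hn).le
  have hT_trace : traceNorm T ≠ ∞ := by
    obtain ⟨N, hN⟩ := hlim 1 one_pos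
    rw [← sub_add_cancel T (toCLM (u N))]
    exact ne_top_of_le_ne_top (ENNReal.add_ne_top.mpr ⟨ne_top_of_le_ne_top ENNReal.ofReal_ne_top
      (hN N le_rfl), (u N).traceNorm_toCLM_ne_top⟩) traceNorm_add_le
  refine ⟨mk T hT_trace, Metric.tendsto_atTop'.mpr fun ε hε => ?_⟩
  obtain ⟨N, hN⟩ := hlim (ε / 2) (half_pos hε)
  refine ⟨N, fun n hn => ?_⟩
  rw [dist_comm, dist_eq_norm]
  refine ((norm_le_iff (half_pos hε).le).mpr ?_).trans_lt (half_lt_self hε)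
  simpa only [map_sub, toCLM_mk] using hN n hn.le

theorem traceNorm_mul_toCLM_le (A : K →L[ℂ] K) (T : TraceClass K) :
    traceNorm (A * toCLM T) ≤ ENNReal.ofReal (‖A‖ * ‖T‖) := by
  rw [ENNReal.ofReal_mul (norm_nonneg A), ofReal_norm, ofReal_norm, enorm_eq]
  exact traceNorm_mul_le A _

theorem traceNorm_toCLM_mul_le (A : K →L[ℂ] K) (T : TraceClass K) :
    traceNorm (toCLM T * A) ≤ ENNReal.ofReal (‖A‖ * ‖T‖) := by
  rw [ENNReal.ofReal_mul (norm_nonneg A), ofReal_norm, ofReal_norm, enorm_eq, mul_comm]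
  exact traceNorm_mul_le_mul_enorm _ A

/-- Multiplication of trace class operators by a bounded operator on the left. -/
def mulLeft (A : K →L[ℂ] K) : TraceClass K →L[ℂ] TraceClass K :=
  mkContinuous ((LinearMap.mulLeft ℂ A).comp toCLM.toLinearMap) ‖A‖ (traceNorm_mul_toCLM_le A)

/-- Multiplication of trace class operators by a bounded operator on the right. -/
def mulRight (A : K →L[ℂ] K) : TraceClass K →L[ℂ] TraceClass K :=
  mkContinuous ((LinearMap.mulRight ℂ A).comp toCLM.toLinearMap) ‖A‖ (traceNorm_toCLM_mul_le A)

@[simp]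
theorem toCLM_mulLeft (A : K →L[ℂ] K) (T : TraceClass K) : toCLM (mulLeft A T) = A * toCLM T := rfl

@[simp]
theorem toCLM_mulRight (A : K →L[ℂ] K) (T : TraceClass K) :
    toCLM (mulRight A T) = toCLM T * A := rfl

theorem norm_mulLeft_apply_le (A : K →L[ℂ] K) (T : TraceClass K) : ‖mulLeft A T‖ ≤ ‖A‖ * ‖T‖ :=
  (norm_le_iff (by positivity)).mpr (traceNorm_mul_toCLM_le A T)

theorem norm_mulRight_apply_le (A : K →L[ℂ] K) (T : TraceClass K) : ‖mulRight A T‖ ≤ ‖A‖ * ‖T‖ :=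
  (norm_le_iff (by positivity)).mpr (traceNorm_toCLM_mul_le A T)

theorem induction_on {p : TraceClass K → Prop} (T : TraceClass K)
    (isPositive : ∀ T, (toCLM T).IsPositive → p T) (add : ∀ S T, p S → p T → p (S + T))
    (smul : ∀ (c : ℂ) T, p T → p (c • T)) : p T := by
  obtain ⟨_, h⟩ : ∃ h, p (mk (toCLM T) h) := by
    refine Submodule.span_induction (p := fun S _ => ∃ h, p (mk S h)) ?_ ?_ ?_ ?_
      (mem_span_isPositive_of_traceNorm_ne_top T.traceNorm_toCLM_ne_top)
    · exact fun S hS => ⟨hS.2, isPositive _ hS.1⟩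
    · exact ⟨(0 : TraceClass K).2, isPositive 0 ContinuousLinearMap.isPositive_zero⟩
    · exact fun _ _ _ _ ⟨_, hS⟩ ⟨_, hT⟩ => ⟨_, add _ _ hS hT⟩
    · exact fun c _ _ ⟨_, hT⟩ => ⟨_, smul c _ hT⟩
  exact h

/-- The trace. -/
def trace : TraceClass K →L[ℂ] ℂ :=
  LinearMap.mkContinuous
    { toFun := fun T => ∑' i, ⟪basis K i, toCLM T (basis K i)⟫_ℂ
      map_add' := fun S T => by
        simp only [map_add, add_apply, inner_add_right]
        exact (S.summable_inner (basis K).orthonormal (basis K).orthonormal).tsum_add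
          (T.summable_inner (basis K).orthonormal (basis K).orthonormal)
      map_smul' := fun c T => by
        simp only [map_smul, smul_apply, inner_smul_right, tsum_mul_left]
        rfl } 1 fun T => by
    rw [one_mul]
    have h := (T.summable_inner (basis K).orthonormal (basis K).orthonormal).norm
    exact (norm_tsum_le_tsum_norm h).trans (h.tsum_le_of_sum_le
      (T.sum_norm_inner_le (basis K).orthonormal (basis K).orthonormal))

theorem trace_apply (T : TraceClass K) :
    trace T = ∑' i, ⟪basis K i, toCLM T (basis K i)⟫_ℂ := rfl

theorem tsum_inner_of_isPositive {T : TraceClass K} (hT : (toCLM T).IsPositive) {ι : Type*}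
    (b : HilbertBasis ι ℂ K) : ∑' i, ⟪b i, toCLM T (b i)⟫_ℂ = ‖T‖ := by
  have hnorm : ∀ i, ⟪b i, toCLM T (b i)⟫_ℂ = (‖⟪b i, toCLM T (b i)⟫_ℂ‖ : ℂ) := fun i =>
    (RCLike.norm_of_nonneg' (hT.inner_nonneg_right (b i))).symm
  rw [← toReal_enorm, enorm_eq, traceNorm_eq_tsum hT b,
    ENNReal.tsum_toReal_eq fun _ => enorm_ne_top]
  simp_rw [toReal_enorm]
  rw [Complex.ofReal_tsum]
  exact tsum_congr hnorm

theorem trace_eq_norm_of_isPositive {T : TraceClass K} (hT : (toCLM T).IsPositive) :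
    trace T = ‖T‖ :=
  tsum_inner_of_isPositive hT _

theorem hasSum_trace (T : TraceClass K) {ι : Type*} (b : HilbertBasis ι ℂ K) :
    HasSum (fun i => ⟪b i, toCLM T (b i)⟫_ℂ) (trace T) := by
  induction T using induction_on with
  | isPositive T hT =>
    rw [trace_eq_norm_of_isPositive hT, ← tsum_inner_of_isPositive hT b]
    exact (T.summable_inner b.orthonormal b.orthonormal).hasSum
  | add S T hS hT => simpa only [map_add, add_apply, inner_add_right] using hS.add hT
  | smul c T hT =>
    simpa only [map_smul, smul_apply, inner_smul_right, smul_eq_mul] using hT.mul_left c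

theorem trace_mulRight_unitary {u : K →L[ℂ] K} (hu : u ∈ unitary (K →L[ℂ] K))
    (T : TraceClass K) : trace (mulRight u T) = trace (mulLeft u T) := by
  let U := Unitary.linearIsometryEquiv ⟨u, hu⟩
  let b : HilbertBasis (basisIdx K) ℂ K := .ofRepr (U.symm.trans (basis K).repr)
  have hb : ∀ i, b i = u (basis K i) := fun i => by
    classical
    rw [← b.repr_symm_single, ← (basis K).repr_symm_single]
    rfl
  refine ((mulRight u T).hasSum_trace (basis K)).unique ?_
  convert (mulLeft u T).hasSum_trace b using 2 with i
  rw [hb]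
  exact (U.inner_map_map _ _).symm

/-- Every bounded operator is a linear combination of unitaries, for which this is a change of
basis. -/
theorem trace_mulRight_eq_trace_mulLeft (A : K →L[ℂ] K) (T : TraceClass K) :
    trace (mulRight A T) = trace (mulLeft A T) := by
  have hA : A ∈ Submodule.span ℂ (unitary (K →L[ℂ] K) : Set (K →L[ℂ] K)) := by
    rw [CStarAlgebra.span_unitary]
    trivial
  induction hA using Submodule.span_induction with
  | mem u hu => exact trace_mulRight_unitary hu T
  | zero =>
    have hR : mulRight 0 T = 0 := ext (mul_zero _)
    have hL : mulLeft 0 T = 0 := ext (zero_mul _)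
    rw [hR, hL]
  | add A B _ _ hA hB =>
    have hR : mulRight (A + B) T = mulRight A T + mulRight B T := ext (mul_add _ _ _)
    have hL : mulLeft (A + B) T = mulLeft A T + mulLeft B T := ext (add_mul _ _ _)
    rw [hR, hL, map_add, map_add, hA, hB]
  | smul c A _ hA =>
    have hR : mulRight (c • A) T = c • mulRight A T := ext (mul_smul_comm _ _ _)
    have hL : mulLeft (c • A) T = c • mulLeft A T := ext (smul_mul_assoc _ _ _)
    rw [hR, hL, map_smul, map_smul, hA]

theorem trace_mulRight_rankOne (T : TraceClass K) (x y : K) :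
    trace (mulRight (InnerProductSpace.rankOne ℂ y x) T) = ⟪x, toCLM T y⟫_ℂ := by
  rw [trace_apply, ← (basis K).tsum_inner_mul_inner x (toCLM T y)]
  refine tsum_congr fun i => ?_
  simp

theorem ext_trace_mulRight {S T : TraceClass K}
    (h : ∀ A : K →L[ℂ] K, trace (mulRight A S) = trace (mulRight A T)) : S = T := by
  refine ext (ContinuousLinearMap.ext fun y => ext_inner_left ℂ fun x => ?_)
  rw [← trace_mulRight_rankOne, ← trace_mulRight_rankOne, h]

end TraceClass

end TraceClass

section Average
variable {C K : Type*} [MetricSpace C] [NormedAddCommGroup K] [InnerProductSpace ℂ K]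
  [CompleteSpace K] {W : C → K →L[ℂ] K}

namespace TraceClass

/-- The operator `T ↦ A T A*` on trace class operators. -/
def conj (A : K →L[ℂ] K) : TraceClass K →L[ℂ] TraceClass K :=
  (mulRight (star A)).comp (mulLeft A)

@[simp]
theorem toCLM_conj (A : K →L[ℂ] K) (T : TraceClass K) :
    toCLM (conj A T) = A * toCLM T * star A := rfl

theorem trace_mulRight_conj (A B : K →L[ℂ] K) (T : TraceClass K) :
    trace (mulRight B (conj A T)) = trace (mulRight (star A * B * A) T) := by
  have hl : mulRight B (conj A T) = mulLeft A (mulRight (star A * B) T) :=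
    ext (by simp only [toCLM_mulRight, toCLM_conj, toCLM_mulLeft, mul_assoc])
  rw [hl, ← trace_mulRight_eq_trace_mulLeft]
  exact congrArg trace (ext (mul_assoc _ _ _))

theorem trace_conj_unitary {u : K →L[ℂ] K} (hu : u ∈ unitary (K →L[ℂ] K)) (T : TraceClass K) :
    trace (conj u T) = trace T := by
  have h := trace_mulRight_conj u 1 T
  rw [mul_one, Unitary.star_mul_self_of_mem hu] at h
  have hone : ∀ S : TraceClass K, mulRight 1 S = S := fun S => ext (mul_one _)
  simpa only [hone] using h

theorem norm_conj_apply_le {A : K →L[ℂ] K} (hA : ‖A‖ ≤ 1) (T : TraceClass K) :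
    ‖conj A T‖ ≤ ‖T‖ := by
  calc ‖conj A T‖ ≤ ‖star A‖ * ‖mulLeft A T‖ := norm_mulRight_apply_le _ _
    _ ≤ 1 * (1 * ‖T‖) := by
        rw [norm_star]
        gcongr
        exact (norm_mulLeft_apply_le A T).trans (by gcongr)
    _ = ‖T‖ := by rw [one_mul, one_mul]

theorem norm_mulRight_star_of_isPositive (A : K →L[ℂ] K) {T : TraceClass K}
    (hT : (toCLM T).IsPositive) : ‖mulRight (star A) T‖ = ‖mulLeft A T‖ := by
  have hstar : toCLM (mulRight (star A) T) = (toCLM (mulLeft A T)).adjoint := by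
    rw [toCLM_mulRight, toCLM_mulLeft, ← ContinuousLinearMap.star_eq_adjoint, star_mul,
      hT.isSelfAdjoint.star_eq]
  rw [← toReal_enorm, ← toReal_enorm, enorm_eq, enorm_eq, hstar, traceNorm_adjoint]

theorem norm_sqrt_apply_sq {T : K →L[ℂ] K} (hT : T.IsPositive) (x : K) :
    ‖CFC.sqrt T x‖ ^ 2 = ‖⟪x, T x⟫_ℂ‖ := by
  simpa only [ENNReal.toReal_pow, toReal_enorm] using
    congrArg ENNReal.toReal (enorm_sqrt_apply_sq hT x)

theorem summable_norm_apply_sqrt_sq (A : K →L[ℂ] K) {T : TraceClass K}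
    (hT : (toCLM T).IsPositive) {ι : Type*} (b : HilbertBasis ι ℂ K) :
    Summable fun j => ‖A (CFC.sqrt (toCLM T) (b j))‖ ^ 2 := by
  have hsqrt : Summable fun j => ‖CFC.sqrt (toCLM T) (b j)‖ ^ 2 := by
    simpa only [norm_sqrt_apply_sq hT] using (T.summable_inner b.orthonormal b.orthonormal).norm
  refine (hsqrt.mul_left (‖A‖ ^ 2)).of_nonneg_of_le (fun j => by positivity) fun j => ?_
  rw [← mul_pow]
  gcongr
  exact A.le_opNorm _

theorem norm_mulLeft_sq_le (A : K →L[ℂ] K) {T : TraceClass K} (hT : (toCLM T).IsPositive)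
    {ι : Type*} (b : HilbertBasis ι ℂ K) :
    ‖mulLeft A T‖ ^ 2 ≤ ‖T‖ * ∑' j, ‖A (CFC.sqrt (toCLM T) (b j))‖ ^ 2 := by
  set R := CFC.sqrt (toCLM T)
  have hR : R.adjoint = R := (CFC.sqrt_nonneg _).isSelfAdjoint.adjoint_eq
  have hfactor : A * toCLM T = (R * A.adjoint).adjoint * R := by
    rw [ContinuousLinearMap.mul_def R, ContinuousLinearMap.adjoint_comp,
      ContinuousLinearMap.adjoint_adjoint, hR, ← ContinuousLinearMap.mul_def, mul_assoc,
      CFC.sqrt_mul_sqrt_self _ ((ContinuousLinearMap.nonneg_iff_isPositive _).mpr hT)]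
  have hHS : ∑' j, ‖(R * A.adjoint) (b j)‖ₑ ^ 2 ≤ ∑' j, ‖A (R (b j))‖ₑ ^ 2 := by
    refine (tsum_enorm_sq_apply_le_adjoint b.orthonormal b _).trans_eq ?_
    rw [ContinuousLinearMap.mul_def R, ContinuousLinearMap.adjoint_comp,
      ContinuousLinearMap.adjoint_adjoint, hR]
    rfl
  have hle : ‖mulLeft A T‖ₑ ^ 2 ≤ ‖T‖ₑ * ∑' j, ‖A (R (b j))‖ₑ ^ 2 := by
    have hCS := traceNorm_adjoint_mul_le b (R * A.adjoint) R
    have hT_norm : ∑' j, ‖R (b j)‖ₑ ^ 2 = ‖T‖ₑ := by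
      rw [enorm_eq, traceNorm_eq_tsum hT b]
      exact tsum_congr fun j => enorm_sqrt_apply_sq hT _
    rw [← hfactor, hT_norm, ← ENNReal.mul_rpow_of_nonneg _ _ (by norm_num)] at hCS
    rw [enorm_eq (mulLeft A T), toCLM_mulLeft]
    calc traceNorm (A * toCLM T) ^ 2
        ≤ (((∑' j, ‖(R * A.adjoint) (b j)‖ₑ ^ 2) * ‖T‖ₑ) ^ (1 / 2 : ℝ)) ^ 2 := by gcongr
      _ = (∑' j, ‖(R * A.adjoint) (b j)‖ₑ ^ 2) * ‖T‖ₑ := by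
        rw [← ENNReal.rpow_natCast, ← ENNReal.rpow_mul]
        norm_num
      _ ≤ ‖T‖ₑ * ∑' j, ‖A (R (b j))‖ₑ ^ 2 := by
        rw [mul_comm]
        gcongr
  have hsum : ∑' j, ‖A (R (b j))‖ₑ ^ 2 = ENNReal.ofReal (∑' j, ‖A (R (b j))‖ ^ 2) := by
    rw [ENNReal.ofReal_tsum_of_nonneg (fun j => by positivity)
      (summable_norm_apply_sqrt_sq A hT b)]
    exact tsum_congr fun j => by rw [ENNReal.ofReal_pow (norm_nonneg _), ofReal_norm]
  rw [hsum, ← ofReal_norm, ← ofReal_norm, ← ENNReal.ofReal_pow (norm_nonneg _),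
    ← ENNReal.ofReal_mul (norm_nonneg _)] at hle
  exact (ENNReal.ofReal_le_ofReal_iff (by positivity)).mp hle

theorem continuous_mulLeft_of_isPositive (hW : ∀ x, Continuous fun σ => W σ x)
    (hW_le : ∀ σ, ‖W σ‖ ≤ 1) {T : TraceClass K} (hT : (toCLM T).IsPositive) :
    Continuous fun σ => mulLeft (W σ) T := by
  set R := CFC.sqrt (toCLM T)
  have hR : Summable fun j => 4 * ‖R (basis K j)‖ ^ 2 := by
    exact (summable_norm_apply_sqrt_sq 1 hT (basis K)).mul_left 4
  refine continuous_iff_continuousAt.mpr fun σ₀ => tendsto_iff_norm_sub_tendsto_zero.mpr ?_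
  have hlim : Tendsto (fun σ => ∑' j, ‖(W σ - W σ₀) (R (basis K j))‖ ^ 2) (𝓝 σ₀) (𝓝 0) := by
    rw [← tsum_zero (β := basisIdx K)]
    refine tendsto_tsum_of_dominated_convergence hR (fun j => ?_) (.of_forall fun σ j => ?_)
    · have h := (tendsto_iff_norm_sub_tendsto_zero.mp ((hW (R (basis K j))).tendsto σ₀)).pow 2
      simpa only [sub_apply, ne_eq, OfNat.ofNat_ne_zero, not_false_eq_true, zero_pow] using h
    · have hle : ‖W σ - W σ₀‖ ≤ 2 := (norm_sub_le _ _).trans (by linarith [hW_le σ, hW_le σ₀])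
      calc ‖‖(W σ - W σ₀) (R (basis K j))‖ ^ 2‖ = ‖(W σ - W σ₀) (R (basis K j))‖ ^ 2 :=
            Real.norm_of_nonneg (by positivity)
        _ ≤ (2 * ‖R (basis K j)‖) ^ 2 := by
            gcongr
            exact ContinuousLinearMap.le_of_opNorm_le _ hle _
        _ = 4 * ‖R (basis K j)‖ ^ 2 := by ring
  have hsub : ∀ σ, mulLeft (W σ) T - mulLeft (W σ₀) T = mulLeft (W σ - W σ₀) T := fun σ =>
    ext (by simp only [map_sub, toCLM_mulLeft, sub_mul])
  have hsq : Tendsto (fun σ => ‖mulLeft (W σ) T - mulLeft (W σ₀) T‖ ^ 2) (𝓝 σ₀) (𝓝 0) := by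
    refine squeeze_zero (fun σ => by positivity) (fun σ => ?_)
      (by simpa only [mul_zero] using hlim.const_mul ‖T‖)
    rw [hsub]
    exact norm_mulLeft_sq_le _ hT _
  simpa only [Real.sqrt_sq (norm_nonneg _), Real.sqrt_zero] using hsq.sqrt

theorem continuous_conj (hW : ∀ x, Continuous fun σ => W σ x) (hW_le : ∀ σ, ‖W σ‖ ≤ 1)
    (T : TraceClass K) : Continuous fun σ => conj (W σ) T := by
  induction T using induction_on with
  | isPositive T hT =>
    refine continuous_iff_continuousAt.mpr fun σ₀ => tendsto_iff_norm_sub_tendsto_zero.mpr ?_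
    have hlim := (tendsto_iff_norm_sub_tendsto_zero.mp
      ((continuous_mulLeft_of_isPositive hW hW_le hT).tendsto σ₀)).const_mul 2
    rw [mul_zero] at hlim
    refine squeeze_zero (fun _ => norm_nonneg _) (fun σ => ?_) hlim
    have hsub : mulLeft (W σ) T - mulLeft (W σ₀) T = mulLeft (W σ - W σ₀) T :=
      ext (by simp only [map_sub, toCLM_mulLeft, sub_mul])
    have hsplit : conj (W σ) T - conj (W σ₀) T = mulRight (star (W σ)) (mulLeft (W σ - W σ₀) T)
        + mulLeft (W σ₀) (mulRight (star (W σ - W σ₀)) T) := ext (by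
      simp only [map_sub, map_add, toCLM_conj, toCLM_mulLeft, toCLM_mulRight, star_sub]
      noncomm_ring)
    calc ‖conj (W σ) T - conj (W σ₀) T‖
        ≤ ‖star (W σ)‖ * ‖mulLeft (W σ - W σ₀) T‖
          + ‖W σ₀‖ * ‖mulRight (star (W σ - W σ₀)) T‖ := by
          rw [hsplit]
          exact norm_add_le_of_le (norm_mulRight_apply_le _ _) (norm_mulLeft_apply_le _ _)
      _ ≤ 1 * ‖mulLeft (W σ - W σ₀) T‖ + 1 * ‖mulLeft (W σ - W σ₀) T‖ := by
          rw [norm_mulRight_star_of_isPositive _ hT, norm_star]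
          gcongr <;> exact hW_le _
      _ = 2 * ‖mulLeft (W σ) T - mulLeft (W σ₀) T‖ := by rw [hsub]; ring
  | add S T hS hT =>
    simp only [map_add]
    exact hS.add hT
  | smul c T hT =>
    simp only [map_smul]
    exact hT.const_smul c

theorem isPositive_conj (A : K →L[ℂ] K) {T : TraceClass K} (hT : (toCLM T).IsPositive) :
    (toCLM (conj A T)).IsPositive :=
  hT.conj_adjoint A

variable [CompactSpace C] [MeasurableSpace C] [BorelSpace C] (hW : IsContractiveFamily W)
  (ν : Measure C) [IsProbabilityMeasure ν]

include hW in
theorem integrable_conj (T : TraceClass K) : Integrable (fun σ => conj (W σ) T) ν :=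
  (continuous_conj hW.cont hW.norm_le T).integrable_of_hasCompactSupport
    (HasCompactSupport.of_compactSpace _)

/-- The average `∫ W(σ) T W(σ)* dν(σ)` of a trace class operator, as a Bochner integral in trace
norm. -/
def average : TraceClass K →L[ℂ] TraceClass K :=
  LinearMap.mkContinuous
    { toFun := fun T => ∫ σ, conj (W σ) T ∂ν
      map_add' := fun S T => by
        simp only [map_add]
        exact integral_add (integrable_conj hW ν S) (integrable_conj hW ν T)
      map_smul' := fun c T => by
        simp only [map_smul]
        exact integral_smul c _ } 1 fun T => by
    rw [one_mul]
    refine (norm_integral_le_of_norm_le_const (μ := ν)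
      (.of_forall fun σ => norm_conj_apply_le (hW.norm_le σ) T)).trans_eq ?_
    rw [probReal_univ, mul_one]

theorem norm_average_apply_le (T : TraceClass K) : ‖average hW ν T‖ ≤ ‖T‖ := by
  simpa only [one_mul] using (average hW ν).le_of_opNorm_le
    (LinearMap.mkContinuous_norm_le _ zero_le_one _) T

theorem map_average {E : Type*} [NormedAddCommGroup E] [NormedSpace ℂ E] [CompleteSpace E]
    (L : TraceClass K →L[ℂ] E) (T : TraceClass K) :
    L (average hW ν T) = ∫ σ, L (conj (W σ) T) ∂ν :=
  (L.integral_comp_comm (integrable_conj hW ν T)).symm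

theorem toCLM_average (T : TraceClass K) :
    toCLM (average hW ν T) = QuantumKac.average hW ν (toCLM T) := by
  ext x
  exact map_average hW ν ((ContinuousLinearMap.apply ℂ K x).comp toCLM) T

theorem isPositive_average {T : TraceClass K} (hT : (toCLM T).IsPositive) :
    (toCLM (average hW ν T)).IsPositive := by
  rw [map_average, ← ContinuousLinearMap.nonneg_iff_isPositive]
  exact integral_nonneg fun σ =>
    (ContinuousLinearMap.nonneg_iff_isPositive _).mpr (isPositive_conj (W σ) hT)

theorem trace_average (hu : ∀ σ, W σ ∈ unitary (K →L[ℂ] K)) (T : TraceClass K) :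
    trace (average hW ν T) = trace T := by
  simp only [map_average, trace_conj_unitary (hu _), integral_const, probReal_univ, one_smul]

end TraceClass

end Average

section Entries
variable {H : Type*} [NormedAddCommGroup H] [InnerProductSpace ℂ H] [CompleteSpace H]
variable {ι κ κ' : Type}

/-- The product vectors `basisVec α` as an orthonormal basis. -/
def tensorBasis (H : Type*) [NormedAddCommGroup H] [InnerProductSpace ℂ H] [CompleteSpace H]
    (ι : Type) : HilbertBasis (ι → basisIdx H) ℂ (TensorPow H ι) :=
  HilbertBasis.ofRepr (LinearIsometryEquiv.refl ℂ (TensorPow H ι))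

@[simp]
theorem tensorBasis_apply (α : ι → basisIdx H) : tensorBasis H ι α = basisVec α := rfl

/-- The matrix elements of an operator in the product basis. -/
def entry (T : TensorPow H ι →L[ℂ] TensorPow H ι) (α β : ι → basisIdx H) : ℂ :=
  ⟪basisVec α, T (basisVec β)⟫_ℂ

theorem ext_basisVec {E : Type*} [NormedAddCommGroup E] [NormedSpace ℂ E]
    {S T : TensorPow H ι →L[ℂ] E} (h : ∀ β, S (basisVec β) = T (basisVec β)) : S = T := by
  refine ContinuousLinearMap.ext_on
    (Submodule.dense_iff_topologicalClosure_eq_top.2 (tensorBasis H ι).dense_span) ?_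
  rintro _ ⟨β, rfl⟩
  exact h β

theorem ext_inner_basisVec {x y : TensorPow H ι}
    (h : ∀ α : ι → basisIdx H, ⟪basisVec α, x⟫_ℂ = ⟪basisVec α, y⟫_ℂ) : x = y := by
  refine (tensorBasis H ι).repr.injective ?_
  ext α
  rw [HilbertBasis.repr_apply_apply, HilbertBasis.repr_apply_apply]
  exact h α

theorem ext_entry {S T : TensorPow H ι →L[ℂ] TensorPow H ι}
    (h : ∀ α β, entry S α β = entry T α β) : S = T :=
  ext_basisVec fun β => ext_inner_basisVec fun α => h α β

open scoped Classical in
theorem inner_basisVec (α β : ι → basisIdx H) :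
    ⟪basisVec α, basisVec β⟫_ℂ = if α = β then 1 else 0 :=
  orthonormal_iff_ite.1 orthonormal_basisVec α β

theorem isometryOfOrthonormal_basisVec {E : Type*} [NormedAddCommGroup E]
    [InnerProductSpace ℂ E] [CompleteSpace E] {v : (ι → basisIdx H) → E} (hv : Orthonormal ℂ v)
    (α : ι → basisIdx H) : isometryOfOrthonormal hv (basisVec α) = v α := by
  classical
  have h : (basisVec α : TensorPow H ι) = lp.single 2 α 1 :=
    ((tensorBasis H ι).repr_symm_single α).symm
  rw [h, isometryOfOrthonormal, OrthogonalFamily.linearIsometry_apply_single]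
  simp [LinearIsometry.toSpanSingleton_apply]

theorem insertVec_basisVec (f : κ ↪ ι) (y : {i // i ∉ Set.range f} → basisIdx H)
    (x : κ → basisIdx H) : insertVec f y (basisVec x) = basisVec (merge f y x) :=
  isometryOfOrthonormal_basisVec _ x

theorem merge_restrict (f : κ ↪ ι) (α : ι → basisIdx H) :
    merge f (fun i => α i) (α ∘ f) = α := by
  ext1 i
  by_cases hi : i ∈ Set.range f
  · obtain ⟨k, rfl⟩ := hi
    exact merge_apply_mem f _ _ k
  · exact merge_apply_not_mem f _ _ ⟨i, hi⟩

theorem merge_comp (f : κ ↪ ι) (y : {i // i ∉ Set.range f} → basisIdx H) (x : κ → basisIdx H) :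
    merge f y x ∘ f = x := funext (merge_apply_mem f y x)

theorem basisVec_eq_insertVec (f : κ ↪ ι) (α : ι → basisIdx H) :
    (basisVec α : TensorPow H ι) = insertVec f (fun i => α i) (basisVec (α ∘ f)) := by
  rw [insertVec_basisVec, merge_restrict]

open scoped Classical in
theorem entry_amplify (f : κ ↪ ι) (A : TensorPow H κ →L[ℂ] TensorPow H κ)
    (α β : ι → basisIdx H) : entry (amplify f A) α β =
      if ∀ i, i ∉ Set.range f → α i = β i then entry A (α ∘ f) (β ∘ f) else 0 := by
  rw [entry, basisVec_eq_insertVec f β, amplify_insertVec, basisVec_eq_insertVec f α]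
  by_cases h : ∀ i, i ∉ Set.range f → α i = β i
  · have hαβ : (fun i : {i // i ∉ Set.range f} => α i) = fun i => β i.1 :=
      funext fun i => h i i.2
    rw [if_pos h, hαβ, LinearIsometry.inner_map_map, entry]
  · rw [if_neg h]
    exact orthogonalFamily_insertVec f (fun hαβ => h fun i hi => congrFun hαβ ⟨i, hi⟩) _ _

theorem amplify_one (f : κ ↪ ι) : amplify f (1 : TensorPow H κ →L[ℂ] TensorPow H κ) = 1 := by
  refine ext_basisVec fun β => ?_
  rw [basisVec_eq_insertVec f β, amplify_insertVec]
  rfl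

theorem amplify_refl (A : TensorPow H ι →L[ℂ] TensorPow H ι) :
    amplify (Function.Embedding.refl ι) A = A := by
  classical
  refine ext_entry fun α β => ?_
  rw [entry_amplify, if_pos fun i hi => absurd ⟨i, rfl⟩ hi]
  rfl

theorem amplify_mul (f : κ ↪ ι) (A B : TensorPow H κ →L[ℂ] TensorPow H κ) :
    amplify f (A * B) = amplify f A * amplify f B := by
  refine ext_basisVec fun β => ?_
  rw [mul_apply_eq_comp, basisVec_eq_insertVec f β, amplify_insertVec, amplify_insertVec,
    amplify_insertVec, mul_apply_eq_comp]

theorem amplify_star (f : κ ↪ ι) (A : TensorPow H κ →L[ℂ] TensorPow H κ) :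
    amplify f (star A) = star (amplify f A) := (adjoint_amplify f A).symm

/-- `A ↦ A ⊗ 1` as a bounded linear map. -/
def amplifyL (f : κ ↪ ι) :
    (TensorPow H κ →L[ℂ] TensorPow H κ) →L[ℂ] (TensorPow H ι →L[ℂ] TensorPow H ι) :=
  LinearMap.mkContinuous
    { toFun := amplify f
      map_add' := fun A B => ext_basisVec fun β => by
        rw [add_apply, basisVec_eq_insertVec f β, amplify_insertVec,
          amplify_insertVec, amplify_insertVec, add_apply, map_add]
      map_smul' := fun c A => ext_basisVec fun β => by
        rw [smul_apply, basisVec_eq_insertVec f β, amplify_insertVec,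
          amplify_insertVec, smul_apply, map_smul]
        rfl } 1 fun A => by
    rw [one_mul]
    exact norm_amplify_le f A

@[simp]
theorem amplifyL_apply (f : κ ↪ ι) (A : TensorPow H κ →L[ℂ] TensorPow H κ) :
    amplifyL f A = amplify f A := rfl

/-- `A ↦ A ⊗ 1` as a homomorphism of monoids. -/
def amplifyHom (f : κ ↪ ι) :
    (TensorPow H κ →L[ℂ] TensorPow H κ) →* (TensorPow H ι →L[ℂ] TensorPow H ι) where
  toFun := amplify f
  map_one' := amplify_one f
  map_mul' := amplify_mul f

theorem amplify_mem_unitary (f : κ ↪ ι) {A : TensorPow H κ →L[ℂ] TensorPow H κ}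
    (hA : A ∈ unitary (TensorPow H κ →L[ℂ] TensorPow H κ)) :
    amplify f A ∈ unitary (TensorPow H ι →L[ℂ] TensorPow H ι) := by
  rw [Unitary.mem_iff] at hA ⊢
  rw [← amplify_star, ← amplify_mul, ← amplify_mul, hA.1, hA.2, amplify_one]
  exact ⟨rfl, rfl⟩

theorem amplify_amplify (f : κ ↪ κ') (g : κ' ↪ ι) (A : TensorPow H κ →L[ℂ] TensorPow H κ) :
    amplify g (amplify f A) = amplify (f.trans g) A := by
  classical
  refine ext_entry fun α β => ?_
  simp only [entry_amplify]
  have hoff : (∀ i, i ∉ Set.range (f.trans g) → α i = β i) ↔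
      (∀ i, i ∉ Set.range g → α i = β i) ∧
      ∀ j, j ∉ Set.range f → (α ∘ g) j = (β ∘ g) j := by
    constructor
    · refine fun h => ⟨fun i hi => h i ?_, fun j hj => h _ ?_⟩
      · rintro ⟨k, rfl⟩
        exact hi ⟨f k, rfl⟩
      · rintro ⟨k, hk⟩
        exact hj ⟨k, g.injective hk⟩
    · rintro ⟨hoff_g, hoff_f⟩ i hi
      by_cases hg : i ∈ Set.range g
      · obtain ⟨j, rfl⟩ := hg
        refine hoff_f j ?_
        rintro ⟨k, rfl⟩
        exact hi ⟨k, rfl⟩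
      · exact hoff_g i hg
  rw [if_congr hoff rfl rfl, ite_and]
  rfl

theorem entry_mul (S T : TensorPow H ι →L[ℂ] TensorPow H ι) (α β : ι → basisIdx H) :
    entry (S * T) α β = ∑' γ, entry S α γ * entry T γ β := by
  rw [entry, mul_apply_eq_comp, ← ContinuousLinearMap.adjoint_inner_left,
    ← (tensorBasis H ι).tsum_inner_mul_inner]
  refine tsum_congr fun γ => ?_
  rw [ContinuousLinearMap.adjoint_inner_left]
  rfl

open scoped Classical in
theorem entry_amplify_mul_amplify {f : κ ↪ ι} {g : κ' ↪ ι}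
    (hfg : ∀ k k', f k ≠ g k') (A : TensorPow H κ →L[ℂ] TensorPow H κ)
    (B : TensorPow H κ' →L[ℂ] TensorPow H κ') (α β : ι → basisIdx H) :
    entry (amplify f A * amplify g B) α β =
      if ∀ i, i ∉ Set.range f → i ∉ Set.range g → α i = β i then
        entry A (α ∘ f) (β ∘ f) * entry B (α ∘ g) (β ∘ g) else 0 := by
  -- The only intermediate multi-index that contributes.
  let γ₀ : ι → basisIdx H := fun i => if i ∈ Set.range f then β i else α i
  have hγ₀_f : ∀ k, γ₀ (f k) = β (f k) := fun k => if_pos ⟨k, rfl⟩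
  have hγ₀ : ∀ i, i ∉ Set.range f → γ₀ i = α i := fun i hi => if_neg hi
  have hγ₀_g : ∀ k, γ₀ (g k) = α (g k) := fun k =>
    hγ₀ _ (by rintro ⟨j, hj⟩; exact hfg j k hj)
  rw [entry_mul, tsum_eq_single γ₀]
  · rw [entry_amplify, entry_amplify, if_pos fun i hi => (hγ₀ i hi).symm,
      show γ₀ ∘ f = β ∘ f from funext hγ₀_f, show γ₀ ∘ g = α ∘ g from funext hγ₀_g, mul_ite,
      mul_zero]
    refine if_congr ⟨fun h i hi hi' => ?_, fun h i hi => ?_⟩ rfl rfl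
    · rw [← hγ₀ i hi]
      exact h i hi'
    · by_cases hif : i ∈ Set.range f
      · obtain ⟨k, rfl⟩ := hif
        exact hγ₀_f k
      · rw [hγ₀ i hif]
        exact h i hif hi
  · intro γ hγ
    rw [entry_amplify, entry_amplify]
    by_contra hne
    have hA := left_ne_zero_of_mul hne
    have hB := right_ne_zero_of_mul hne
    rw [ne_eq, ite_eq_right_iff, Classical.not_imp] at hA hB
    refine hγ (funext fun i => ?_)
    by_cases hif : i ∈ Set.range f
    · obtain ⟨k, rfl⟩ := hif
      rw [hγ₀_f]
      exact hB.1 _ (by rintro ⟨j, hj⟩; exact hfg k j hj.symm)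
    · rw [hγ₀ i hif]
      exact (hA.1 i hif).symm

theorem commute_amplify {f : κ ↪ ι} {g : κ' ↪ ι} (hfg : ∀ k k', f k ≠ g k')
    (A : TensorPow H κ →L[ℂ] TensorPow H κ) (B : TensorPow H κ' →L[ℂ] TensorPow H κ') :
    Commute (amplify f A) (amplify g B) := by
  classical
  refine ext_entry fun α β => ?_
  rw [entry_amplify_mul_amplify hfg, entry_amplify_mul_amplify fun k k' => (hfg k' k).symm,
    mul_comm]
  refine if_congr ⟨fun h i h1 h2 => h i h2 h1, fun h i h1 h2 => h i h2 h1⟩ rfl rfl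

end Entries

section Permutations
variable {H : Type*} [NormedAddCommGroup H] [InnerProductSpace ℂ H] [CompleteSpace H]
variable {ι κ : Type}

/-- `permute π` as a bounded operator. -/
def permuteOp (π : Equiv.Perm ι) : TensorPow H ι →L[ℂ] TensorPow H ι :=
  (permute π).toContinuousLinearMap

theorem permuteOp_basisVec (π : Equiv.Perm ι) (α : ι → basisIdx H) :
    permuteOp π (basisVec α) = basisVec (α ∘ π) :=
  isometryOfOrthonormal_basisVec (orthonormal_basisVec.comp (fun α => α ∘ π)
    fun _ _ h => π.surjective.injective_comp_right h) α

theorem star_permuteOp_basisVec (π : Equiv.Perm ι) (α : ι → basisIdx H) :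
    star (permuteOp π) (basisVec α) = basisVec (α ∘ π.symm) := by
  classical
  refine ext_inner_basisVec fun β => ?_
  rw [ContinuousLinearMap.star_eq_adjoint, ContinuousLinearMap.adjoint_inner_right,
    permuteOp_basisVec, inner_basisVec, inner_basisVec]
  refine if_congr ⟨fun h => ?_, fun h => ?_⟩ rfl rfl
  · rw [← h]; ext i; simp
  · rw [h]; ext i; simp

theorem permuteOp_mem_unitary (π : Equiv.Perm ι) :
    permuteOp π ∈ unitary (TensorPow H ι →L[ℂ] TensorPow H ι) := by
  rw [Unitary.mem_iff]
  constructor <;> refine ext_basisVec fun β => ?_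
  · rw [mul_apply_eq_comp, permuteOp_basisVec, star_permuteOp_basisVec]
    simp [Function.comp_assoc]
  · rw [mul_apply_eq_comp, star_permuteOp_basisVec, permuteOp_basisVec]
    simp [Function.comp_assoc]

theorem star_permuteOp (π : Equiv.Perm ι) :
    star (permuteOp π : TensorPow H ι →L[ℂ] TensorPow H ι) = permuteOp π.symm :=
  ext_basisVec fun β => by rw [star_permuteOp_basisVec, permuteOp_basisVec]

theorem permuteOp_conj_amplify (π : Equiv.Perm ι) (f : κ ↪ ι)
    (A : TensorPow H κ →L[ℂ] TensorPow H κ) :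
    permuteOp π * amplify f A * star (permuteOp π) = amplify (f.trans π.symm.toEmbedding) A := by
  classical
  refine ext_entry fun α β => ?_
  have hconj : entry (permuteOp π * amplify f A * star (permuteOp π)) α β =
      entry (amplify f A) (α ∘ π.symm) (β ∘ π.symm) := by
    rw [entry, mul_apply_eq_comp, mul_apply_eq_comp, star_permuteOp_basisVec,
      ← ContinuousLinearMap.adjoint_inner_left, ← ContinuousLinearMap.star_eq_adjoint,
      star_permuteOp_basisVec]
    rfl
  rw [hconj, entry_amplify, entry_amplify]
  refine if_congr ⟨fun h i hi => ?_, fun h i hi => ?_⟩ rfl rfl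
  · have := h (π i) fun ⟨k, hk⟩ => hi ⟨k, by simp [hk]⟩
    simpa using this
  · refine h (π.symm i) ?_
    rintro ⟨k, hk⟩
    exact hi ⟨k, π.symm.injective hk⟩

theorem star_permuteOp_conj_amplify (π : Equiv.Perm ι) (f : κ ↪ ι)
    (A : TensorPow H κ →L[ℂ] TensorPow H κ) :
    star (permuteOp π) * amplify f A * permuteOp π = amplify (f.trans π.toEmbedding) A := by
  have h := permuteOp_conj_amplify π.symm f A
  rwa [star_permuteOp, Equiv.symm_symm, ← star_permuteOp] at h

theorem isPermSymmetric_iff {T : TensorPow H ι →L[ℂ] TensorPow H ι} :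
    IsPermSymmetric T ↔ ∀ π, permuteOp π * T * star (permuteOp π) = T := by
  simp only [mul_assoc]
  exact Iff.rfl

end Permutations

open TraceClass

section PartialTrace
variable {H : Type*} [NormedAddCommGroup H] [InnerProductSpace ℂ H] [CompleteSpace H]
variable {ι κ κ' : Type}

/-- `x ↦ x ⊗ Ψ_y` as a bounded operator. -/
def insertOp (f : κ ↪ ι) (y : {i // i ∉ Set.range f} → basisIdx H) :
    TensorPow H κ →L[ℂ] TensorPow H ι := (insertVec f y).toContinuousLinearMap

/-- The diagonal block `V_y* T V_y` of `T`, where `V_y x = x ⊗ Ψ_y`. -/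
def block (f : κ ↪ ι) (y : {i // i ∉ Set.range f} → basisIdx H)
    (T : TensorPow H ι →L[ℂ] TensorPow H ι) : TensorPow H κ →L[ℂ] TensorPow H κ :=
  (insertOp f y).adjoint ∘L T ∘L insertOp f y

theorem partialTrace_eq_tsum_block (f : κ ↪ ι) (T : TensorPow H ι →L[ℂ] TensorPow H ι) :
    partialTrace f T = ∑' y, block f y T := rfl

theorem inner_block (f : κ ↪ ι) (y : {i // i ∉ Set.range f} → basisIdx H)
    (T : TensorPow H ι →L[ℂ] TensorPow H ι) (u v : TensorPow H κ) :
    ⟪u, block f y T v⟫_ℂ = ⟪insertVec f y u, T (insertVec f y v)⟫_ℂ := by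
  rw [block, ContinuousLinearMap.comp_apply, ContinuousLinearMap.adjoint_inner_right]
  rfl

theorem entry_block (f : κ ↪ ι) (y : {i // i ∉ Set.range f} → basisIdx H)
    (T : TensorPow H ι →L[ℂ] TensorPow H ι) (α β : κ → basisIdx H) :
    entry (block f y T) α β = entry T (merge f y α) (merge f y β) := by
  rw [entry, inner_block, insertVec_basisVec, insertVec_basisVec, entry]

theorem orthonormal_insertVec (f : κ ↪ ι) {X : Type*} {e : X → TensorPow H κ}
    (he : Orthonormal ℂ e) :
    Orthonormal ℂ fun p : X × ({i // i ∉ Set.range f} → basisIdx H) =>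
      insertVec f p.2 (e p.1) := by
  classical
  rw [orthonormal_iff_ite]
  rintro ⟨x, y⟩ ⟨x', y'⟩
  by_cases hy : y = y'
  · subst hy
    simp only [LinearIsometry.inner_map_map, orthonormal_iff_ite.1 he x x', Prod.mk.injEq,
      and_true]
  · rw [if_neg fun h => hy (Prod.mk.inj h).2]
    exact orthogonalFamily_insertVec f hy _ _

theorem exists_norm_le_two_mul_norm_inner {K : Type*} [NormedAddCommGroup K]
    [InnerProductSpace ℂ K] {S : K →L[ℂ] K} (hS : S ≠ 0) :
    ∃ u v : K, ‖u‖ = 1 ∧ ‖v‖ = 1 ∧ ‖S‖ ≤ 2 * ‖⟪u, S v⟫_ℂ‖ := by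
  have hpos : 0 < ‖S‖ := norm_pos_iff.2 hS
  obtain ⟨v, hv⟩ : ∃ v, ‖S‖ / 2 * ‖v‖ < ‖S v‖ := by
    by_contra! h
    have := S.opNorm_le_bound (by positivity) h
    linarith
  have hSv : S v ≠ 0 := fun h => by
    rw [h, norm_zero] at hv
    exact absurd hv (not_lt.2 (by positivity))
  have hv0 : v ≠ 0 := by
    rintro rfl
    exact hSv (map_zero S)
  have hv_pos := norm_pos_iff.2 hv0
  have hinner : ‖⟪(‖S v‖⁻¹ : ℂ) • S v, S ((‖v‖⁻¹ : ℂ) • v)⟫_ℂ‖ = ‖S v‖ / ‖v‖ := by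
    rw [map_smul, inner_smul_left, inner_smul_right, inner_self_eq_norm_sq_to_K, norm_mul,
      norm_mul]
    simp only [map_inv₀, Complex.conj_ofReal, norm_inv, Complex.norm_real, norm_norm, norm_pow,
      Complex.coe_algebraMap]
    field_simp
  refine ⟨(‖S v‖⁻¹ : ℂ) • S v, (‖v‖⁻¹ : ℂ) • v, norm_smul_inv_norm hSv, norm_smul_inv_norm hv0,
    ?_⟩
  rw [hinner, ← mul_div_assoc, le_div_iff₀ hv_pos]
  linarith

theorem summable_block (f : κ ↪ ι) (T : TraceClass (TensorPow H ι)) :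
    Summable fun y => block f y (toCLM T) := by
  classical
  refine Summable.of_norm (summable_of_sum_le (c := 2 * ‖T‖) (fun _ => norm_nonneg _) fun s => ?_)
  let s' := s.filter fun y => block f y (toCLM T) ≠ 0
  have hs' : ∑ y ∈ s, ‖block f y (toCLM T)‖ = ∑ y ∈ s', ‖block f y (toCLM T)‖ := by
    refine (Finset.sum_filter_of_ne fun y _ hy => ?_).symm
    simpa using hy
  have hunit : ∀ y : s', ∃ u v : TensorPow H κ, ‖u‖ = 1 ∧ ‖v‖ = 1 ∧
      ‖block f y (toCLM T)‖ ≤ 2 * ‖⟪u, block f y (toCLM T) v⟫_ℂ‖ := fun y =>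
    exists_norm_le_two_mul_norm_inner (Finset.mem_filter.1 y.2).2
  choose u v hu hv huv using hunit
  have hon : ∀ w : s' → TensorPow H κ, (∀ y, ‖w y‖ = 1) →
      Orthonormal ℂ fun y : s' => insertVec f y.1 (w y) := fun w hw => by
    refine ⟨fun y => by rw [LinearIsometry.norm_map, hw], fun y y' hy => ?_⟩
    exact orthogonalFamily_insertVec f (fun h => hy (Subtype.ext h)) _ _
  rw [hs', ← Finset.sum_coe_sort s']
  calc ∑ y : s', ‖block f y (toCLM T)‖
      ≤ ∑ y : s', 2 * ‖⟪insertVec f y.1 (u y), toCLM T (insertVec f y.1 (v y))⟫_ℂ‖ := by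
        refine Finset.sum_le_sum fun y _ => ?_
        rw [← inner_block]
        exact huv y
    _ ≤ 2 * ‖T‖ := by
        rw [← Finset.mul_sum]
        gcongr
        exact sum_norm_inner_le T (hon v hv) (hon u hu) Finset.univ

theorem hasSum_block (f : κ ↪ ι) (T : TraceClass (TensorPow H ι)) :
    HasSum (fun y => block f y (toCLM T)) (partialTrace f (toCLM T)) :=
  (summable_block f T).hasSum

theorem hasSum_inner_partialTrace (f : κ ↪ ι) (T : TraceClass (TensorPow H ι))
    (u v : TensorPow H κ) :
    HasSum (fun y => ⟪insertVec f y u, toCLM T (insertVec f y v)⟫_ℂ)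
      ⟪u, partialTrace f (toCLM T) v⟫_ℂ := by
  have h := ((hasSum_block f T).mapL (ContinuousLinearMap.apply ℂ _ v)).mapL (innerSL ℂ u)
  simpa only [innerSL_apply_apply, ContinuousLinearMap.apply_apply, inner_block] using h

theorem traceNorm_partialTrace_le (f : κ ↪ ι) (T : TraceClass (TensorPow H ι)) :
    traceNorm (partialTrace f (toCLM T)) ≤ traceNorm (toCLM T) := by
  refine traceNorm_le fun n e e' he he' => ?_
  calc ∑ i, ‖⟪e' i, partialTrace f (toCLM T) (e i)⟫_ℂ‖ₑ
      ≤ ∑ i, ∑' y, ‖⟪insertVec f y (e' i), toCLM T (insertVec f y (e i))⟫_ℂ‖ₑ := by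
        refine Finset.sum_le_sum fun i _ => ?_
        rw [← (hasSum_inner_partialTrace f T _ _).tsum_eq]
        exact enorm_tsum_le_tsum_enorm
    _ = ∑' p : Fin n × _,
          ‖⟪insertVec f p.2 (e' p.1), toCLM T (insertVec f p.2 (e p.1))⟫_ℂ‖ₑ := by
        rw [ENNReal.tsum_prod', tsum_fintype]
    _ ≤ traceNorm (toCLM T) :=
        tsum_enorm_inner_le_traceNorm (orthonormal_insertVec f he) (orthonormal_insertVec f he')

theorem partialTrace_add (f : κ ↪ ι) (S T : TraceClass (TensorPow H ι)) :
    partialTrace f (toCLM S + toCLM T) = partialTrace f (toCLM S) + partialTrace f (toCLM T) := by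
  rw [← ((hasSum_block f S).add (hasSum_block f T)).tsum_eq, partialTrace_eq_tsum_block]
  refine tsum_congr fun y => ?_
  simp only [block, ContinuousLinearMap.comp_add, ContinuousLinearMap.add_comp]

theorem partialTrace_smul (f : κ ↪ ι) (c : ℂ) (T : TraceClass (TensorPow H ι)) :
    partialTrace f (c • toCLM T) = c • partialTrace f (toCLM T) := by
  rw [← ((hasSum_block f T).const_smul c).tsum_eq, partialTrace_eq_tsum_block]
  refine tsum_congr fun y => ?_
  simp only [block, ContinuousLinearMap.smul_comp, ContinuousLinearMap.comp_smul]

/-- The partial trace, bundled as a contraction between spaces of trace class operators. -/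
def traceOut (f : κ ↪ ι) : TraceClass (TensorPow H ι) →L[ℂ] TraceClass (TensorPow H κ) :=
  mkContinuous
    { toFun := fun T => partialTrace f (toCLM T)
      map_add' := partialTrace_add f
      map_smul' := partialTrace_smul f } 1 fun T => by
    rw [one_mul, ofReal_norm, enorm_eq]
    exact traceNorm_partialTrace_le f T

@[simp]
theorem toCLM_traceOut (f : κ ↪ ι) (T : TraceClass (TensorPow H ι)) :
    toCLM (traceOut f T) = partialTrace f (toCLM T) := rfl

theorem norm_traceOut_apply_le (f : κ ↪ ι) (T : TraceClass (TensorPow H ι)) :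
    ‖traceOut f T‖ ≤ ‖T‖ := by
  rw [norm_le_iff (norm_nonneg T), ofReal_norm, enorm_eq]
  exact traceNorm_partialTrace_le f T

/-- A multi-index is determined by its values on and off the range of `f`. -/
def mergeEquiv (f : κ ↪ ι) :
    (κ → basisIdx H) × ({i // i ∉ Set.range f} → basisIdx H) ≃ (ι → basisIdx H) where
  toFun p := merge f p.2 p.1
  invFun := fun α => (α ∘ f, fun i => α i)
  left_inv _ := Prod.ext (merge_comp f _ _) (funext fun i => merge_apply_not_mem f _ _ i)
  right_inv α := merge_restrict f α

theorem trace_mulRight_traceOut (f : κ ↪ ι) (T : TraceClass (TensorPow H ι))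
    (A : TensorPow H κ →L[ℂ] TensorPow H κ) :
    trace (mulRight A (traceOut f T)) = trace (mulRight (amplify f A) T) := by
  have hι := hasSum_trace (mulRight (amplify f A) T) (tensorBasis H ι)
  rw [← (mergeEquiv f).hasSum_iff] at hι
  refine (hasSum_trace (mulRight A (traceOut f T)) (tensorBasis H κ)).unique
    (hι.prod_fiberwise fun x => ?_)
  simp only [tensorBasis_apply, toCLM_mulRight, toCLM_traceOut, mul_apply_eq_comp]
  convert hasSum_inner_partialTrace f T (basisVec x) (A (basisVec x)) using 2 with y
  rw [Function.comp_apply, mergeEquiv, Equiv.coe_fn_mk, ← insertVec_basisVec, amplify_insertVec]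

theorem trace_traceOut (f : κ ↪ ι) (T : TraceClass (TensorPow H ι)) :
    trace (traceOut f T) = trace T := by
  have mulRight_one : ∀ {ι : Type} (S : TraceClass (TensorPow H ι)), mulRight 1 S = S :=
    fun _ => TraceClass.ext (by simp)
  simpa only [amplify_one, mulRight_one] using trace_mulRight_traceOut f T 1

theorem isPositive_of_hasSum {K X : Type*} [NormedAddCommGroup K] [InnerProductSpace ℂ K]
    [CompleteSpace K] {S : X → K →L[ℂ] K} {T : K →L[ℂ] K} (h : HasSum S T)
    (hS : ∀ i, (S i).IsPositive) : T.IsPositive := by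
  rw [← ContinuousLinearMap.nonneg_iff_isPositive]
  exact CStarAlgebra.isClosed_nonneg.mem_of_tendsto h <| Eventually.of_forall fun s =>
    Finset.sum_nonneg fun i _ => (ContinuousLinearMap.nonneg_iff_isPositive _).2 (hS i)

theorem isPositive_traceOut (f : κ ↪ ι) {T : TraceClass (TensorPow H ι)}
    (hT : (toCLM T).IsPositive) : (toCLM (traceOut f T)).IsPositive :=
  isPositive_of_hasSum (hasSum_block f T) fun y => hT.adjoint_conj (insertOp f y)

theorem traceOut_traceOut (f : κ ↪ κ') (g : κ' ↪ ι) (T : TraceClass (TensorPow H ι)) :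
    traceOut f (traceOut g T) = traceOut (f.trans g) T :=
  ext_trace_mulRight fun A => by
    rw [trace_mulRight_traceOut, trace_mulRight_traceOut, trace_mulRight_traceOut,
      amplify_amplify]

theorem traceOut_trans_perm (f : κ ↪ ι) (π : Equiv.Perm ι) {T : TraceClass (TensorPow H ι)}
    (hT : IsPermSymmetric (toCLM T)) : traceOut (f.trans π.toEmbedding) T = traceOut f T := by
  have hconj : conj (permuteOp π) T = T := TraceClass.ext <| by
    rw [toCLM_conj, isPermSymmetric_iff.1 hT]
  refine ext_trace_mulRight fun A => ?_
  rw [trace_mulRight_traceOut, trace_mulRight_traceOut, ← star_permuteOp_conj_amplify,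
    ← trace_mulRight_conj, hconj]

theorem traceOut_eq_of_isPermSymmetric {k N : ℕ} (f g : Fin k ↪ Fin N)
    {T : TraceClass (TensorPow H (Fin N))} (hT : IsPermSymmetric (toCLM T)) :
    traceOut f T = traceOut g T := by
  have := Equiv.Perm.isMultiplyPretransitive (Fin N) k
  obtain ⟨π, rfl⟩ := MulAction.exists_smul_eq (Equiv.Perm (Fin N)) f g
  exact (traceOut_trans_perm f π hT).symm

end PartialTrace

section Compression
variable {K K' : Type*} [NormedAddCommGroup K] [InnerProductSpace ℂ K] [CompleteSpace K]
  [NormedAddCommGroup K'] [InnerProductSpace ℂ K'] [CompleteSpace K']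

/-- The compression `T ↦ J* T J` along an isometry, on trace class operators. -/
def compress (J : K' →ₗᵢ[ℂ] K) : TraceClass K →L[ℂ] TraceClass K' :=
  mkContinuous
    { toFun := fun T => J.toContinuousLinearMap.adjoint ∘L toCLM T ∘L J.toContinuousLinearMap
      map_add' := fun S T => by
        simp only [map_add, ContinuousLinearMap.comp_add, ContinuousLinearMap.add_comp]
      map_smul' := fun c T => by
        simp only [map_smul, ContinuousLinearMap.smul_comp, ContinuousLinearMap.comp_smul,
          RingHom.id_apply] } 1 fun T => by
    rw [one_mul, ofReal_norm, enorm_eq]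
    exact traceNorm_conj_le J J

theorem toCLM_compress (J : K' →ₗᵢ[ℂ] K) (T : TraceClass K) :
    toCLM (compress J T) =
      J.toContinuousLinearMap.adjoint ∘L toCLM T ∘L J.toContinuousLinearMap := rfl

theorem norm_compress_apply_le (J : K' →ₗᵢ[ℂ] K) (T : TraceClass K) : ‖compress J T‖ ≤ ‖T‖ := by
  rw [norm_le_iff (norm_nonneg T), ofReal_norm, enorm_eq]
  exact traceNorm_conj_le J J

end Compression

section OneParticle
variable {H : Type*} [NormedAddCommGroup H] [InnerProductSpace ℂ H] [CompleteSpace H]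

/-- `oneParticle` as a bounded operator. -/
def oneParticleOp (H : Type*) [NormedAddCommGroup H] [InnerProductSpace ℂ H] [CompleteSpace H] :
    H →L[ℂ] TensorPow H (Fin 1) := (oneParticle (H := H)).toContinuousLinearMap

theorem oneParticle_basis (j : basisIdx H) : oneParticle (basis H j) = basisVec fun _ => j := by
  classical
  change isometryOfOrthonormal (orthonormal_basisVec.comp (fun (j : basisIdx H) (_ : Fin 1) => j)
    fun _ _ h => congrFun h 0) ((basis H).repr (basis H j)) = _
  rw [HilbertBasis.repr_self, isometryOfOrthonormal, OrthogonalFamily.linearIsometry_apply_single]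
  simp [LinearIsometry.toSpanSingleton_apply]

theorem adjoint_oneParticle_apply (x : H) : (oneParticleOp H).adjoint (oneParticle x) = x :=
  congrArg (fun T : H →L[ℂ] H => T x) (oneParticle (H := H)).adjoint_comp_self

theorem adjoint_oneParticle_basisVec (α : Fin 1 → basisIdx H) :
    (oneParticleOp H).adjoint (basisVec α) = basis H (α 0) := by
  rw [← adjoint_oneParticle_apply (basis H (α 0)), oneParticle_basis]
  congr 2
  ext i; rw [Subsingleton.elim i 0]

theorem oneParticle_comp_adjoint : oneParticleOp H ∘L (oneParticleOp H).adjoint = 1 :=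
  ext_basisVec fun β => by
    rw [ContinuousLinearMap.comp_apply, adjoint_oneParticle_basisVec]
    refine (oneParticle_basis (β 0)).trans (congrArg basisVec (funext fun i => ?_))
    rw [Subsingleton.elim i 0]

theorem oneParticle_adjoint_apply (x : TensorPow H (Fin 1)) :
    oneParticle ((oneParticleOp H).adjoint x) = x :=
  congrArg (fun T : TensorPow H (Fin 1) →L[ℂ] TensorPow H (Fin 1) => T x) oneParticle_comp_adjoint

theorem liftOp_lowerOp (T : TensorPow H (Fin 1) →L[ℂ] TensorPow H (Fin 1)) :
    liftOp (lowerOp T) = T := by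
  change oneParticleOp H ∘L ((oneParticleOp H).adjoint ∘L T ∘L oneParticleOp H) ∘L
    (oneParticleOp H).adjoint = T
  rw [ContinuousLinearMap.comp_assoc, ContinuousLinearMap.comp_assoc, oneParticle_comp_adjoint,
    ← ContinuousLinearMap.comp_assoc, oneParticle_comp_adjoint]
  rfl

theorem lowerOp_liftOp (A : H →L[ℂ] H) : lowerOp (liftOp A) = A := by
  ext x
  change (oneParticleOp H).adjoint (oneParticle (A ((oneParticleOp H).adjoint (oneParticle x)))) = _
  rw [adjoint_oneParticle_apply, adjoint_oneParticle_apply]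

/-- The isomorphism between a Hilbert space and its first tensor power. -/
def oneParticleEquiv : H ≃ₗᵢ[ℂ] TensorPow H (Fin 1) :=
  LinearIsometryEquiv.ofSurjective oneParticle fun x => ⟨_, oneParticle_adjoint_apply x⟩

/-- `lowerOp` on trace class operators. -/
def lower : TraceClass (TensorPow H (Fin 1)) →L[ℂ] TraceClass H := compress oneParticle

/-- `liftOp` on trace class operators; it is inverse to `lower`. -/
def raise : TraceClass H →L[ℂ] TraceClass (TensorPow H (Fin 1)) :=
  compress oneParticleEquiv.symm.toLinearIsometry

@[simp]
theorem toCLM_lower (T : TraceClass (TensorPow H (Fin 1))) :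
    toCLM (lower T) = lowerOp (toCLM T) := rfl

@[simp]
theorem toCLM_raise (T : TraceClass H) : toCLM (raise T) = liftOp (toCLM T) := by
  have hsymm : oneParticleEquiv.symm.toLinearIsometry.toContinuousLinearMap =
      (oneParticleOp H).adjoint := by
    ext x : 1
    exact oneParticleEquiv.symm_apply_eq.2 (oneParticle_adjoint_apply x).symm
  rw [raise, toCLM_compress, hsymm, ContinuousLinearMap.adjoint_adjoint]
  rfl

theorem norm_lower_apply_le (T : TraceClass (TensorPow H (Fin 1))) : ‖lower T‖ ≤ ‖T‖ :=
  norm_compress_apply_le _ T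

theorem norm_raise_apply_le (T : TraceClass H) : ‖raise T‖ ≤ ‖T‖ := norm_compress_apply_le _ T

theorem lower_raise (T : TraceClass H) : lower (raise T) = T :=
  TraceClass.ext <| by rw [toCLM_lower, toCLM_raise, lowerOp_liftOp]

end OneParticle

section LastFactor
variable {H : Type*} [NormedAddCommGroup H] [InnerProductSpace ℂ H] [CompleteSpace H]

/-- The embedding with the single value `i`. -/
def pointEmb {ι : Type} (i : ι) : Fin 1 ↪ ι :=
  ⟨fun _ : Fin 1 => i, fun _ _ _ => Subsingleton.elim _ _⟩

theorem atFactor_eq {ι : Type} (i : ι) (A : H →L[ℂ] H) :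
    atFactor i A = amplify (pointEmb i) (liftOp A) := rfl

theorem atFactor_lowerOp {ι : Type} (i : ι) (T : TensorPow H (Fin 1) →L[ℂ] TensorPow H (Fin 1)) :
    atFactor i (lowerOp T) = amplify (pointEmb i) T := by
  rw [atFactor_eq, liftOp_lowerOp]

theorem amplify_atFactor {ι κ : Type} (f : κ ↪ ι) (i : κ) (A : H →L[ℂ] H) :
    amplify f (atFactor i A) = atFactor (f i) A :=
  amplify_amplify _ _ _

theorem commute_atFactor {ι : Type} {i j : ι} (hij : i ≠ j) (A B : H →L[ℂ] H) :
    Commute (atFactor i A) (atFactor j B) :=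
  commute_amplify (fun _ _ => hij) _ _

theorem not_mem_range_castAddEmb {k : ℕ} (i : Fin (k + 1)) :
    i ∉ Set.range (Fin.castAddEmb 1 : Fin k ↪ Fin (k + 1)) ↔ i = Fin.last k := by
  refine ⟨fun h => ?_, ?_⟩
  · induction i using Fin.lastCases with
    | last => rfl
    | cast j => exact absurd ⟨j, rfl⟩ h
  · rintro rfl ⟨j, hj⟩
    exact (Fin.castSucc_lt_last j).ne hj

/-- The block of an operator at the basis vector `j` of the last factor. -/
def lastBlock {k : ℕ} (j : basisIdx H)
    (T : TensorPow H (Fin (k + 1)) →L[ℂ] TensorPow H (Fin (k + 1))) :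
    TensorPow H (Fin k) →L[ℂ] TensorPow H (Fin k) :=
  block (Fin.castAddEmb 1) (fun _ => j) T

theorem partialTrace_eq_tsum_lastBlock {k : ℕ}
    (T : TensorPow H (Fin (k + 1)) →L[ℂ] TensorPow H (Fin (k + 1))) :
    partialTrace (Fin.castAddEmb 1 : Fin k ↪ Fin (k + 1)) T = ∑' j, lastBlock j T := by
  let u : Unique {i // i ∉ Set.range (Fin.castAddEmb 1 : Fin k ↪ Fin (k + 1))} :=
    { default := ⟨Fin.last k, (not_mem_range_castAddEmb _).2 rfl⟩
      uniq := fun i => Subtype.ext ((not_mem_range_castAddEmb _).1 i.2) }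
  rw [partialTrace_eq_tsum_block]
  exact ((Equiv.funUnique _ (basisIdx H)).symm.tsum_eq fun y => block _ y T).symm

theorem hasSum_lastBlock {k : ℕ} (T : TraceClass (TensorPow H (Fin (k + 1)))) :
    HasSum (fun j => lastBlock j (toCLM T))
      (partialTrace (Fin.castAddEmb 1 : Fin k ↪ Fin (k + 1)) (toCLM T)) := by
  rw [partialTrace_eq_tsum_lastBlock]
  refine Summable.hasSum ?_
  exact (summable_block (Fin.castAddEmb 1) T).comp_injective
    (i := fun (j : basisIdx H) (_ : {i // i ∉ Set.range (Fin.castAddEmb 1)}) => j)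
    fun j j' h => congrFun h ⟨Fin.last k, (not_mem_range_castAddEmb _).2 rfl⟩

theorem merge_castSucc {k : ℕ} (j : basisIdx H) (α : Fin k → basisIdx H) (i : Fin k) :
    merge (Fin.castAddEmb 1 : Fin k ↪ Fin (k + 1)) (fun _ => j) α i.castSucc = α i :=
  merge_apply_mem (Fin.castAddEmb 1 : Fin k ↪ Fin (k + 1)) _ _ i

theorem merge_last {k : ℕ} (j : basisIdx H) (α : Fin k → basisIdx H) :
    merge (Fin.castAddEmb 1 : Fin k ↪ Fin (k + 1)) (fun _ => j) α (Fin.last k) = j :=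
  merge_apply_not_mem (Fin.castAddEmb 1 : Fin k ↪ Fin (k + 1)) _ _
    ⟨Fin.last k, (not_mem_range_castAddEmb _).2 rfl⟩

/-- The pair consisting of `i` and the last index. -/
def lastPair {k : ℕ} (i : Fin k) : Fin 2 ↪ Fin (k + 1) :=
  pairEmb i.castSucc (Fin.last k) (Fin.castSucc_lt_last i)

theorem lastBlock_amplify_lastPair {k : ℕ} (i : Fin k) (j : basisIdx H)
    (Y : TensorPow H (Fin 2) →L[ℂ] TensorPow H (Fin 2)) :
    lastBlock j (amplify (lastPair i) Y) = amplify (pointEmb i) (lastBlock (k := 1) j Y) := by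
  classical
  refine ext_entry fun α β => ?_
  have h : ∀ α : Fin k → basisIdx H,
      merge (Fin.castAddEmb 1 : Fin k ↪ Fin (k + 1)) (fun _ => j) α ∘ lastPair i =
      merge (Fin.castAddEmb 1 : Fin 1 ↪ Fin 2) (fun _ => j) (α ∘ pointEmb i) := fun α => by
    ext1 a
    refine Fin.lastCases ?_ (fun b => ?_) a
    · rw [merge_last]
      exact merge_last j α
    · rw [merge_castSucc, Subsingleton.elim b 0]
      exact merge_castSucc j α i
  rw [lastBlock, entry_block, entry_amplify, entry_amplify, lastBlock, entry_block, h, h]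
  refine @if_congr _ _ _ (_) (_) _ _ _ _ ⟨fun h1 a ha => ?_, fun h1 a ha => ?_⟩ rfl rfl
  · have := h1 a.castSucc ?_
    · rwa [merge_castSucc, merge_castSucc] at this
    · rintro ⟨b, hb⟩
      induction b using Fin.lastCases with
      | last => exact (Fin.castSucc_lt_last a).ne hb.symm
      | cast b =>
        rw [Subsingleton.elim b 0] at hb
        exact ha ⟨0, Fin.castSucc_injective _ hb⟩
  · induction a using Fin.lastCases with
    | last => rw [merge_last, merge_last]
    | cast a =>
      rw [merge_castSucc, merge_castSucc]
      refine h1 a ?_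
      rintro ⟨b, rfl⟩
      exact ha ⟨0, rfl⟩

theorem lastBlock_amplify_mul {k : ℕ} (j : basisIdx H)
    (R : TensorPow H (Fin k) →L[ℂ] TensorPow H (Fin k))
    (T : TensorPow H (Fin (k + 1)) →L[ℂ] TensorPow H (Fin (k + 1))) :
    lastBlock j (amplify (Fin.castAddEmb 1) R * T) = R * lastBlock j T := by
  refine ContinuousLinearMap.ext fun x => ext_inner_left ℂ fun u => ?_
  rw [lastBlock, inner_block, mul_apply_eq_comp, ← ContinuousLinearMap.adjoint_inner_left,
    adjoint_amplify, amplify_insertVec, mul_apply_eq_comp,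
    ← ContinuousLinearMap.adjoint_inner_left R, lastBlock, inner_block]

theorem partialTrace_amplify_mul_lastPair {k : ℕ} (i : Fin k)
    (R : TensorPow H (Fin k) →L[ℂ] TensorPow H (Fin k)) (Y : TraceClass (TensorPow H (Fin 2))) :
    partialTrace (Fin.castAddEmb 1)
        (amplify (Fin.castAddEmb 1) R * amplify (lastPair i) (toCLM Y)) =
      R * amplify (pointEmb i)
        (partialTrace (Fin.castAddEmb 1 : Fin 1 ↪ Fin (1 + 1)) (toCLM Y)) := by
  rw [partialTrace_eq_tsum_lastBlock]
  have h := ((hasSum_lastBlock (k := 1) Y).mapL (amplifyL (pointEmb i))).mul_left R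
  rw [amplifyL_apply] at h
  rw [← h.tsum_eq]
  refine tsum_congr fun j => ?_
  rw [lastBlock_amplify_mul, lastBlock_amplify_lastPair]
  rfl

end LastFactor

theorem exists_star_mul_self_eq {K : Type*} [NormedAddCommGroup K] [InnerProductSpace ℂ K]
    [CompleteSpace K] {T : K →L[ℂ] K} (hT : T.IsPositive) : ∃ R, star R * R = T :=
  ⟨CFC.sqrt T, by
    rw [(CFC.sqrt_nonneg T).isSelfAdjoint.star_eq, CFC.sqrt_mul_sqrt_self T
      ((ContinuousLinearMap.nonneg_iff_isPositive T).mpr hT)]⟩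

section TensorProduct
variable {H : Type*} [NormedAddCommGroup H] [InnerProductSpace ℂ H] [CompleteSpace H]
variable {ι κ κ' : Type}

theorem isPositive_amplify_mul_amplify {f : κ ↪ ι} {g : κ' ↪ ι} (hfg : ∀ k k', f k ≠ g k')
    {X : TensorPow H κ →L[ℂ] TensorPow H κ} {Y : TensorPow H κ' →L[ℂ] TensorPow H κ'}
    (hX : X.IsPositive) (hY : Y.IsPositive) : (amplify f X * amplify g Y).IsPositive := by
  obtain ⟨R, rfl⟩ := exists_star_mul_self_eq hX
  obtain ⟨S, rfl⟩ := exists_star_mul_self_eq hY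
  have hsq : amplify f (star R * R) * amplify g (star S * S) =
      star (amplify g S * amplify f R) * (amplify g S * amplify f R) := by
    rw [star_mul, ← amplify_star, ← amplify_star, amplify_mul, amplify_mul, mul_assoc, mul_assoc,
      (commute_amplify hfg R (star S)).left_comm, ← (commute_amplify hfg R S).eq]
  rw [hsq]
  exact ContinuousLinearMap.isPositive_adjoint_comp_self _

theorem traceNorm_amplify_mul_amplify_le_of_isPositive {f : κ ↪ ι} {g : κ' ↪ ι}
    (hfg : ∀ k k', f k ≠ g k') (hcov : ∀ i, i ∈ Set.range f ∨ i ∈ Set.range g)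
    {X : TensorPow H κ →L[ℂ] TensorPow H κ} {Y : TensorPow H κ' →L[ℂ] TensorPow H κ'}
    (hX : X.IsPositive) (hY : Y.IsPositive) :
    traceNorm (amplify f X * amplify g Y) ≤ traceNorm X * traceNorm Y := by
  have hinj : Function.Injective
      fun α : ι → basisIdx H => ((α ∘ f, α ∘ g) : (κ → basisIdx H) × (κ' → basisIdx H)) := by
    intro α β h
    ext1 i
    rcases hcov i with ⟨k, rfl⟩ | ⟨k, rfl⟩
    · exact congrFun (Prod.mk.inj h).1 k
    · exact congrFun (Prod.mk.inj h).2 k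
  have hdiag : ∀ α, ‖entry (amplify f X * amplify g Y) α α‖ₑ =
      ‖entry X (α ∘ f) (α ∘ f)‖ₑ * ‖entry Y (α ∘ g) (α ∘ g)‖ₑ := fun α => by
    rw [entry_amplify_mul_amplify hfg, if_pos fun _ _ _ => rfl, enorm_mul]
  calc traceNorm (amplify f X * amplify g Y)
      = ∑' α, ‖entry X (α ∘ f) (α ∘ f)‖ₑ * ‖entry Y (α ∘ g) (α ∘ g)‖ₑ := by
        rw [traceNorm_eq_tsum (isPositive_amplify_mul_amplify hfg hX hY) (tensorBasis H ι)]
        refine tsum_congr fun α => ?_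
        rw [tensorBasis_apply]
        exact hdiag α
    _ ≤ ∑' p : (κ → basisIdx H) × (κ' → basisIdx H), ‖entry X p.1 p.1‖ₑ * ‖entry Y p.2 p.2‖ₑ :=
        ENNReal.tsum_comp_le_tsum_of_injective hinj
          fun p => ‖entry X p.1 p.1‖ₑ * ‖entry Y p.2 p.2‖ₑ
    _ = (∑' β, ‖entry X β β‖ₑ) * ∑' γ, ‖entry Y γ γ‖ₑ := by
        rw [ENNReal.tsum_prod (f := fun β γ => ‖entry X β β‖ₑ * ‖entry Y γ γ‖ₑ)]
        simp only [ENNReal.tsum_mul_left, ENNReal.tsum_mul_right]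
    _ = traceNorm X * traceNorm Y := by
        rw [traceNorm_eq_tsum hX (tensorBasis H κ), traceNorm_eq_tsum hY (tensorBasis H κ')]
        simp only [tensorBasis_apply, entry]

/-- The positive parts of the polar decompositions of `X` and `Y` carry their trace norms, and the
partial isometries only contract. -/
theorem traceNorm_amplify_mul_amplify_le {f : κ ↪ ι} {g : κ' ↪ ι}
    (hfg : ∀ k k', f k ≠ g k') (hcov : ∀ i, i ∈ Set.range f ∨ i ∈ Set.range g)
    (X : TensorPow H κ →L[ℂ] TensorPow H κ) (Y : TensorPow H κ' →L[ℂ] TensorPow H κ') :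
    traceNorm (amplify f X * amplify g Y) ≤ traceNorm X * traceNorm Y := by
  obtain ⟨P, V, hP, hPX, hV, hVX⟩ := exists_isPositive_seq_tendsto_mul X
  obtain ⟨Q, W, hQ, hQY, hW, hWY⟩ := exists_isPositive_seq_tendsto_mul Y
  have hlim : Tendsto (fun n => amplify f (V n * P) * amplify g (W n * Q)) atTop
      (𝓝 (amplify f X * amplify g Y)) :=
    (((amplifyL f).continuous.tendsto X).comp hVX).mul
      (((amplifyL g).continuous.tendsto Y).comp hWY)
  refine traceNorm_le_of_tendsto hlim (.of_forall fun n => ?_)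
  have hcontr : ‖amplify f (V n) * amplify g (W n)‖ ≤ 1 :=
    (norm_mul_le _ _).trans <| mul_le_one₀ ((norm_amplify_le f _).trans (hV n)) (norm_nonneg _)
      ((norm_amplify_le g _).trans (hW n))
  calc traceNorm (amplify f (V n * P) * amplify g (W n * Q))
      = traceNorm ((amplify f (V n) * amplify g (W n)) * (amplify f P * amplify g Q)) := by
        rw [amplify_mul, amplify_mul, mul_assoc, mul_assoc,
          (commute_amplify hfg P (W n)).left_comm]
    _ ≤ traceNorm (amplify f P * amplify g Q) := traceNorm_mul_le_of_norm_le_one hcontr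
    _ ≤ traceNorm P * traceNorm Q :=
        traceNorm_amplify_mul_amplify_le_of_isPositive hfg hcov hP hQ
    _ = traceNorm X * traceNorm Y := by rw [hPX, hQY]

theorem traceNorm_amplify_mul_amplify_toCLM_le {f : κ ↪ ι} {g : κ' ↪ ι}
    (hfg : ∀ k k', f k ≠ g k') (hcov : ∀ i, i ∈ Set.range f ∨ i ∈ Set.range g)
    (X : TraceClass (TensorPow H κ)) (Y : TraceClass (TensorPow H κ')) :
    traceNorm (amplify f (toCLM X) * amplify g (toCLM Y)) ≤ ENNReal.ofReal (1 * ‖X‖ * ‖Y‖) := by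
  rw [one_mul, ENNReal.ofReal_mul (norm_nonneg X), ofReal_norm, ofReal_norm, enorm_eq, enorm_eq]
  exact traceNorm_amplify_mul_amplify_le hfg hcov _ _

/-- The tensor product of trace class operators on complementary sets of factors. -/
def tensor (f : κ ↪ ι) (g : κ' ↪ ι) (hfg : ∀ k k', f k ≠ g k')
    (hcov : ∀ i, i ∈ Set.range f ∨ i ∈ Set.range g) :
    TraceClass (TensorPow H κ) →L[ℂ] TraceClass (TensorPow H κ') →L[ℂ]
      TraceClass (TensorPow H ι) :=
  LinearMap.mkContinuous₂
    (LinearMap.mk₂ ℂ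
      (fun X Y => TraceClass.mk (amplify f (toCLM X) * amplify g (toCLM Y))
        (ne_top_of_le_ne_top ENNReal.ofReal_ne_top
          (traceNorm_amplify_mul_amplify_toCLM_le hfg hcov X Y)))
      (fun X X' Y => TraceClass.ext (by simp [← amplifyL_apply, add_mul]))
      (fun c X Y => TraceClass.ext (by simp [← amplifyL_apply]))
      (fun X Y Y' => TraceClass.ext (by simp [← amplifyL_apply, mul_add]))
      (fun c X Y => TraceClass.ext (by simp [← amplifyL_apply]))) 1
    fun X Y => (TraceClass.norm_le_iff (by positivity)).2
      (traceNorm_amplify_mul_amplify_toCLM_le hfg hcov X Y)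

theorem toCLM_tensor (f : κ ↪ ι) (g : κ' ↪ ι) (hfg : ∀ k k', f k ≠ g k')
    (hcov : ∀ i, i ∈ Set.range f ∨ i ∈ Set.range g) (X : TraceClass (TensorPow H κ))
    (Y : TraceClass (TensorPow H κ')) :
    toCLM (tensor f g hfg hcov X Y) = amplify f (toCLM X) * amplify g (toCLM Y) := rfl

theorem norm_tensor_apply_le (f : κ ↪ ι) (g : κ' ↪ ι) (hfg : ∀ k k', f k ≠ g k')
    (hcov : ∀ i, i ∈ Set.range f ∨ i ∈ Set.range g) (X : TraceClass (TensorPow H κ))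
    (Y : TraceClass (TensorPow H κ')) : ‖tensor f g hfg hcov X Y‖ ≤ ‖X‖ * ‖Y‖ := by
  rw [norm_le_iff (by positivity), toCLM_tensor, ← one_mul ‖X‖]
  exact traceNorm_amplify_mul_amplify_toCLM_le hfg hcov X Y

end TensorProduct

section TensorPowers
variable {H : Type*} [NormedAddCommGroup H] [InnerProductSpace ℂ H] [CompleteSpace H]

theorem castAddEmb_ne_last {k : ℕ} (i : Fin k) (j : Fin 1) :
    (Fin.castAddEmb 1 : Fin k ↪ Fin (k + 1)) i ≠ pointEmb (Fin.last k) j :=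
  (Fin.castSucc_lt_last i).ne

theorem mem_range_castAddEmb_or {k : ℕ} (i : Fin (k + 1)) :
    i ∈ Set.range (Fin.castAddEmb 1 : Fin k ↪ Fin (k + 1)) ∨
      i ∈ Set.range (pointEmb (Fin.last k)) :=
  or_iff_not_imp_left.mpr fun h => ⟨0, ((not_mem_range_castAddEmb i).1 h).symm⟩

/-- `X ⊗ A`, with `X` acting on the first `k` factors and `A` on the last one. -/
def tensorSnoc (k : ℕ) : TraceClass (TensorPow H (Fin k)) →L[ℂ] TraceClass H →L[ℂ]
    TraceClass (TensorPow H (Fin (k + 1))) :=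
  (tensor (Fin.castAddEmb 1) (pointEmb (Fin.last k)) castAddEmb_ne_last
    mem_range_castAddEmb_or).bilinearComp (ContinuousLinearMap.id ℂ _) raise

theorem tensorSnoc_apply (k : ℕ) (X : TraceClass (TensorPow H (Fin k))) (A : TraceClass H) :
    tensorSnoc k X A = tensor (Fin.castAddEmb 1) (pointEmb (Fin.last k)) castAddEmb_ne_last
      mem_range_castAddEmb_or X (raise A) := rfl

@[simp]
theorem toCLM_tensorSnoc (k : ℕ) (X : TraceClass (TensorPow H (Fin k))) (A : TraceClass H) :
    toCLM (tensorSnoc k X A) =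
      amplify (Fin.castAddEmb 1) (toCLM X) * atFactor (Fin.last k) (toCLM A) := by
  rw [tensorSnoc_apply, toCLM_tensor, toCLM_raise, atFactor_eq]

theorem norm_tensorSnoc_apply_le (k : ℕ) (X : TraceClass (TensorPow H (Fin k)))
    (A : TraceClass H) : ‖tensorSnoc k X A‖ ≤ ‖X‖ * ‖A‖ := by
  rw [tensorSnoc_apply]
  exact (norm_tensor_apply_le _ _ _ _ X _).trans (by gcongr; exact norm_raise_apply_le A)

theorem tensorPowOp_succ (k : ℕ) (A : H →L[ℂ] H) :
    tensorPowOp (k + 1) A =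
      amplify (Fin.castAddEmb 1) (tensorPowOp k A) * atFactor (Fin.last k) A := by
  have hfirst : amplify (Fin.castAddEmb 1) (tensorPowOp k A) =
      (List.ofFn fun i : Fin k => atFactor i.castSucc A).prod := by
    change amplifyHom (Fin.castAddEmb 1) (List.ofFn fun i => atFactor i A).prod = _
    rw [map_list_prod, List.map_ofFn]
    congr 2
    ext1 i
    exact amplify_atFactor (Fin.castAddEmb 1) i A
  rw [hfirst, tensorPowOp, List.ofFn_succ_last, List.prod_append, List.prod_singleton]

theorem traceNorm_one_fin_zero :
    traceNorm (1 : TensorPow H (Fin 0) →L[ℂ] TensorPow H (Fin 0)) = 1 := by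
  have hnorm : ‖tensorBasis H (Fin 0) default‖ = 1 := (tensorBasis H (Fin 0)).orthonormal.1 _
  rw [traceNorm_eq_tsum ContinuousLinearMap.isPositive_one (tensorBasis H (Fin 0)),
    tsum_eq_single default fun a ha => absurd (Subsingleton.elim a default) ha,
    one_apply_eq_self, inner_self_eq_norm_sq_to_K, hnorm]
  simp

/-- The tensor powers of a trace class operator. -/
def tensorPow (A : TraceClass H) : ∀ k : ℕ, TraceClass (TensorPow H (Fin k))
  | 0 => TraceClass.mk 1 (traceNorm_one_fin_zero.trans_ne ENNReal.one_ne_top)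
  | k + 1 => tensorSnoc k (tensorPow A k) A

@[simp]
theorem toCLM_tensorPow (A : TraceClass H) (k : ℕ) :
    toCLM (tensorPow A k) = tensorPowOp k (toCLM A) := by
  induction k with
  | zero => rfl
  | succ k ih => rw [tensorPow, toCLM_tensorSnoc, ih, tensorPowOp_succ]

theorem norm_tensorPow_le (A : TraceClass H) (k : ℕ) : ‖tensorPow A k‖ ≤ ‖A‖ ^ k := by
  induction k with
  | zero =>
    rw [tensorPow, norm_le_iff (by positivity), toCLM_mk, traceNorm_one_fin_zero]
    simp
  | succ k ih =>
    calc ‖tensorPow A (k + 1)‖ ≤ ‖tensorPow A k‖ * ‖A‖ := norm_tensorSnoc_apply_le k _ A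
      _ ≤ ‖A‖ ^ (k + 1) := by rw [pow_succ]; gcongr

end TensorPowers

section Exponential
variable {E F : Type*} [NormedAddCommGroup E] [NormedSpace ℂ E] [CompleteSpace E]
  [NormedAddCommGroup F] [NormedSpace ℂ F] [CompleteSpace F]

theorem hasSum_exp_apply (L : E →L[ℂ] E) (x : E) :
    HasSum (fun n : ℕ => ((n.factorial : ℂ)⁻¹) • (L ^ n) x) (NormedSpace.exp L x) :=
  (NormedSpace.exp_series_hasSum_exp' (𝕂 := ℂ) L).mapL (ContinuousLinearMap.apply ℂ E x)

theorem exp_intertwine (Φ : E →L[ℂ] F) {L : E →L[ℂ] E} {M : F →L[ℂ] F}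
    (h : ∀ x, Φ (L x) = M (Φ x)) (x : E) : Φ (NormedSpace.exp L x) = NormedSpace.exp M (Φ x) := by
  have hpow : ∀ (n : ℕ) (x : E), Φ ((L ^ n) x) = (M ^ n) (Φ x) := by
    intro n
    induction n with
    | zero => exact fun x => rfl
    | succ n ih =>
      intro x
      rw [pow_succ, pow_succ, mul_apply_eq_comp, mul_apply_eq_comp, ih, h]
  refine ((hasSum_exp_apply L x).mapL Φ).unique ?_
  simp only [map_smul, hpow]
  exact hasSum_exp_apply M (Φ x)

theorem exp_smul_one_apply (c : ℂ) (x : E) :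
    NormedSpace.exp (c • (1 : E →L[ℂ] E)) x = Complex.exp c • x := by
  refine (hasSum_exp_apply _ x).unique ?_
  have h := (NormedSpace.exp_series_hasSum_exp' (𝕂 := ℂ) c).smul_const x
  rw [← Complex.exp_eq_exp_ℂ] at h
  simpa [smul_pow, smul_smul] using h

theorem exp_add_apply_of_commute {L M : E →L[ℂ] E} (h : Commute L M) (x : E) :
    NormedSpace.exp (L + M) x = NormedSpace.exp L (NormedSpace.exp M x) := by
  let _ : NormedAlgebra ℚ (E →L[ℂ] E) := NormedAlgebra.restrictScalars ℚ ℂ _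
  rw [NormedSpace.exp_add_of_commute h, mul_apply_eq_comp]

theorem exp_add_smul_apply (L : E →L[ℂ] E) (s t : ℂ) (x : E) :
    NormedSpace.exp ((s + t) • L) x = NormedSpace.exp (s • L) (NormedSpace.exp (t • L) x) := by
  rw [add_smul, exp_add_apply_of_commute (((Commute.refl L).smul_left s).smul_right t)]

theorem hasDerivAt_exp_apply (L : E →L[ℂ] E) (x : E) (t : ℝ) :
    HasDerivAt (fun s : ℝ => NormedSpace.exp ((s : ℂ) • L) x)
      (L (NormedSpace.exp ((t : ℂ) • L) x)) t := by
  have h := (hasDerivAt_exp_smul_const' (𝕂 := ℂ) L (t : ℂ)).scomp t Complex.ofRealCLM.hasDerivAt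
  rw [Complex.ofRealCLM_apply, Complex.ofReal_one, one_smul] at h
  exact ((ContinuousLinearMap.apply ℂ E x).restrictScalars ℝ).hasFDerivAt.comp_hasDerivAt t h

end Exponential

section Positivity
variable {K : Type*} [NormedAddCommGroup K] [InnerProductSpace ℂ K]

namespace TraceClass

theorem isPositive_smul {c : ℝ} (hc : 0 ≤ c) {T : TraceClass K} (hT : (toCLM T).IsPositive) :
    (toCLM ((c : ℂ) • T)).IsPositive := by
  rw [map_smul]
  exact hT.smul_of_nonneg (Complex.zero_le_real.mpr hc)

variable [CompleteSpace K]

theorem isPositive_exp_apply {L : TraceClass K →L[ℂ] TraceClass K}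
    (hL : ∀ T, (toCLM T).IsPositive → (toCLM (L T)).IsPositive) {T : TraceClass K}
    (hT : (toCLM T).IsPositive) : (toCLM (NormedSpace.exp L T)).IsPositive := by
  have hpow : ∀ n : ℕ, (toCLM ((L ^ n) T)).IsPositive := by
    intro n
    induction n with
    | zero => exact hT
    | succ n ih =>
      rw [pow_succ', mul_apply_eq_comp]
      exact hL _ ih
  refine isPositive_of_hasSum ((hasSum_exp_apply L T).mapL toCLM) fun n => ?_
  have h := isPositive_smul (inv_nonneg.mpr (Nat.cast_nonneg n.factorial)) (hpow n)
  rwa [Complex.ofReal_inv, Complex.ofReal_natCast] at h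

end TraceClass

end Positivity

section ConjPartialTrace
variable {K : Type*} [NormedAddCommGroup K] [InnerProductSpace ℂ K] [CompleteSpace K]
variable {H : Type*} [NormedAddCommGroup H] [InnerProductSpace ℂ H] [CompleteSpace H]
variable {ι κ : Type}

theorem conj_conj (A B : K →L[ℂ] K) (T : TraceClass K) :
    conj A (conj B T) = conj (A * B) T :=
  TraceClass.ext (by simp only [toCLM_conj, star_mul, mul_assoc])

theorem traceOut_conj_amplify (f : κ ↪ ι) (B : TensorPow H κ →L[ℂ] TensorPow H κ)
    (T : TraceClass (TensorPow H ι)) :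
    traceOut f (conj (amplify f B) T) = conj B (traceOut f T) :=
  ext_trace_mulRight fun A => by
    rw [trace_mulRight_traceOut, trace_mulRight_conj, trace_mulRight_conj, trace_mulRight_traceOut,
      amplify_mul, amplify_mul, amplify_star]

theorem traceOut_conj_unitary (f : κ ↪ ι) {u : TensorPow H ι →L[ℂ] TensorPow H ι}
    (hu : u ∈ unitary (TensorPow H ι →L[ℂ] TensorPow H ι))
    (hcomm : ∀ A, Commute (amplify f A) u) (T : TraceClass (TensorPow H ι)) :
    traceOut f (conj u T) = traceOut f T :=
  ext_trace_mulRight fun A => by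
    rw [trace_mulRight_traceOut, trace_mulRight_conj, trace_mulRight_traceOut, mul_assoc,
      (hcomm A).eq, ← mul_assoc, Unitary.star_mul_self_of_mem hu, one_mul]

end ConjPartialTrace

namespace CollisionSpec
variable {H : Type*} [NormedAddCommGroup H] [InnerProductSpace ℂ H] [CompleteSpace H]
variable {h : H →ₗ.[ℂ] H} {C : Type*} [MetricSpace C] [CompactSpace C] [MeasurableSpace C]
  [BorelSpace C] (S : CollisionSpec h C) {ι κ : Type}

theorem opAt_mem_unitary (p : Fin 2 ↪ ι) (σ : C) :
    S.opAt p σ ∈ unitary (TensorPow H ι →L[ℂ] TensorPow H ι) :=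
  amplify_mem_unitary p (S.U σ).2

/-- The collision map `Q_{i,j}` on trace class operators, for `p 0 = i` and `p 1 = j`. -/
def collide (p : Fin 2 ↪ ι) : TraceClass (TensorPow H ι) →L[ℂ] TraceClass (TensorPow H ι) :=
  TraceClass.average (S.isContractiveFamily_opAt p) S.ν

theorem collide_apply (p : Fin 2 ↪ ι) (T : TraceClass (TensorPow H ι)) :
    S.collide p T = ∫ σ, conj (S.opAt p σ) T ∂S.ν := rfl

theorem map_collide {E : Type*} [NormedAddCommGroup E] [NormedSpace ℂ E] [CompleteSpace E]
    (p : Fin 2 ↪ ι) (L : TraceClass (TensorPow H ι) →L[ℂ] E) (T : TraceClass (TensorPow H ι)) :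
    L (S.collide p T) = ∫ σ, L (conj (S.opAt p σ) T) ∂S.ν :=
  map_average _ _ L T

@[simp]
theorem toCLM_collide (p : Fin 2 ↪ ι) (T : TraceClass (TensorPow H ι)) :
    toCLM (S.collide p T) = S.collision p (toCLM T) := toCLM_average _ _ T

theorem norm_collide_apply_le (p : Fin 2 ↪ ι) (T : TraceClass (TensorPow H ι)) :
    ‖S.collide p T‖ ≤ ‖T‖ := norm_average_apply_le _ _ T

theorem trace_collide (p : Fin 2 ↪ ι) (T : TraceClass (TensorPow H ι)) :
    trace (S.collide p T) = trace T := trace_average _ _ (S.opAt_mem_unitary p) T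

theorem isPositive_collide (p : Fin 2 ↪ ι) {T : TraceClass (TensorPow H ι)}
    (hT : (toCLM T).IsPositive) : (toCLM (S.collide p T)).IsPositive :=
  isPositive_average _ _ hT

theorem conj_permuteOp_collide (π : Equiv.Perm ι) (p : Fin 2 ↪ ι)
    (T : TraceClass (TensorPow H ι)) :
    conj (permuteOp π) (S.collide p T) =
      S.collide (p.trans π.symm.toEmbedding) (conj (permuteOp π) T) := by
  rw [map_collide, collide_apply]
  refine integral_congr_ae (.of_forall fun σ => ?_)
  have hmove : permuteOp π * S.opAt p σ =
      S.opAt (p.trans π.symm.toEmbedding) σ * permuteOp π := by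
    rw [opAt, opAt, ← permuteOp_conj_amplify, mul_assoc (_ * _) _ (permuteOp π),
      Unitary.star_mul_self_of_mem (permuteOp_mem_unitary π), mul_one]
  simp only [conj_conj, hmove]

theorem collide_swap (p : Fin 2 ↪ ι) :
    S.collide ((Equiv.swap 0 1).toEmbedding.trans p) = S.collide p := by
  obtain ⟨τ, hτ, hU⟩ := S.swap_symm
  have hop : ∀ σ, S.op (τ σ) = amplify (Equiv.swap 0 1).toEmbedding (S.op σ) := fun σ => by
    have h := permuteOp_conj_amplify (Equiv.swap 0 1) (Function.Embedding.refl _) (S.op σ)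
    rw [amplify_refl, mul_assoc] at h
    exact (hU σ).symm.trans h
  have hopAt : ∀ σ, S.opAt ((Equiv.swap 0 1).toEmbedding.trans p) σ = S.opAt p (τ σ) := fun σ => by
    rw [opAt, opAt, hop, amplify_amplify]
  refine ContinuousLinearMap.ext fun T => ?_
  have hmeas := (integrable_conj (S.isContractiveFamily_opAt p) S.ν T).aestronglyMeasurable
  rw [← hτ.map_eq] at hmeas
  simp only [collide_apply, hopAt]
  conv_rhs => rw [← hτ.map_eq]
  exact (integral_map hτ.measurable.aemeasurable hmeas).symm

theorem traceOut_collide_trans (f : κ ↪ ι) (p : Fin 2 ↪ κ) (T : TraceClass (TensorPow H ι)) :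
    traceOut f (S.collide (p.trans f) T) = S.collide p (traceOut f T) := by
  rw [map_collide, collide_apply]
  refine integral_congr_ae (.of_forall fun σ => ?_)
  have hopAt : S.opAt (p.trans f) σ = amplify f (S.opAt p σ) := (amplify_amplify p f _).symm
  simp only [hopAt, traceOut_conj_amplify]

theorem traceOut_collide_of_disjoint (f : κ ↪ ι) (p : Fin 2 ↪ ι) (hfp : ∀ k i, f k ≠ p i)
    (T : TraceClass (TensorPow H ι)) : traceOut f (S.collide p T) = traceOut f T := by
  have hconj : ∀ σ, traceOut f (conj (S.opAt p σ) T) = traceOut f T := fun σ =>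
    traceOut_conj_unitary f (S.opAt_mem_unitary p σ) (fun A => commute_amplify hfp A _) T
  simp only [S.map_collide, hconj, integral_const, probReal_univ, one_smul]

end CollisionSpec

section Pairs
variable {ι : Type}

/-- The ordered pair of distinct particles `i`, `j`. -/
def pairOfNe (i j : ι) (hij : i ≠ j) : Fin 2 ↪ ι :=
  ⟨![i, j], by
    intro a b
    fin_cases a <;> fin_cases b <;> simp [hij, hij.symm]⟩

theorem pairOfNe_symm {i j : ι} (hij : i ≠ j) :
    pairOfNe j i hij.symm = (Equiv.swap 0 1).toEmbedding.trans (pairOfNe i j hij) := by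
  ext a
  fin_cases a <;> rfl

theorem pairOfNe_trans {i j : ι} (hij : i ≠ j) (π : Equiv.Perm ι) :
    (pairOfNe i j hij).trans π.toEmbedding = pairOfNe (π i) (π j) (π.injective.ne hij) := by
  ext a
  fin_cases a <;> rfl

theorem sum_sum_eq_two_nsmul_sum_lt {E : Type*} [AddCommMonoid E] [Fintype ι] [LinearOrder ι]
    {q : ι → ι → E} (hsymm : ∀ i j, q i j = q j i) (hdiag : ∀ i, q i i = 0) :
    ∑ i, ∑ j, q i j = 2 • ∑ i, ∑ j, if i < j then q i j else 0 := by
  have hsplit : ∀ i j, q i j = (if i < j then q i j else 0) + if j < i then q j i else 0 := by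
    intro i j
    rcases lt_trichotomy i j with hij | rfl | hij
    · rw [if_pos hij, if_neg hij.asymm, add_zero]
    · simp only [hdiag, ite_self, add_zero]
    · rw [if_neg hij.asymm, if_pos hij, zero_add, hsymm]
  rw [Finset.sum_congr rfl fun i _ => Finset.sum_congr rfl fun j _ => hsplit i j]
  simp only [Finset.sum_add_distrib]
  rw [Finset.sum_comm (f := fun i j => if j < i then q j i else 0), two_nsmul]

end Pairs

namespace CollisionSpec
variable {H : Type*} [NormedAddCommGroup H] [InnerProductSpace ℂ H] [CompleteSpace H]
variable {h : H →ₗ.[ℂ] H} {C : Type*} [MetricSpace C] [CompactSpace C] [MeasurableSpace C]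
  [BorelSpace C] (S : CollisionSpec h C)

section PairCollision
variable {ι : Type} [DecidableEq ι]

/-- The collision of the particles `i` and `j` on trace class operators, extended by the identity
to the diagonal `i = j`: sums over pairs of particles then need no restriction. -/
def pairCollision (i j : ι) : TraceClass (TensorPow H ι) →L[ℂ] TraceClass (TensorPow H ι) :=
  if hij : i ≠ j then S.collide (pairOfNe i j hij) else 1

theorem pairCollision_of_ne {i j : ι} (hij : i ≠ j) :
    S.pairCollision i j = S.collide (pairOfNe i j hij) := dif_pos hij

@[simp]
theorem pairCollision_self (i : ι) (T : TraceClass (TensorPow H ι)) :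
    S.pairCollision i i T = T := by
  rw [pairCollision, dif_neg (not_not.mpr rfl), one_apply_eq_self]

theorem pairCollision_comm (i j : ι) : S.pairCollision i j = S.pairCollision j i := by
  rcases eq_or_ne i j with rfl | hij
  · rfl
  · rw [pairCollision_of_ne S hij, pairCollision_of_ne S hij.symm, pairOfNe_symm hij, collide_swap]

theorem norm_pairCollision_apply_le (i j : ι) (T : TraceClass (TensorPow H ι)) :
    ‖S.pairCollision i j T‖ ≤ ‖T‖ := by
  rcases eq_or_ne i j with rfl | hij
  · rw [pairCollision_self]
  · rw [pairCollision_of_ne S hij]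
    exact S.norm_collide_apply_le _ T

theorem trace_pairCollision (i j : ι) (T : TraceClass (TensorPow H ι)) :
    trace (S.pairCollision i j T) = trace T := by
  rcases eq_or_ne i j with rfl | hij
  · rw [pairCollision_self]
  · rw [pairCollision_of_ne S hij, trace_collide]

theorem isPositive_pairCollision (i j : ι) {T : TraceClass (TensorPow H ι)}
    (hT : (toCLM T).IsPositive) : (toCLM (S.pairCollision i j T)).IsPositive := by
  rcases eq_or_ne i j with rfl | hij
  · rwa [pairCollision_self]
  · rw [pairCollision_of_ne S hij]
    exact S.isPositive_collide _ hT

theorem conj_permuteOp_pairCollision (π : Equiv.Perm ι) (i j : ι)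
    (T : TraceClass (TensorPow H ι)) :
    conj (permuteOp π) (S.pairCollision i j T) =
      S.pairCollision (π.symm i) (π.symm j) (conj (permuteOp π) T) := by
  rcases eq_or_ne i j with rfl | hij
  · rw [pairCollision_self, pairCollision_self]
  · rw [pairCollision_of_ne S hij, pairCollision_of_ne S (π.symm.injective.ne hij),
      conj_permuteOp_collide, pairOfNe_trans]

end PairCollision

/-- The quantum Kac generator `L_N` on trace class operators, as a sum over ordered pairs of
particles. -/
def generator (N : ℕ) :
    TraceClass (TensorPow H (Fin N)) →L[ℂ] TraceClass (TensorPow H (Fin N)) :=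
  ((N : ℂ) - 1)⁻¹ • ∑ i : Fin N, ∑ j : Fin N, (S.pairCollision i j - 1)

theorem generator_apply (N : ℕ) (T : TraceClass (TensorPow H (Fin N))) :
    S.generator N T = ((N : ℂ) - 1)⁻¹ • ∑ i, ∑ j, (S.pairCollision i j T - T) := by
  simp only [generator, smul_apply, sum_apply, sub_apply, one_apply_eq_self]

theorem sum_pairCollision_sub (N : ℕ) (T : TraceClass (TensorPow H (Fin N))) :
    ∑ i : Fin N, ∑ j : Fin N, (S.pairCollision i j T - T) =
      (2 : ℂ) • (∑ i, ∑ j, if i < j then S.pairCollision i j T else 0) -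
        ((N : ℂ) * (N - 1)) • T := by
  have hoff : ∀ i j : Fin N, S.pairCollision i j T - T =
      (if i = j then 0 else S.pairCollision i j T) - T + if i = j then T else 0 := by
    intro i j
    split_ifs with hij
    · rw [hij, pairCollision_self]
      abel
    · rw [add_zero]
  have hlt : ∀ i j : Fin N, (if i < j then if i = j then 0 else S.pairCollision i j T else 0) =
      if i < j then S.pairCollision i j T else 0 := fun i j => by
    split_ifs with hij heq
    · exact absurd heq hij.ne
    · rfl
    · rfl
  have hsum := sum_sum_eq_two_nsmul_sum_lt
    (q := fun i j : Fin N => if i = j then 0 else S.pairCollision i j T)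
    (fun i j => by simp only [eq_comm, S.pairCollision_comm i j]) fun i => if_pos rfl
  simp only [hlt] at hsum
  simp only [hoff, Finset.sum_add_distrib, Finset.sum_sub_distrib, hsum, Finset.sum_const,
    Finset.card_univ, Fintype.card_fin, Finset.sum_ite_eq, Finset.mem_univ, if_true]
  module

theorem toCLM_generator {N : ℕ} (hN : 2 ≤ N) (T : TraceClass (TensorPow H (Fin N))) :
    toCLM (S.generator N T) = S.kacGenerator N (toCLM T) := by
  have hN0 : (N : ℂ) ≠ 0 := by exact_mod_cast (by omega : N ≠ 0)
  have hN1 : (N : ℂ) - 1 ≠ 0 := by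
    rw [sub_ne_zero]
    exact_mod_cast (by omega : N ≠ 1)
  have hpair : ∀ i j : Fin N, toCLM (if i < j then S.pairCollision i j T else 0) =
      (if hij : i < j then S.collision (pairEmb i j hij) else 0) (toCLM T) := by
    intro i j
    split_ifs with hij
    · rw [pairCollision_of_ne S hij.ne, toCLM_collide]
      rfl
    · rw [map_zero, zero_apply]
  rw [generator_apply, sum_pairCollision_sub]
  simp only [map_smul, map_sub, map_sum, hpair, kacGenerator, kacAverage, smul_apply, sub_apply,
    one_apply_eq_self, sum_apply, Nat.cast_choose_two, smul_sub, smul_smul]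
  congr 2 <;> field_simp

/-- `exp (t L_N)` on trace class operators. -/
def flow (N : ℕ) (t : ℝ) :
    TraceClass (TensorPow H (Fin N)) →L[ℂ] TraceClass (TensorPow H (Fin N)) :=
  NormedSpace.exp ((t : ℂ) • S.generator N)

theorem toCLM_flow {N : ℕ} (hN : 2 ≤ N) (t : ℝ) (T : TraceClass (TensorPow H (Fin N))) :
    toCLM (S.flow N t T) = S.kacSemigroup N t (toCLM T) :=
  exp_intertwine toCLM (fun X => by
    rw [smul_apply, smul_apply, map_smul, S.toCLM_generator hN]) T

theorem trace_flow (N : ℕ) (t : ℝ) (T : TraceClass (TensorPow H (Fin N))) :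
    trace (S.flow N t T) = trace T := by
  have h := exp_intertwine trace (L := (t : ℂ) • S.generator N) (M := 0) (fun X => by
    simp only [smul_apply, map_smul, generator_apply, map_sum, map_sub, trace_pairCollision,
      sub_self, Finset.sum_const_zero, smul_zero, zero_apply]) T
  rwa [NormedSpace.exp_zero, one_apply_eq_self] at h

theorem isPositive_flow {N : ℕ} (hN : 1 ≤ N) {t : ℝ} (ht : 0 ≤ t)
    {T : TraceClass (TensorPow H (Fin N))} (hT : (toCLM T).IsPositive) :
    (toCLM (S.flow N t T)).IsPositive := by
  have hN' : (0 : ℝ) ≤ N - 1 := sub_nonneg.mpr (by exact_mod_cast hN)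
  set c : ℝ := t * ((N : ℝ) - 1)⁻¹ with hc
  set Q := ∑ i : Fin N, ∑ j : Fin N, S.pairCollision i j with hQ
  have hsplit : (t : ℂ) • S.generator N = (c : ℂ) • Q + ((-(c * N * N) : ℝ) : ℂ) • 1 := by
    simp only [generator, Finset.sum_sub_distrib, Finset.sum_const, Finset.card_univ,
      Fintype.card_fin, ← Nat.cast_smul_eq_nsmul ℂ, ← hQ, smul_sub, smul_smul, hc]
    push_cast
    rw [sub_eq_add_neg, neg_smul]
    congr 3
    ring
  rw [flow, hsplit, exp_add_apply_of_commute ((Commute.one_right _).smul_right _),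
    exp_smul_one_apply, ← Complex.ofReal_exp]
  refine isPositive_exp_apply (fun X hX => ?_) (isPositive_smul (Real.exp_pos _).le hT)
  rw [smul_apply]
  refine isPositive_smul (by positivity) ?_
  rw [hQ]
  simp only [sum_apply, map_sum]
  exact ContinuousLinearMap.isPositive_sum _ fun i _ =>
    ContinuousLinearMap.isPositive_sum _ fun j _ => S.isPositive_pairCollision i j hX

theorem conj_permuteOp_generator {N : ℕ} (π : Equiv.Perm (Fin N))
    (T : TraceClass (TensorPow H (Fin N))) :
    conj (permuteOp π) (S.generator N T) = S.generator N (conj (permuteOp π) T) := by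
  simp only [generator_apply, map_smul, map_sum, map_sub, conj_permuteOp_pairCollision]
  congr 1
  exact Fintype.sum_equiv π.symm _ _ fun i => Fintype.sum_equiv π.symm _ _ fun j => rfl

theorem isPermSymmetric_flow {N : ℕ} (t : ℝ) {T : TraceClass (TensorPow H (Fin N))}
    (hT : IsPermSymmetric (toCLM T)) : IsPermSymmetric (toCLM (S.flow N t T)) := by
  rw [isPermSymmetric_iff] at hT ⊢
  intro π
  have hconj : conj (permuteOp π) T = T := TraceClass.ext (hT π)
  have h := exp_intertwine (conj (permuteOp π)) (L := (t : ℂ) • S.generator N)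
    (M := (t : ℂ) • S.generator N) (fun X => by
      simp only [smul_apply, map_smul, conj_permuteOp_generator]) T
  rw [hconj] at h
  exact congrArg toCLM h

end CollisionSpec

section Embeddings
variable {k M : ℕ}

theorem castAdd_lt_natAdd (i : Fin k) (j : Fin M) : Fin.castAdd M i < Fin.natAdd k j := by
  rw [Fin.lt_def, Fin.val_castAdd, Fin.val_natAdd]
  omega

/-- The embedding of `k + 1` indices that keeps the first `k` of them and sends the last one to
the `j`-th of the `M` others. -/
def extendEmb (j : Fin M) : Fin (k + 1) ↪ Fin (k + M) where
  toFun a := ⟨if (a : ℕ) < k then a else k + j, by split_ifs <;> omega⟩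
  inj' a b hab := by
    simp only [Fin.mk.injEq] at hab
    ext
    split_ifs at hab <;> omega

theorem castAddEmb_trans_extendEmb (j : Fin M) :
    (Fin.castAddEmb 1).trans (extendEmb j) = (Fin.castAddEmb M : Fin k ↪ Fin (k + M)) := by
  ext a
  exact if_pos a.2

theorem lastPair_trans_extendEmb (i : Fin k) (j : Fin M) :
    (lastPair i).trans (extendEmb j) =
      pairOfNe (Fin.castAdd M i) (Fin.natAdd k j) (castAdd_lt_natAdd i j).ne := by
  ext a
  fin_cases a
  · exact if_pos i.2
  · exact if_neg (lt_irrefl k)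

end Embeddings

namespace CollisionSpec
variable {H : Type*} [NormedAddCommGroup H] [InnerProductSpace ℂ H] [CompleteSpace H]
variable {h : H →ₗ.[ℂ] H} {C : Type*} [MetricSpace C] [CompactSpace C] [MeasurableSpace C]
  [BorelSpace C] (S : CollisionSpec h C)

/-- The collisions of the first `k` of `k + 1` particles with the last one, which is then traced
out: the collision term of the hierarchy of the marginals. -/
def gain (k : ℕ) :
    TraceClass (TensorPow H (Fin (k + 1))) →L[ℂ] TraceClass (TensorPow H (Fin k)) :=
  ∑ i : Fin k, (traceOut (Fin.castAddEmb 1)).comp (S.collide (lastPair i))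

theorem gain_apply (k : ℕ) (Y : TraceClass (TensorPow H (Fin (k + 1)))) :
    S.gain k Y = ∑ i : Fin k, traceOut (Fin.castAddEmb 1) (S.collide (lastPair i) Y) := by
  simp only [gain, sum_apply, ContinuousLinearMap.comp_apply]

theorem norm_gain_apply_le (k : ℕ) (Y : TraceClass (TensorPow H (Fin (k + 1)))) :
    ‖S.gain k Y‖ ≤ k * ‖Y‖ := by
  rw [gain_apply]
  calc ‖∑ i : Fin k, traceOut (Fin.castAddEmb 1) (S.collide (lastPair i) Y)‖
      ≤ ∑ _i : Fin k, ‖Y‖ := norm_sum_le_of_le _ fun i _ =>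
        (norm_traceOut_apply_le _ _).trans (S.norm_collide_apply_le _ Y)
    _ = k * ‖Y‖ := by simp

/-- The right-hand side `2 (∑ᵢ Tr_{k+1} Q_{i,k+1} Y - k X)` of the hierarchy of the marginals, with
`X` in the place of the `k`-particle and `Y` in that of the `(k + 1)`-particle marginal. -/
def hierarchy (k : ℕ) (X : TraceClass (TensorPow H (Fin k)))
    (Y : TraceClass (TensorPow H (Fin (k + 1)))) : TraceClass (TensorPow H (Fin k)) :=
  (2 : ℂ) • (S.gain k Y - (k : ℂ) • X)

section MeanField
variable {k M : ℕ}

theorem traceOut_pairCollision_castAdd_natAdd (f : Fin (k + 1) ↪ Fin (k + M))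
    {X : TraceClass (TensorPow H (Fin (k + M)))} (hX : IsPermSymmetric (toCLM X))
    (i : Fin k) (j : Fin M) :
    traceOut (Fin.castAddEmb M) (S.pairCollision (Fin.castAdd M i) (Fin.natAdd k j) X) =
      traceOut (Fin.castAddEmb 1) (S.collide (lastPair i) (traceOut f X)) := by
  rw [pairCollision_of_ne S (castAdd_lt_natAdd i j).ne, ← lastPair_trans_extendEmb,
    ← castAddEmb_trans_extendEmb j, ← traceOut_traceOut, traceOut_collide_trans,
    traceOut_eq_of_isPermSymmetric (extendEmb j) f hX]

theorem traceOut_pairCollision_natAdd_natAdd (X : TraceClass (TensorPow H (Fin (k + M))))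
    (i j : Fin M) :
    traceOut (Fin.castAddEmb M : Fin k ↪ _)
        (S.pairCollision (Fin.natAdd k i) (Fin.natAdd k j) X) =
      traceOut (Fin.castAddEmb M) X := by
  rcases eq_or_ne (Fin.natAdd k i) (Fin.natAdd k j) with hij | hij
  · rw [hij, pairCollision_self]
  · rw [pairCollision_of_ne S hij]
    refine S.traceOut_collide_of_disjoint _ _ (fun a b => ?_) X
    fin_cases b
    · exact (castAdd_lt_natAdd a i).ne
    · exact (castAdd_lt_natAdd a j).ne

theorem hierarchy_eq_sum (X : TraceClass (TensorPow H (Fin k)))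
    (Y : TraceClass (TensorPow H (Fin (k + 1)))) :
    S.hierarchy k X Y = (2 : ℂ) •
      ∑ i : Fin k, (traceOut (Fin.castAddEmb 1) (S.collide (lastPair i) Y) - X) := by
  simp only [hierarchy, gain_apply, Finset.sum_sub_distrib, Finset.sum_const, Finset.card_univ,
    Fintype.card_fin, Nat.cast_smul_eq_nsmul]

theorem traceOut_generator (f : Fin (k + 1) ↪ Fin (k + M))
    {X : TraceClass (TensorPow H (Fin (k + M)))} (hX : IsPermSymmetric (toCLM X)) :
    traceOut (Fin.castAddEmb M) (S.generator (k + M) X) = (((k + M : ℕ) : ℂ) - 1)⁻¹ •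
      ((∑ i : Fin k, ∑ j : Fin k, traceOut (Fin.castAddEmb M)
          (S.pairCollision (Fin.castAdd M i) (Fin.castAdd M j) X - X)) +
        (M : ℂ) • S.hierarchy k (traceOut (Fin.castAddEmb M) X) (traceOut f X)) := by
  have hmixed := S.traceOut_pairCollision_castAdd_natAdd f hX
  have hmixed' : ∀ (i : Fin M) (j : Fin k), traceOut (Fin.castAddEmb M)
      (S.pairCollision (Fin.natAdd k i) (Fin.castAdd M j) X) =
      traceOut (Fin.castAddEmb 1) (S.collide (lastPair j) (traceOut f X)) := fun i j => by
    rw [pairCollision_comm, hmixed]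
  simp only [generator_apply, map_smul, map_add, map_sum, map_sub, Fin.sum_univ_add, hmixed,
    hmixed', S.traceOut_pairCollision_natAdd_natAdd X, sub_self, Finset.sum_const_zero, add_zero,
    Finset.sum_const, Finset.card_univ, Fintype.card_fin, Finset.sum_add_distrib,
    ← Nat.cast_smul_eq_nsmul ℂ, ← Finset.smul_sum, hierarchy_eq_sum]
  module

theorem norm_hierarchy_apply_le (X : TraceClass (TensorPow H (Fin k)))
    (Y : TraceClass (TensorPow H (Fin (k + 1)))) :
    ‖S.hierarchy k X Y‖ ≤ 2 * k * (‖Y‖ + ‖X‖) := by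
  calc ‖S.hierarchy k X Y‖ = 2 * ‖S.gain k Y - (k : ℂ) • X‖ := by
        rw [hierarchy, norm_smul, Complex.norm_ofNat]
    _ ≤ 2 * (k * ‖Y‖ + k * ‖X‖) := by
        gcongr
        refine norm_sub_le_of_le (S.norm_gain_apply_le k Y) ?_
        rw [norm_smul, Complex.norm_natCast]
    _ = 2 * k * (‖Y‖ + ‖X‖) := by ring

theorem norm_traceOut_pairCollision_sub_le {N : ℕ} (f : Fin k ↪ Fin N) (i j : Fin N)
    (X : TraceClass (TensorPow H (Fin N))) :
    ‖traceOut f (S.pairCollision i j X - X)‖ ≤ 2 * ‖X‖ :=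
  (norm_traceOut_apply_le _ _).trans <|
    (norm_sub_le_of_le (S.norm_pairCollision_apply_le i j X) le_rfl).trans_eq (two_mul _).symm

theorem norm_traceOut_generator_sub_hierarchy_le (hk : 1 ≤ k) (f : Fin (k + 1) ↪ Fin (k + M))
    {X : TraceClass (TensorPow H (Fin (k + M)))} (hX : IsPermSymmetric (toCLM X)) :
    ‖traceOut (Fin.castAddEmb M) (S.generator (k + M) X) -
        S.hierarchy k (traceOut (Fin.castAddEmb M) X) (traceOut f X)‖ ≤
      6 * k ^ 2 / ((k + M : ℕ) - 1 : ℝ) * ‖X‖ := by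
  have hM : k + 1 ≤ k + M := by simpa using Fintype.card_le_of_embedding f
  have hN : (0 : ℝ) < (k + M : ℕ) - 1 := by
    rw [sub_pos]
    exact_mod_cast (by omega : 1 < k + M)
  have hN' : ((k + M : ℕ) : ℂ) - 1 ≠ 0 := by exact_mod_cast hN.ne'
  set A := ∑ i : Fin k, ∑ j : Fin k, traceOut (Fin.castAddEmb M : Fin k ↪ _)
    (S.pairCollision (Fin.castAdd M i) (Fin.castAdd M j) X - X)
  set B := S.hierarchy k (traceOut (Fin.castAddEmb M) X) (traceOut f X)
  have hA : ‖A‖ ≤ k * (k * (2 * ‖X‖)) := by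
    refine (norm_sum_le_of_le _ fun i _ => norm_sum_le_of_le _ fun j _ =>
      S.norm_traceOut_pairCollision_sub_le _ _ _ X).trans_eq ?_
    simp
  have hB : ‖B‖ ≤ 2 * k * (‖X‖ + ‖X‖) := (S.norm_hierarchy_apply_le _ _).trans <| by
    gcongr <;> exact norm_traceOut_apply_le _ X
  have hdiff : traceOut (Fin.castAddEmb M) (S.generator (k + M) X) - B =
      (((k + M : ℕ) : ℂ) - 1)⁻¹ • (A - ((k - 1 : ℕ) : ℂ) • B) := by
    rw [S.traceOut_generator f hX, sub_eq_iff_eq_add, ← sub_eq_iff_eq_add', ← smul_sub]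
    refine (smul_right_injective _ hN' ?_ : _ = B)
    simp only [smul_inv_smul₀ hN']
    push_cast [Nat.cast_sub hk]
    module
  have hnorm : ‖((k + M : ℕ) : ℂ) - 1‖ = (k + M : ℕ) - 1 := by
    rw [← Complex.ofReal_natCast, ← Complex.ofReal_one, ← Complex.ofReal_sub, Complex.norm_real,
      Real.norm_of_nonneg hN.le]
  calc ‖traceOut (Fin.castAddEmb M) (S.generator (k + M) X) - B‖
      ≤ (((k + M : ℕ) : ℝ) - 1)⁻¹ * (‖A‖ + ((k - 1 : ℕ) : ℝ) * ‖B‖) := by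
        rw [hdiff, norm_smul, norm_inv, hnorm]
        gcongr
        refine norm_sub_le_of_le le_rfl ?_
        rw [norm_smul, Complex.norm_natCast]
    _ ≤ (((k + M : ℕ) : ℝ) - 1)⁻¹ * (k * (k * (2 * ‖X‖)) + k * (2 * k * (‖X‖ + ‖X‖))) := by
        gcongr
        exact Nat.sub_le k 1
    _ = 6 * k ^ 2 / ((k + M : ℕ) - 1 : ℝ) * ‖X‖ := by ring

end MeanField

end CollisionSpec

section PowerDerivative
variable {H : Type*} [NormedAddCommGroup H] [InnerProductSpace ℂ H] [CompleteSpace H]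

/-- The tensor power `A ⊗ ⋯ ⊗ A` with the identity in the place of its `i`-th factor. -/
def tensorPowErase (A : H →L[ℂ] H) :
    ∀ k : ℕ, Fin k → (TensorPow H (Fin k) →L[ℂ] TensorPow H (Fin k))
  | 0 => fun i => i.elim0
  | k + 1 => Fin.lastCases (motive := fun _ => _) (amplify (Fin.castAddEmb 1) (tensorPowOp k A))
      fun i => amplify (Fin.castAddEmb 1) (tensorPowErase A k i) * atFactor (Fin.last k) A

theorem tensorPowErase_last (A : H →L[ℂ] H) (k : ℕ) :
    tensorPowErase A (k + 1) (Fin.last k) = amplify (Fin.castAddEmb 1) (tensorPowOp k A) := by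
  rw [tensorPowErase, Fin.lastCases_last]

theorem tensorPowErase_castSucc (A : H →L[ℂ] H) (k : ℕ) (i : Fin k) :
    tensorPowErase A (k + 1) i.castSucc =
      amplify (Fin.castAddEmb 1) (tensorPowErase A k i) * atFactor (Fin.last k) A := by
  rw [tensorPowErase, Fin.lastCases_castSucc]

theorem tensorPowErase_castSucc_mul_atFactor (A B : H →L[ℂ] H) (k : ℕ) (i : Fin k) :
    tensorPowErase A (k + 1) i.castSucc * atFactor i.castSucc B =
      amplify (Fin.castAddEmb 1) (tensorPowErase A k i * atFactor i B) *
        atFactor (Fin.last k) A := by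
  rw [tensorPowErase_castSucc, amplify_mul, amplify_atFactor, mul_assoc, mul_assoc,
    (commute_atFactor (Fin.castSucc_lt_last i).ne' A B).eq]
  rfl

theorem tensorPowErase_mul_atFactor (A : H →L[ℂ] H) (k : ℕ) (i : Fin k) :
    tensorPowErase A k i * atFactor i A = tensorPowOp k A := by
  induction k with
  | zero => exact i.elim0
  | succ k ih =>
    rw [tensorPowOp_succ]
    induction i using Fin.lastCases with
    | last => rw [tensorPowErase_last]
    | cast i => rw [tensorPowErase_castSucc_mul_atFactor, ih]

theorem commute_amplify_tensorPowErase {ι κ : Type} (A : H →L[ℂ] H) (k : ℕ) (f : Fin k ↪ ι)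
    (g : κ ↪ ι) (i : Fin k) (hfg : ∀ j, j ≠ i → ∀ a, f j ≠ g a)
    (Y : TensorPow H κ →L[ℂ] TensorPow H κ) :
    Commute (amplify f (tensorPowErase A k i)) (amplify g Y) := by
  induction k with
  | zero => exact i.elim0
  | succ k ih =>
    induction i using Fin.lastCases with
    | last =>
      rw [tensorPowErase_last, amplify_amplify]
      exact commute_amplify (fun j a => hfg j.castSucc (Fin.castSucc_lt_last j).ne a) _ _
    | cast i =>
      rw [tensorPowErase_castSucc, amplify_mul, amplify_amplify, amplify_atFactor]
      refine Commute.mul_left (ih _ i fun j hj a => ?_) ?_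
      · exact hfg j.castSucc (fun h => hj (Fin.castSucc_injective _ h)) a
      · exact commute_amplify (fun _ a => hfg _ (Fin.castSucc_lt_last i).ne' a) _ _

/-- The derivative of the `k`-th tensor power at `A` in the direction `B`. -/
def tensorPowDeriv (A B : TraceClass H) : ∀ k : ℕ, TraceClass (TensorPow H (Fin k))
  | 0 => 0
  | k + 1 => tensorSnoc k (tensorPowDeriv A B k) A + tensorSnoc k (tensorPow A k) B

theorem hasDerivWithinAt_tensorPow {α : ℝ → TraceClass H} {α' : TraceClass H} {s : Set ℝ} {t : ℝ}
    (hα : HasDerivWithinAt α α' s t) (k : ℕ) :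
    HasDerivWithinAt (fun t => tensorPow (α t) k) (tensorPowDeriv (α t) α' k) s t := by
  induction k with
  | zero => exact hasDerivWithinAt_const _ _ _
  | succ k ih =>
    have hprod := ((tensorSnoc (H := H) k).bilinearRestrictScalars ℝ).hasDerivWithinAt_of_bilinear
      ih hα
    exact hprod.congr_deriv (add_comm _ _)

theorem toCLM_tensorPowDeriv (A B : TraceClass H) (k : ℕ) : toCLM (tensorPowDeriv A B k) =
    ∑ i, tensorPowErase (toCLM A) k i * atFactor i (toCLM B) := by
  induction k with
  | zero => rw [Fin.sum_univ_zero]; exact map_zero _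
  | succ k ih =>
    rw [Fin.sum_univ_castSucc, tensorPowDeriv, map_add, toCLM_tensorSnoc, toCLM_tensorSnoc, ih,
      toCLM_tensorPow, tensorPowErase_last, ← amplifyL_apply, map_sum, Finset.sum_mul]
    congr 1
    exact Finset.sum_congr rfl fun i _ => (tensorPowErase_castSucc_mul_atFactor _ _ k i).symm

theorem pointEmb_zero_ne_pointEmb_one (j k : Fin 1) :
    pointEmb (0 : Fin 2) j ≠ pointEmb (1 : Fin 2) k :=
  zero_ne_one

theorem mem_range_pointEmb_zero_or_one (i : Fin 2) :
    i ∈ Set.range (pointEmb (0 : Fin 2)) ∨ i ∈ Set.range (pointEmb (1 : Fin 2)) := by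
  fin_cases i
  · exact Or.inl ⟨0, rfl⟩
  · exact Or.inr ⟨0, rfl⟩

/-- The tensor product `A ⊗ B` of two trace class operators. -/
def tensorPair : TraceClass H →L[ℂ] TraceClass H →L[ℂ] TraceClass (TensorPow H (Fin 2)) :=
  (tensor (pointEmb 0) (pointEmb 1) pointEmb_zero_ne_pointEmb_one
    mem_range_pointEmb_zero_or_one).bilinearComp raise raise

theorem tensorPair_apply (A B : TraceClass H) :
    tensorPair A B = tensor (pointEmb 0) (pointEmb 1) pointEmb_zero_ne_pointEmb_one
      mem_range_pointEmb_zero_or_one (raise A) (raise B) := rfl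

@[simp]
theorem toCLM_tensorPair (A B : TraceClass H) :
    toCLM (tensorPair A B) = tensorOp (toCLM A) (toCLM B) := by
  rw [tensorPair_apply, toCLM_tensor, toCLM_raise, toCLM_raise]
  rfl

end PowerDerivative

section AverageCommute
variable {C K : Type*} [MetricSpace C] [CompactSpace C] [MeasurableSpace C] [BorelSpace C]
  [NormedAddCommGroup K] [InnerProductSpace ℂ K] [CompleteSpace K]
  {W : C → K →L[ℂ] K} (hW : IsContractiveFamily W) (ν : Measure C) [IsProbabilityMeasure ν]

theorem average_apply (A : K →L[ℂ] K) (x : K) :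
    QuantumKac.average hW ν A x = ∫ σ, W σ (A ((W σ).adjoint x)) ∂ν := rfl

theorem average_mul_of_commute {R : K →L[ℂ] K} (hR : ∀ σ, Commute R (W σ)) (A : K →L[ℂ] K) :
    QuantumKac.average hW ν (R * A) = R * QuantumKac.average hW ν A := by
  ext x
  rw [mul_apply_eq_comp, average_apply, average_apply,
    ← R.integral_comp_comm (hW.integrable ν A x)]
  refine integral_congr_ae (.of_forall fun σ => ?_)
  exact congrArg (fun T : K →L[ℂ] K => T (A ((W σ).adjoint x))) (hR σ).eq.symm

end AverageCommute

namespace CollisionSpec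
variable {H : Type*} [NormedAddCommGroup H] [InnerProductSpace ℂ H] [CompleteSpace H]
variable {h : H →ₗ.[ℂ] H} {C : Type*} [MetricSpace C] [CompactSpace C] [MeasurableSpace C]
  [BorelSpace C] (S : CollisionSpec h C)

/-- The map `𝒬` on trace class operators of two particles. -/
def collidePair : TraceClass (TensorPow H (Fin 2)) →L[ℂ] TraceClass (TensorPow H (Fin 2)) :=
  TraceClass.average S.isContractiveFamily_op S.ν

@[simp]
theorem toCLM_collidePair (T : TraceClass (TensorPow H (Fin 2))) :
    toCLM (S.collidePair T) = S.collisionOp (toCLM T) := toCLM_average _ _ T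

/-- The Wild convolution on trace class operators. -/
def wildConv : TraceClass H →L[ℂ] TraceClass H →L[ℂ] TraceClass H :=
  (ContinuousLinearMap.compL ℂ (TraceClass H) (TraceClass (TensorPow H (Fin 2))) (TraceClass H)
    (lower.comp ((traceOut (Fin.castAddEmb 1 : Fin 1 ↪ Fin (1 + 1))).comp S.collidePair))).comp
      tensorPair

theorem wildConv_apply (A B : TraceClass H) : S.wildConv A B =
    lower (traceOut (Fin.castAddEmb 1 : Fin 1 ↪ Fin (1 + 1)) (S.collidePair (tensorPair A B))) :=
  rfl

@[simp]
theorem toCLM_wildConv (A B : TraceClass H) :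
    toCLM (S.wildConv A B) = S.wild (toCLM A) (toCLM B) := by
  rw [wildConv_apply, toCLM_lower, toCLM_traceOut, toCLM_collidePair, toCLM_tensorPair]
  rfl

theorem collision_amplify {ι : Type} (p : Fin 2 ↪ ι)
    (A : TensorPow H (Fin 2) →L[ℂ] TensorPow H (Fin 2)) :
    S.collision p (amplify p A) = amplify p (S.collisionOp A) := by
  refine ext_basisVec fun β => ?_
  rw [basisVec_eq_insertVec p β, amplify_insertVec, collisionOp, average_apply, collision,
    average_apply]
  refine Eq.trans (integral_congr_ae (.of_forall fun σ => ?_))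
    ((insertVec p _).toContinuousLinearMap.integral_comp_comm
      (S.isContractiveFamily_op.integrable S.ν A _))
  simp only [opAt, adjoint_amplify, amplify_insertVec]
  rfl

theorem collision_amplify_mul_lastPair {k : ℕ} (A : H →L[ℂ] H) (i : Fin k)
    (Y : TensorPow H (Fin 2) →L[ℂ] TensorPow H (Fin 2)) :
    S.collision (lastPair i)
        (amplify (Fin.castAddEmb 1) (tensorPowErase A k i) * amplify (lastPair i) Y) =
      amplify (Fin.castAddEmb 1) (tensorPowErase A k i) *
        amplify (lastPair i) (S.collisionOp Y) := by
  rw [← collision_amplify]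
  refine average_mul_of_commute _ _
    (fun σ => commute_amplify_tensorPowErase A k _ _ i (fun j hj a => ?_) _) _
  fin_cases a
  · exact fun h => hj (Fin.castSucc_injective _ h)
  · exact (Fin.castSucc_lt_last j).ne

end CollisionSpec

theorem tensorPowOp_succ_eq_mul_lastPair {H : Type*} [NormedAddCommGroup H]
    [InnerProductSpace ℂ H] [CompleteSpace H] (A : H →L[ℂ] H) {k : ℕ} (i : Fin k) :
    tensorPowOp (k + 1) A = amplify (Fin.castAddEmb 1) (tensorPowErase A k i) *
      amplify (lastPair i) (tensorOp A A) := by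
  rw [tensorPowOp_succ, ← tensorPowErase_mul_atFactor A k i, amplify_mul, mul_assoc, tensorOp,
    amplify_mul, amplify_atFactor, amplify_atFactor, amplify_atFactor]
  rfl

namespace CollisionSpec
variable {H : Type*} [NormedAddCommGroup H] [InnerProductSpace ℂ H] [CompleteSpace H]
variable {h : H →ₗ.[ℂ] H} {C : Type*} [MetricSpace C] [CompactSpace C] [MeasurableSpace C]
  [BorelSpace C] (S : CollisionSpec h C)

theorem toCLM_traceOut_collide_tensorPow (A : TraceClass H) (k : ℕ) (i : Fin k) :
    toCLM (traceOut (Fin.castAddEmb 1) (S.collide (lastPair i) (tensorPow A (k + 1)))) =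
      tensorPowErase (toCLM A) k i * atFactor i (toCLM (S.wildConv A A)) := by
  rw [toCLM_traceOut, toCLM_collide, toCLM_tensorPow, tensorPowOp_succ_eq_mul_lastPair _ i,
    collision_amplify_mul_lastPair, ← toCLM_tensorPair, ← toCLM_collidePair,
    partialTrace_amplify_mul_lastPair, ← atFactor_lowerOp, wildConv_apply, toCLM_lower,
    toCLM_traceOut]

theorem gain_tensorPow (A : TraceClass H) (k : ℕ) :
    S.gain k (tensorPow A (k + 1)) = tensorPowDeriv A (S.wildConv A A) k := by
  refine TraceClass.ext ?_
  rw [gain_apply, map_sum, toCLM_tensorPowDeriv]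
  exact Finset.sum_congr rfl fun i _ => S.toCLM_traceOut_collide_tensorPow A k i

/-- The right-hand side `2 (A ⋆ A - A)` of the quantum Kac–Boltzmann equation. -/
def kacBoltzmann (A : TraceClass H) : TraceClass H := (2 : ℂ) • (S.wildConv A A - A)

/-- The derivative of a tensor power is linear in the direction, and the direction `A` gives back
`k` times the power. -/
theorem tensorPowDeriv_kacBoltzmann (A : TraceClass H) (k : ℕ) :
    tensorPowDeriv A (S.kacBoltzmann A) k =
      S.hierarchy k (tensorPow A k) (tensorPow A (k + 1)) := by
  have hlin : ∀ i : Fin k, atFactor i (toCLM (S.kacBoltzmann A)) =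
      (2 : ℂ) • (atFactor i (toCLM (S.wildConv A A)) - atFactor i (toCLM A)) := fun i => by
    simp only [atFactor_eq, ← amplifyL_apply, ← toCLM_raise]
    simp only [kacBoltzmann, map_smul, map_sub]
  refine TraceClass.ext ?_
  rw [hierarchy, gain_tensorPow, map_smul, map_sub, map_smul, toCLM_tensorPowDeriv,
    toCLM_tensorPowDeriv, toCLM_tensorPow]
  simp only [hlin, mul_smul_comm, mul_sub, tensorPowErase_mul_atFactor, ← Finset.smul_sum,
    Finset.sum_sub_distrib, Finset.sum_const, Finset.card_univ, Fintype.card_fin,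
    Nat.cast_smul_eq_nsmul]

end CollisionSpec

section LocalSolution
variable {E : Type*} [NormedAddCommGroup E] [NormedSpace ℝ E] [CompleteSpace E]

theorem exists_isPicardLindelof_solution {F : E → E} {τ : ℝ} (hτ : 0 ≤ τ) {x : E}
    {a L K : NNReal} (hp : IsPicardLindelof (fun _ => F) (tmin := 0) (tmax := τ)
      ⟨0, le_rfl, hτ⟩ x a 0 L K) :
    ∃ α : ℝ → E, α 0 = x ∧ ∀ t ∈ Set.Icc 0 τ, α t ∈ Metric.closedBall x a ∧
      HasDerivWithinAt α (F (α t)) (Set.Icc 0 τ) t := by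
  obtain ⟨α, hα⟩ := ODE.FunSpace.exists_isFixedPt_next hp (x := x) (by simp)
  have hmem : ∀ t, α.compProj t ∈ Metric.closedBall x a := fun t =>
    α.compProj_mem_closedBall hp.mul_max_le
  have hpicard : ∀ t ∈ Set.Icc 0 τ, α.compProj t = ODE.picard (fun _ => F) 0 x α.compProj t :=
    fun t ht => by
      conv_lhs => rw [← hα]
      rw [ODE.FunSpace.compProj_apply, ODE.FunSpace.next_apply, Set.projIcc_of_mem _ ht]
  refine ⟨α.compProj, ?_, fun t ht => ⟨hmem t, ?_⟩⟩
  · rw [hpicard 0 ⟨le_rfl, hτ⟩, ODE.picard_apply₀]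
  · have hderiv := ODE.hasDerivWithinAt_picard_Icc (f := fun _ => F) (t₀ := 0) (tmin := 0)
      (tmax := τ) (u := Metric.closedBall x a) ⟨le_rfl, hτ⟩ hp.continuousOn_uncurry
      α.continuous_compProj.continuousOn (fun t _ => hmem t) x ht
    exact hderiv.congr hpicard (hpicard t ht)

theorem exists_local_solution {F : E → E} {K : NNReal} {τ : ℝ} (hτ : 0 ≤ τ) (hτK : 2 * K * τ ≤ 1)
    (hF0 : F 0 = 0) (hF : LipschitzOnWith K F (Metric.closedBall 0 2)) {x : E} (hx : ‖x‖ ≤ 1) :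
    ∃ α : ℝ → E, α 0 = x ∧ ∀ t ∈ Set.Icc 0 τ, ‖α t‖ ≤ 2 ∧
      HasDerivWithinAt α (F (α t)) (Set.Icc 0 τ) t := by
  have hsub : Metric.closedBall x 1 ⊆ Metric.closedBall (0 : E) 2 :=
    Metric.closedBall_subset_closedBall' (by rw [dist_zero_right]; linarith)
  have hF_le : ∀ y ∈ Metric.closedBall x 1, ‖F y‖ ≤ ((2 * K : NNReal) : ℝ) := fun y hy => by
    have hlip := hF.dist_le_mul y (hsub hy) 0 (by simp)
    rw [hF0, dist_zero_right, dist_zero_right] at hlip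
    have hy_le : ‖y‖ ≤ 2 := by simpa using hsub hy
    calc ‖F y‖ ≤ K * ‖y‖ := hlip
      _ ≤ K * 2 := by gcongr
      _ = ((2 * K : NNReal) : ℝ) := by push_cast; ring
  have hp : IsPicardLindelof (fun _ => F) (tmin := 0) (tmax := τ) ⟨0, le_rfl, hτ⟩ x 1 0
      (2 * K) K := by
    refine IsPicardLindelof.of_time_independent hF_le (hF.mono hsub) ?_
    push_cast
    rw [sub_zero, sub_zero, max_eq_left hτ]
    simpa using hτK
  obtain ⟨α, hα0, hα⟩ := exists_isPicardLindelof_solution hτ hp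
  exact ⟨α, hα0, fun t ht => ⟨by simpa using hsub (hα t ht).1, (hα t ht).2⟩⟩

end LocalSolution

section Comparison

theorem norm_le_of_norm_deriv_le_pow {E : Type*} [NormedAddCommGroup E] [NormedSpace ℝ E] {τ : ℝ}
    {f f' : ℝ → E} (hf : ∀ t ∈ Set.Icc 0 τ, HasDerivWithinAt f (f' t) (Set.Icc 0 τ) t)
    {b δ η : ℝ} {m : ℕ} (hf' : ∀ t ∈ Set.Icc 0 τ, ‖f' t‖ ≤ b * ((m + 1) * t ^ m) + δ)
    (h0 : ‖f 0‖ ≤ η) : ∀ t ∈ Set.Icc 0 τ, ‖f t‖ ≤ b * t ^ (m + 1) + (δ * t + η) := by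
  refine image_norm_le_of_norm_deriv_right_le_deriv_boundary
    (B' := fun t => b * ((m + 1) * t ^ m) + δ)
    (fun t ht => (hf t ht).continuousWithinAt)
    (fun t ht => (hf t ⟨ht.1, ht.2.le⟩).mono_of_mem_nhdsWithin (Icc_mem_nhdsGE_of_mem ht))
    (by simpa using h0) (fun t => ?_) fun t ht => hf' t ⟨ht.1, ht.2.le⟩
  have hbound := ((hasDerivAt_pow (m + 1) t).const_mul b).add
    (((hasDerivAt_id t).const_mul δ).add_const η)
  exact hbound.congr_deriv (by push_cast; simp)

/-- The coefficient of `t ^ m` in the bound that `m` iterations of the hierarchy give for the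
`k`-th of its components. -/
def iterBound (c : ℝ) (k m : ℕ) : ℝ := 2 * c ^ (k + m) * 4 ^ m * ((k + m).choose m : ℝ)

theorem iterBound_nonneg {c : ℝ} (hc : 0 ≤ c) (k m : ℕ) : 0 ≤ iterBound c k m := by
  unfold iterBound; positivity

theorem iterBound_zero (c : ℝ) (k : ℕ) : iterBound c k 0 = 2 * c ^ k := by
  simp [iterBound]

theorem iterBound_le_succ {c : ℝ} (hc : 1 ≤ c) (k m : ℕ) :
    iterBound c k m ≤ iterBound c (k + 1) m := by
  have hpow : c ^ (k + m) ≤ c ^ (k + 1 + m) := pow_le_pow_right₀ hc (by omega)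
  have hchoose : ((k + m).choose m : ℝ) ≤ ((k + 1 + m).choose m : ℝ) :=
    Nat.cast_le.2 (Nat.choose_le_choose m (by omega))
  unfold iterBound
  gcongr

theorem four_mul_iterBound_succ_le {c : ℝ} (hc : 0 ≤ c) (k m : ℕ) :
    4 * k * iterBound c (k + 1) m ≤ (m + 1) * iterBound c k (m + 1) := by
  have hchoose : ((k + 1 + m).choose m : ℝ) * (k + 1) =
      ((k + 1 + m).choose (m + 1) : ℝ) * (m + 1) := by
    have hnat := Nat.choose_succ_right_eq (k + 1 + m) m
    rw [Nat.add_sub_cancel] at hnat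
    exact_mod_cast hnat.symm
  rw [iterBound, iterBound, ← add_assoc, add_right_comm k m 1]
  calc 4 * (k : ℝ) * (2 * c ^ (k + 1 + m) * 4 ^ m * ((k + 1 + m).choose m : ℝ))
      = 2 * c ^ (k + 1 + m) * 4 ^ (m + 1) * (((k + 1 + m).choose m : ℝ) * k) := by ring
    _ ≤ 2 * c ^ (k + 1 + m) * 4 ^ (m + 1) * (((k + 1 + m).choose m : ℝ) * (k + 1)) := by
        gcongr
        exact le_add_of_nonneg_right zero_le_one
    _ = (m + 1) * (2 * c ^ (k + 1 + m) * 4 ^ (m + 1) * ((k + 1 + m).choose (m + 1) : ℝ)) := by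
        rw [hchoose]; ring

theorem iterBound_mul_pow_le {c τ : ℝ} (hc : 0 ≤ c) (hτ : 0 ≤ τ) (hcτ : 16 * c * τ ≤ 1) (k m : ℕ) :
    iterBound c k m * τ ^ m ≤ 2 * (2 * c) ^ k * (1 / 2) ^ m := by
  have hchoose : ((k + m).choose m : ℝ) ≤ 2 ^ (k + m) := by
    exact_mod_cast Nat.choose_le_two_pow (k + m) m
  calc iterBound c k m * τ ^ m
      ≤ 2 * c ^ (k + m) * 4 ^ m * 2 ^ (k + m) * τ ^ m := by unfold iterBound; gcongr
    _ = 2 * (2 * c) ^ k * (8 * c * τ) ^ m := by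
        have hprod : 8 * c * τ = c * 4 * 2 * τ := by ring
        rw [hprod, pow_add, pow_add]
        simp only [mul_pow]
        ring
    _ ≤ 2 * (2 * c) ^ k * (1 / 2) ^ m := by
        gcongr
        linarith

variable {E : ℕ → Type*} [∀ k, NormedAddCommGroup (E k)] [∀ k, NormedSpace ℝ (E k)]

/-- The `m`-th iterate of Duhamel's formula, in the form of an inequality. -/
theorem eventually_norm_le_iterBound {c τ : ℝ} (hc : 1 ≤ c) (hτ : 0 ≤ τ)
    {f f' : ∀ k : ℕ, ℕ → ℝ → E k} {e : ℕ → ℕ → ℝ}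
    (hbd : ∀ k, 1 ≤ k → ∀ᶠ N in atTop, ∀ t ∈ Set.Icc 0 τ, ‖f k N t‖ ≤ 2 * c ^ k)
    (hd : ∀ k, 1 ≤ k → ∀ᶠ N in atTop, ∀ t ∈ Set.Icc 0 τ,
      HasDerivWithinAt (f k N) (f' k N t) (Set.Icc 0 τ) t)
    (hd' : ∀ k, 1 ≤ k → ∀ᶠ N in atTop, ∀ t ∈ Set.Icc 0 τ,
      ‖f' k N t‖ ≤ 2 * k * (‖f (k + 1) N t‖ + ‖f k N t‖) + e k N)
    (he : ∀ k, 1 ≤ k → Tendsto (e k) atTop (𝓝 0))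
    (h0 : ∀ k, 1 ≤ k → Tendsto (fun N => ‖f k N 0‖) atTop (𝓝 0)) (m : ℕ) :
    ∀ k, 1 ≤ k → ∀ ε : ℝ, 0 < ε → ∀ᶠ N in atTop, ∀ t ∈ Set.Icc 0 τ,
      ‖f k N t‖ ≤ iterBound c k m * t ^ m + ε := by
  induction m with
  | zero =>
    intro k hk ε hε
    filter_upwards [hbd k hk] with N hN t ht
    rw [iterBound_zero, pow_zero, mul_one]
    exact (hN t ht).trans (le_add_of_nonneg_right hε.le)
  | succ m ih =>
    intro k hk ε hε
    set η : ℝ := ε / ((4 * k + 1) * τ + 1) with hη_def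
    have hη : 0 < η := by positivity
    filter_upwards [ih k hk η hη, ih (k + 1) (by omega) η hη, hd k hk, hd' k hk,
      (he k hk).eventually_lt_const hη, (h0 k hk).eventually_lt_const hη]
      with N hfk hfk_succ hderiv hderiv_le he_lt h0_lt t ht
    have hrate : ∀ t ∈ Set.Icc 0 τ,
        ‖f' k N t‖ ≤ iterBound c k (m + 1) * ((m + 1) * t ^ m) + (4 * k + 1) * η := fun t ht => by
      have htm : 0 ≤ t ^ m := pow_nonneg ht.1 m
      calc ‖f' k N t‖ ≤ 2 * k * (‖f (k + 1) N t‖ + ‖f k N t‖) + e k N := hderiv_le t ht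
        _ ≤ 2 * k * ((iterBound c (k + 1) m * t ^ m + η) +
            (iterBound c (k + 1) m * t ^ m + η)) + η := by
            gcongr
            · exact hfk_succ t ht
            · exact (hfk t ht).trans (by gcongr; exact iterBound_le_succ hc k m)
        _ = 4 * k * iterBound c (k + 1) m * t ^ m + (4 * k + 1) * η := by ring
        _ ≤ (m + 1) * iterBound c k (m + 1) * t ^ m + (4 * k + 1) * η := by
            gcongr ?_ * _ + _
            exact four_mul_iterBound_succ_le (by linarith) k m
        _ = iterBound c k (m + 1) * ((m + 1) * t ^ m) + (4 * k + 1) * η := by ring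
    calc ‖f k N t‖ ≤ iterBound c k (m + 1) * t ^ (m + 1) + ((4 * k + 1) * η * t + η) :=
          norm_le_of_norm_deriv_le_pow hderiv hrate h0_lt.le t ht
      _ ≤ iterBound c k (m + 1) * t ^ (m + 1) + ((4 * k + 1) * η * τ + η) := by
          gcongr
          exact ht.2
      _ = iterBound c k (m + 1) * t ^ (m + 1) + ε := by
          rw [hη_def]
          field_simp

theorem eventually_norm_le_of_hierarchy {c τ : ℝ} (hc : 1 ≤ c) (hτ : 0 ≤ τ)
    (hcτ : 16 * c * τ ≤ 1) {f f' : ∀ k : ℕ, ℕ → ℝ → E k} {e : ℕ → ℕ → ℝ}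
    (hbd : ∀ k, 1 ≤ k → ∀ᶠ N in atTop, ∀ t ∈ Set.Icc 0 τ, ‖f k N t‖ ≤ 2 * c ^ k)
    (hd : ∀ k, 1 ≤ k → ∀ᶠ N in atTop, ∀ t ∈ Set.Icc 0 τ,
      HasDerivWithinAt (f k N) (f' k N t) (Set.Icc 0 τ) t)
    (hd' : ∀ k, 1 ≤ k → ∀ᶠ N in atTop, ∀ t ∈ Set.Icc 0 τ,
      ‖f' k N t‖ ≤ 2 * k * (‖f (k + 1) N t‖ + ‖f k N t‖) + e k N)
    (he : ∀ k, 1 ≤ k → Tendsto (e k) atTop (𝓝 0))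
    (h0 : ∀ k, 1 ≤ k → Tendsto (fun N => ‖f k N 0‖) atTop (𝓝 0)) {k : ℕ} (hk : 1 ≤ k) {ε : ℝ}
    (hε : 0 < ε) : ∀ᶠ N in atTop, ∀ t ∈ Set.Icc 0 τ, ‖f k N t‖ ≤ ε := by
  have hlim : Tendsto (fun m : ℕ => 2 * (2 * c) ^ k * (1 / 2 : ℝ) ^ m) atTop (𝓝 0) := by
    simpa using (tendsto_pow_atTop_nhds_zero_of_lt_one (r := (1 / 2 : ℝ)) (by norm_num)
      (by norm_num)).const_mul (2 * (2 * c) ^ k)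
  obtain ⟨m, hm⟩ := (hlim.eventually_lt_const (half_pos hε)).exists
  have hc0 : 0 ≤ c := by linarith
  filter_upwards [eventually_norm_le_iterBound hc hτ hbd hd hd' he h0 m k hk (ε / 2) (half_pos hε)]
    with N hN t ht
  calc ‖f k N t‖ ≤ iterBound c k m * t ^ m + ε / 2 := hN t ht
    _ ≤ iterBound c k m * τ ^ m + ε / 2 := by
        gcongr
        · exact iterBound_nonneg hc0 k m
        · exact ht.1
        · exact ht.2
    _ ≤ ε / 2 + ε / 2 := by
        gcongr
        exact (iterBound_mul_pow_le hc0 hτ hcτ k m).trans hm.le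
    _ = ε := add_halves ε

end Comparison

section States
variable {K : Type*} [NormedAddCommGroup K] [InnerProductSpace ℂ K]

/-- A bounded operator of finite trace norm as a trace class operator; any other bounded operator
is sent to `0`. -/
def TraceClass.ofCLM (T : K →L[ℂ] K) : TraceClass K :=
  open scoped Classical in if hT : traceNorm T ≠ ∞ then TraceClass.mk T hT else 0

theorem TraceClass.toCLM_ofCLM {T : K →L[ℂ] K} (hT : traceNorm T ≠ ∞) : toCLM (ofCLM T) = T := by
  rw [ofCLM, dif_pos hT, toCLM_mk]

theorem hasTraceNormDerivWithinAt_toCLM {R : ℝ → TraceClass K} {R' : TraceClass K} {s : Set ℝ}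
    {t : ℝ} (hR : HasDerivWithinAt R R' s t) :
    HasTraceNormDerivWithinAt (fun r => toCLM (R r)) (toCLM R') s t := by
  rw [hasDerivWithinAt_iff_tendsto_slope, tendsto_iff_enorm_sub_tendsto_zero] at hR
  refine hR.congr fun r => ?_
  rw [enorm_eq, slope_def_module, ← Complex.coe_smul, map_sub, map_smul, map_sub,
    Complex.ofReal_inv]

variable [CompleteSpace K]

theorem IsDensityMatrix.traceNorm_ne_top {T : K →L[ℂ] K} (hT : IsDensityMatrix T) :
    traceNorm T ≠ ∞ := by
  rw [traceNorm_eq_tsum hT.1 (basis K)]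
  simp_rw [← ofReal_norm]
  exact hT.2.summable.norm.tsum_ofReal_ne_top

theorem isDensityMatrix_toCLM_iff {T : TraceClass K} :
    IsDensityMatrix (toCLM T) ↔ (toCLM T).IsPositive ∧ trace T = 1 :=
  and_congr_right fun _ =>
    ⟨fun h => (hasSum_trace T (basis K)).unique h, fun h => h ▸ hasSum_trace T (basis K)⟩

theorem norm_eq_one_of_isDensityMatrix {T : TraceClass K} (hT : IsDensityMatrix (toCLM T)) :
    ‖T‖ = 1 := by
  obtain ⟨hpos, htrace⟩ := isDensityMatrix_toCLM_iff.1 hT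
  rw [trace_eq_norm_of_isPositive hpos] at htrace
  exact_mod_cast htrace

theorem isDensityMatrix_of_tendsto {X : ℕ → TraceClass K} {A : TraceClass K}
    (hXA : Tendsto X atTop (𝓝 A)) (hX : ∀ᶠ n in atTop, IsDensityMatrix (toCLM (X n))) :
    IsDensityMatrix (toCLM A) := by
  rw [isDensityMatrix_toCLM_iff, ← ContinuousLinearMap.nonneg_iff_isPositive]
  constructor
  · refine CStarAlgebra.isClosed_nonneg.mem_of_tendsto ((toCLM.continuous.tendsto A).comp hXA) ?_
    filter_upwards [hX] with n hn
    exact (ContinuousLinearMap.nonneg_iff_isPositive _).2 hn.1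
  · refine tendsto_nhds_unique ((trace.continuous.tendsto A).comp hXA)
      (tendsto_const_nhds.congr' ?_)
    filter_upwards [hX] with n hn
    exact (isDensityMatrix_toCLM_iff.1 hn).2.symm

end States

section Marginals
variable {H : Type*} [NormedAddCommGroup H] [InnerProductSpace ℂ H] [CompleteSpace H]

/-- The reduced density matrix of the first `k` of `N` particles; it is `0` if `N < k`. -/
def reduced (k N : ℕ) : TraceClass (TensorPow H (Fin N)) →L[ℂ] TraceClass (TensorPow H (Fin k)) :=
  if hk : k ≤ N then traceOut (Fin.castLEEmb hk) else 0

theorem reduced_of_le {k N : ℕ} (hk : k ≤ N) :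
    (reduced k N : TraceClass (TensorPow H (Fin N)) →L[ℂ] _) = traceOut (Fin.castLEEmb hk) :=
  dif_pos hk

theorem reduced_add (k M : ℕ) :
    (reduced k (k + M) : TraceClass (TensorPow H (Fin (k + M))) →L[ℂ] _) =
      traceOut (Fin.castAddEmb M) :=
  reduced_of_le (Nat.le_add_right k M)

theorem norm_reduced_apply_le (k N : ℕ) (X : TraceClass (TensorPow H (Fin N))) :
    ‖reduced k N X‖ ≤ ‖X‖ := by
  by_cases hk : k ≤ N
  · rw [reduced_of_le hk]
    exact norm_traceOut_apply_le _ X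
  · rw [reduced, dif_neg hk, zero_apply, norm_zero]
    exact norm_nonneg X

theorem isDensityMatrix_reduced {k N : ℕ} (hk : k ≤ N) {X : TraceClass (TensorPow H (Fin N))}
    (hX : IsDensityMatrix (toCLM X)) : IsDensityMatrix (toCLM (reduced k N X)) := by
  obtain ⟨hpos, htrace⟩ := isDensityMatrix_toCLM_iff.1 hX
  rw [isDensityMatrix_toCLM_iff, reduced_of_le hk, trace_traceOut]
  exact ⟨isPositive_traceOut _ hpos, htrace⟩

theorem tensorPow_one (A : TraceClass H) : tensorPow A 1 = raise A := by
  have hpoint : pointEmb (0 : Fin 1) = Function.Embedding.refl _ := by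
    ext i
    exact congrArg Fin.val (Subsingleton.elim (0 : Fin 1) i)
  refine TraceClass.ext ?_
  rw [toCLM_tensorPow, tensorPowOp, List.ofFn_succ, List.ofFn_zero, List.prod_singleton,
    atFactor_eq, hpoint, amplify_refl, toCLM_raise]

theorem norm_raise (A : TraceClass H) : ‖raise A‖ = ‖A‖ := by
  refine le_antisymm (norm_raise_apply_le A) ?_
  calc ‖A‖ = ‖lower (raise A)‖ := by rw [lower_raise]
    _ ≤ ‖raise A‖ := norm_lower_apply_le _

theorem isDensityMatrix_of_raise {A : TraceClass H} (hA : IsDensityMatrix (toCLM (raise A))) :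
    IsDensityMatrix (toCLM A) := by
  have hpos : (toCLM A).IsPositive := by
    rw [← lower_raise A, toCLM_lower]
    exact hA.1.adjoint_conj _
  rw [isDensityMatrix_toCLM_iff, trace_eq_norm_of_isPositive hpos, ← norm_raise,
    norm_eq_one_of_isDensityMatrix hA, Complex.ofReal_one]
  exact ⟨hpos, rfl⟩

end Marginals

section Chaos
variable {H : Type*} [NormedAddCommGroup H] [InnerProductSpace ℂ H] [CompleteSpace H]
  {A B : TraceClass H} {X : ∀ N : ℕ, TraceClass (TensorPow H (Fin N))}
  {ϱ : ∀ N : ℕ, TensorPow H (Fin N) →L[ℂ] TensorPow H (Fin N)}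

/-- A sequence of symmetric density matrices `X N` of `N ≥ 2` particles. -/
def IsSymmState (X : ∀ N : ℕ, TraceClass (TensorPow H (Fin N))) : Prop :=
  ∀ N, 2 ≤ N → IsDensityMatrix (toCLM (X N)) ∧ IsPermSymmetric (toCLM (X N))

/-- Convergence of the reduced density matrices of `X N` to the tensor powers of `A`: the limit
in `IsChaotic`, for trace class operators. -/
def Chaotic (A : TraceClass H) (X : ∀ N : ℕ, TraceClass (TensorPow H (Fin N))) : Prop :=
  ∀ k, 1 ≤ k → Tendsto (fun N => ‖reduced k N (X N) - tensorPow A k‖) atTop (𝓝 0)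

theorem Chaotic.tendsto_raise (hX : Chaotic A X) :
    Tendsto (fun N => reduced 1 N (X N)) atTop (𝓝 (raise A)) := by
  rw [tendsto_iff_norm_sub_tendsto_zero, ← tensorPow_one]
  exact hX 1 le_rfl

theorem Chaotic.unique (hA : Chaotic A X) (hB : Chaotic B X) : A = B := by
  rw [← lower_raise A, tendsto_nhds_unique hA.tendsto_raise hB.tendsto_raise, lower_raise]

theorem Chaotic.isDensityMatrix (hA : Chaotic A X) (hX : IsSymmState X) :
    IsDensityMatrix (toCLM A) := by
  refine isDensityMatrix_of_raise (isDensityMatrix_of_tendsto hA.tendsto_raise ?_)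
  filter_upwards [eventually_ge_atTop 2] with N hN
  exact isDensityMatrix_reduced (by omega) (hX N hN).1

theorem chaotic_iff (hX : ∀ N, 2 ≤ N → toCLM (X N) = ϱ N) : Chaotic A X ↔ ∀ k, 1 ≤ k →
    Tendsto (fun M => traceNorm (marginal k M (ϱ (k + M)) - tensorPowOp k (toCLM A)))
      atTop (𝓝 0) := by
  refine forall₂_congr fun k hk => ?_
  rw [← tendsto_zero_iff_norm_tendsto_zero, tendsto_zero_iff_enorm_tendsto_zero,
    ← tendsto_add_atTop_iff_nat k]
  refine tendsto_congr' ?_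
  filter_upwards [eventually_ge_atTop 1] with M hM
  rw [add_comm M k, reduced_add, enorm_eq, map_sub, toCLM_traceOut, toCLM_tensorPow,
    hX _ (by omega)]
  rfl

theorem isChaotic_toCLM (hXϱ : ∀ N, 2 ≤ N → toCLM (X N) = ϱ N) (hX : IsSymmState X)
    (hA : Chaotic A X) : IsChaotic (toCLM A) ϱ :=
  ⟨hA.isDensityMatrix hX, fun N hN => hXϱ N hN ▸ hX N hN, (chaotic_iff hXϱ).1 hA⟩

theorem IsChaotic.toCLM_ofCLM {ρ : H →L[ℂ] H} (hϱ : IsChaotic ρ ϱ) {N : ℕ} (hN : 2 ≤ N) :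
    toCLM (ofCLM (ϱ N)) = ϱ N :=
  TraceClass.toCLM_ofCLM (hϱ.2.1 N hN).1.traceNorm_ne_top

theorem IsChaotic.isSymmState_ofCLM {ρ : H →L[ℂ] H} (hϱ : IsChaotic ρ ϱ) :
    IsSymmState fun N => ofCLM (ϱ N) := fun N hN => by
  rw [hϱ.toCLM_ofCLM hN]
  exact hϱ.2.1 N hN

theorem IsChaotic.chaotic_ofCLM {ρ : H →L[ℂ] H} (hϱ : IsChaotic ρ ϱ) :
    Chaotic (ofCLM ρ) fun N => ofCLM (ϱ N) := by
  rw [chaotic_iff fun N hN => hϱ.toCLM_ofCLM hN,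
    TraceClass.toCLM_ofCLM hϱ.1.traceNorm_ne_top]
  exact hϱ.2.2

end Chaos

namespace CollisionSpec
variable {H : Type*} [NormedAddCommGroup H] [InnerProductSpace ℂ H] [CompleteSpace H]
variable {h : H →ₗ.[ℂ] H} {C : Type*} [MetricSpace C] [CompactSpace C] [MeasurableSpace C]
  [BorelSpace C] (S : CollisionSpec h C)

theorem flow_zero (N : ℕ) (X : TraceClass (TensorPow H (Fin N))) : S.flow N 0 X = X := by
  rw [flow, Complex.ofReal_zero, zero_smul, NormedSpace.exp_zero]
  rfl

theorem flow_add (N : ℕ) (s t : ℝ) (X : TraceClass (TensorPow H (Fin N))) :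
    S.flow N (s + t) X = S.flow N s (S.flow N t X) := by
  rw [flow, Complex.ofReal_add, exp_add_smul_apply]
  rfl

theorem isDensityMatrix_flow {N : ℕ} (hN : 1 ≤ N) {t : ℝ} (ht : 0 ≤ t)
    {X : TraceClass (TensorPow H (Fin N))} (hX : IsDensityMatrix (toCLM X)) :
    IsDensityMatrix (toCLM (S.flow N t X)) := by
  rw [isDensityMatrix_toCLM_iff] at hX ⊢
  rw [trace_flow]
  exact ⟨S.isPositive_flow hN ht hX.1, hX.2⟩

theorem hierarchy_sub (k : ℕ) (X X' : TraceClass (TensorPow H (Fin k)))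
    (Y Y' : TraceClass (TensorPow H (Fin (k + 1)))) :
    S.hierarchy k X Y - S.hierarchy k X' Y' = S.hierarchy k (X - X') (Y - Y') := by
  simp only [hierarchy, map_sub, smul_sub]
  abel

theorem norm_reduced_generator_sub_hierarchy_le {k N : ℕ} (hk : 1 ≤ k) (hN : k + 1 ≤ N)
    {X : TraceClass (TensorPow H (Fin N))} (hX : IsPermSymmetric (toCLM X)) :
    ‖reduced k N (S.generator N X) - S.hierarchy k (reduced k N X) (reduced (k + 1) N X)‖ ≤
      6 * k ^ 2 / ((N : ℝ) - 1) * ‖X‖ := by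
  obtain ⟨M, rfl⟩ := Nat.exists_eq_add_of_le (by omega : k ≤ N)
  rw [reduced_add, reduced_of_le hN]
  exact S.norm_traceOut_generator_sub_hierarchy_le hk _ hX

section States
variable {X : ∀ N : ℕ, TraceClass (TensorPow H (Fin N))} (hX : IsSymmState X)
include hX

theorem isSymmState_flow {t : ℝ} (ht : 0 ≤ t) : IsSymmState fun N => S.flow N t (X N) :=
  fun N hN => ⟨S.isDensityMatrix_flow (by omega) ht (hX N hN).1,
    S.isPermSymmetric_flow t (hX N hN).2⟩

theorem norm_flow_eq_one {N : ℕ} (hN : 2 ≤ N) {t : ℝ} (ht : 0 ≤ t) : ‖S.flow N t (X N)‖ = 1 :=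
  norm_eq_one_of_isDensityMatrix (S.isSymmState_flow hX ht N hN).1

theorem norm_reduced_flow_sub_tensorPow_le {A : TraceClass H} (hA : ‖A‖ ≤ 2) (k : ℕ) {N : ℕ}
    (hN : 2 ≤ N) {t : ℝ} (ht : 0 ≤ t) :
    ‖reduced k N (S.flow N t (X N)) - tensorPow A k‖ ≤ 2 * 2 ^ k := by
  have hflow : ‖reduced k N (S.flow N t (X N))‖ ≤ 1 :=
    (norm_reduced_apply_le k N _).trans_eq (S.norm_flow_eq_one hX hN ht)
  have hpow : ‖tensorPow A k‖ ≤ 2 ^ k :=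
    (norm_tensorPow_le A k).trans (pow_le_pow_left₀ (norm_nonneg A) hA k)
  calc ‖reduced k N (S.flow N t (X N)) - tensorPow A k‖ ≤ 1 + 2 ^ k :=
        norm_sub_le_of_le hflow hpow
    _ ≤ 2 ^ k + 2 ^ k := by gcongr; exact one_le_pow₀ one_le_two
    _ = 2 * 2 ^ k := (two_mul _).symm

theorem norm_reduced_generator_flow_sub_hierarchy_le (A : TraceClass H) {k N : ℕ} (hk : 1 ≤ k)
    (hN : k + 1 ≤ N) {t : ℝ} (ht : 0 ≤ t) :
    ‖reduced k N (S.generator N (S.flow N t (X N))) -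
        S.hierarchy k (tensorPow A k) (tensorPow A (k + 1))‖ ≤
      2 * k * (‖reduced (k + 1) N (S.flow N t (X N)) - tensorPow A (k + 1)‖ +
        ‖reduced k N (S.flow N t (X N)) - tensorPow A k‖) + 6 * k ^ 2 / ((N : ℝ) - 1) := by
  have hN2 : 2 ≤ N := by omega
  have hmeanField := S.norm_reduced_generator_sub_hierarchy_le hk hN
    (S.isSymmState_flow hX ht N hN2).2
  rw [S.norm_flow_eq_one hX hN2 ht, mul_one] at hmeanField
  refine (norm_sub_le_norm_sub_add_norm_sub _ (S.hierarchy k (reduced k N (S.flow N t (X N)))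
    (reduced (k + 1) N (S.flow N t (X N)))) _).trans ?_
  rw [hierarchy_sub, add_comm]
  exact add_le_add (S.norm_hierarchy_apply_le _ _) hmeanField

theorem chaotic_flow {τ : ℝ} (hτ : 0 ≤ τ) (hτ1 : 16 * 2 * τ ≤ 1) {α : ℝ → TraceClass H}
    (hα : ∀ t ∈ Set.Icc 0 τ, ‖α t‖ ≤ 2 ∧
      HasDerivWithinAt α (S.kacBoltzmann (α t)) (Set.Icc 0 τ) t)
    (h0 : Chaotic (α 0) X) {t : ℝ} (ht : t ∈ Set.Icc 0 τ) :
    Chaotic (α t) fun N => S.flow N t (X N) := by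
  have hbound : ∀ k, 1 ≤ k → ∀ᶠ N in atTop, ∀ t ∈ Set.Icc 0 τ,
      ‖reduced k N (S.flow N t (X N)) - tensorPow (α t) k‖ ≤ 2 * 2 ^ k := fun k _ => by
    filter_upwards [eventually_ge_atTop 2] with N hN t ht
    exact S.norm_reduced_flow_sub_tensorPow_le hX (hα t ht).1 k hN ht.1
  have hderiv : ∀ k, 1 ≤ k → ∀ᶠ N in atTop, ∀ t ∈ Set.Icc 0 τ,
      HasDerivWithinAt (fun t => reduced k N (S.flow N t (X N)) - tensorPow (α t) k)
        (reduced k N (S.generator N (S.flow N t (X N))) -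
          S.hierarchy k (tensorPow (α t) k) (tensorPow (α t) (k + 1))) (Set.Icc 0 τ) t := by
    refine fun k _ => .of_forall fun N t ht => ?_
    have hflow := ((reduced k N).restrictScalars ℝ).hasFDerivAt.comp_hasDerivAt t
      (hasDerivAt_exp_apply (S.generator N) (X N) t)
    have hpow := hasDerivWithinAt_tensorPow (hα t ht).2 k
    rw [tensorPowDeriv_kacBoltzmann] at hpow
    exact hflow.hasDerivWithinAt.sub hpow
  have herror : ∀ k : ℕ, 1 ≤ k →
      Tendsto (fun N : ℕ => 6 * (k : ℝ) ^ 2 / ((N : ℝ) - 1)) atTop (𝓝 0) := fun k _ =>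
    tendsto_const_nhds.div_atTop
      (tendsto_atTop_add_const_right _ (-1 : ℝ) tendsto_natCast_atTop_atTop)
  intro k hk
  rw [NormedAddGroup.tendsto_nhds_zero]
  intro ε hε
  have hclose := eventually_norm_le_of_hierarchy (E := fun k => TraceClass (TensorPow H (Fin k)))
    one_le_two hτ hτ1 hbound hderiv (fun k hk => ?_) herror
    (fun k hk => by simpa only [flow_zero] using h0 k hk) hk (half_pos hε)
  · filter_upwards [hclose] with N hN
    rw [norm_norm]
    exact (hN t ht).trans_lt (half_lt_self hε)
  · filter_upwards [eventually_ge_atTop (k + 1)] with N hN t ht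
    exact S.norm_reduced_generator_flow_sub_hierarchy_le hX _ hk hN ht.1

end States

theorem lipschitzOnWith_kacBoltzmann (r : NNReal) :
    LipschitzOnWith (2 * (2 * r * ‖S.wildConv‖₊ + 1)) S.kacBoltzmann (Metric.closedBall 0 r) := by
  refine LipschitzOnWith.of_dist_le_mul fun A hA B hB => ?_
  rw [mem_closedBall_zero_iff] at hA hB
  have hdiff : S.kacBoltzmann A - S.kacBoltzmann B =
      (2 : ℂ) • (S.wildConv A (A - B) + S.wildConv (A - B) B - (A - B)) := by
    simp only [kacBoltzmann, map_sub, sub_apply, smul_sub, smul_add]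
    abel
  have hleft : ‖S.wildConv A (A - B)‖ ≤ ‖S.wildConv‖ * r * ‖A - B‖ :=
    (S.wildConv.le_opNorm₂ A (A - B)).trans (by gcongr)
  have hright : ‖S.wildConv (A - B) B‖ ≤ ‖S.wildConv‖ * ‖A - B‖ * r :=
    (S.wildConv.le_opNorm₂ (A - B) B).trans (by gcongr)
  rw [dist_eq_norm, dist_eq_norm, hdiff, norm_smul, Complex.norm_ofNat]
  calc 2 * ‖S.wildConv A (A - B) + S.wildConv (A - B) B - (A - B)‖
      ≤ 2 * (‖S.wildConv‖ * r * ‖A - B‖ + ‖S.wildConv‖ * ‖A - B‖ * r + ‖A - B‖) := by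
        gcongr
        exact norm_sub_le_of_le (norm_add_le_of_le hleft hright) le_rfl
    _ = ((2 * (2 * r * ‖S.wildConv‖₊ + 1) : NNReal) : ℝ) * ‖A - B‖ := by
        push_cast
        ring

theorem kacBoltzmann_zero : S.kacBoltzmann 0 = 0 := by
  rw [kacBoltzmann, map_zero, sub_zero, smul_zero]

/-- Density matrices have norm `1`, so the length `τ` of the step does not depend on the state. -/
theorem exists_chaotic_step : ∃ τ : ℝ, 0 < τ ∧
    ∀ (A : TraceClass H) (X : ∀ N : ℕ, TraceClass (TensorPow H (Fin N))), IsSymmState X →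
      Chaotic A X → ∃ α : ℝ → TraceClass H, ∀ t ∈ Set.Icc 0 τ,
        HasDerivWithinAt α (S.kacBoltzmann (α t)) (Set.Icc 0 τ) t ∧
        Chaotic (α t) fun N => S.flow N t (X N) := by
  set K : NNReal := 2 * (2 * 2 * ‖S.wildConv‖₊ + 1)
  set τ : ℝ := (2 * K + 16 * 2)⁻¹
  have hτ : 0 < τ := by positivity
  have hsum : 2 * K * τ + 16 * 2 * τ = 1 := by
    rw [← add_mul]
    exact mul_inv_cancel₀ (by positivity)
  have hKτ : 0 ≤ K * τ := by positivity
  refine ⟨τ, hτ, fun A X hX hA => ?_⟩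
  obtain ⟨α, hα0, hα⟩ := exists_local_solution hτ.le (by linarith) S.kacBoltzmann_zero
    (S.lipschitzOnWith_kacBoltzmann 2)
    (norm_eq_one_of_isDensityMatrix (hA.isDensityMatrix hX)).le
  exact ⟨α, fun t ht => ⟨(hα t ht).2, S.chaotic_flow hX hτ.le (by linarith) hα (hα0 ▸ hA) ht⟩⟩

section Global
variable {X : ∀ N : ℕ, TraceClass (TensorPow H (Fin N))} (hX : IsSymmState X)
include hX

theorem exists_chaotic {A : TraceClass H} (hA : Chaotic A X) {t : ℝ} (ht : 0 ≤ t) :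
    ∃ B, Chaotic B fun N => S.flow N t (X N) := by
  obtain ⟨τ, hτ, hstep⟩ := S.exists_chaotic_step
  have hsteps : ∀ n : ℕ, ∀ t ∈ Set.Icc 0 (n * τ), ∃ B, Chaotic B fun N => S.flow N t (X N) := by
    intro n
    induction n with
    | zero =>
      intro t ht
      obtain rfl : t = 0 := le_antisymm (by simpa using ht.2) ht.1
      exact ⟨A, by simpa only [flow_zero] using hA⟩
    | succ n ih =>
      intro t ht
      have htn : t ≤ n * τ + τ := by simpa [add_mul] using ht.2
      set s := max 0 (t - τ)
      have hs : 0 ≤ s := le_max_left _ _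
      have hst : s ≤ t := max_le ht.1 (by linarith)
      have hts : t - τ ≤ s := le_max_right _ _
      obtain ⟨B, hB⟩ := ih s ⟨hs, max_le (by positivity) (by linarith)⟩
      obtain ⟨α, hα⟩ := hstep B _ (S.isSymmState_flow hX hs) hB
      have hchaos := (hα (t - s) ⟨by linarith, by linarith⟩).2
      simp only [← flow_add, sub_add_cancel] at hchaos
      exact ⟨_, hchaos⟩
  obtain ⟨n, hn⟩ := exists_nat_ge (t / τ)
  exact hsteps n t ⟨ht, (div_le_iff₀ hτ).1 hn⟩

variable {R : ℝ → TraceClass H} (hR : ∀ t, 0 ≤ t → Chaotic (R t) fun N => S.flow N t (X N))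
include hR

theorem exists_hasDerivWithinAt_of_chaotic : ∃ τ : ℝ, 0 < τ ∧ ∀ s, 0 ≤ s →
    ∀ t ∈ Set.Icc s (s + τ),
      HasDerivWithinAt R (S.kacBoltzmann (R t)) (Set.Icc s (s + τ)) t := by
  obtain ⟨τ, hτ, hstep⟩ := S.exists_chaotic_step
  refine ⟨τ, hτ, fun s hs => ?_⟩
  obtain ⟨α, hα⟩ := hstep (R s) _ (S.isSymmState_flow hX hs) (hR s hs)
  have hshift : Set.MapsTo (fun r => r - s) (Set.Icc s (s + τ)) (Set.Icc 0 τ) := fun r hr =>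
    ⟨sub_nonneg.2 hr.1, by linarith [hr.2]⟩
  have heq : ∀ r ∈ Set.Icc s (s + τ), R r = α (r - s) := fun r hr => by
    have hchaos := (hα (r - s) (hshift hr)).2
    simp only [← flow_add, sub_add_cancel] at hchaos
    exact (hR r (hs.trans hr.1)).unique hchaos
  intro t ht
  have hderiv := (hα (t - s) (hshift ht)).1.scomp t
    ((hasDerivWithinAt_id t (Set.Icc s (s + τ))).sub_const s) hshift
  rw [one_smul, ← heq t ht] at hderiv
  exact hderiv.congr heq (heq t ht)

theorem hasDerivWithinAt_of_chaotic {t : ℝ} (ht : 0 ≤ t) :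
    HasDerivWithinAt R (S.kacBoltzmann (R t)) (Set.Ici 0) t := by
  obtain ⟨τ, hτ, hderiv⟩ := S.exists_hasDerivWithinAt_of_chaotic hX hR
  set s := max 0 (t - τ / 2)
  have hts : t - τ / 2 ≤ s := le_max_right _ _
  have hmem : t ∈ Set.Icc s (s + τ) := ⟨max_le ht (by linarith), by linarith⟩
  refine (hderiv s (le_max_left _ _) t hmem).mono_of_mem_nhdsWithin ?_
  have hnhds : Set.Ioo (t - τ / 2) (t + τ / 2) ∈ 𝓝 t := Ioo_mem_nhds (by linarith) (by linarith)
  filter_upwards [self_mem_nhdsWithin, mem_nhdsWithin_of_mem_nhds hnhds] with r hr0 hr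
  exact ⟨max_le hr0 hr.1.le, by linarith [hr.2]⟩

theorem solvesQKBE_of_chaotic : S.SolvesQKBE fun t => toCLM (R t) := fun t ht => by
  refine ⟨(hR t ht).isDensityMatrix (S.isSymmState_flow hX ht), ?_⟩
  have hderiv := hasTraceNormDerivWithinAt_toCLM (S.hasDerivWithinAt_of_chaotic hX hR ht)
  rwa [kacBoltzmann, map_smul, map_sub, toCLM_wildConv] at hderiv

end Global

end CollisionSpec

end QuantumKac

end

theorem mainTheorem2_general {H : Type*} [NormedAddCommGroup H] [InnerProductSpace ℂ H]
    [CompleteSpace H] {h : H →ₗ.[ℂ] H} {C : Type*} [MetricSpace C] [CompactSpace C]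
    [MeasurableSpace C] [BorelSpace C] (S : CollisionSpec h C) {ρ₀ : H →L[ℂ] H}
    {ϱ : ∀ N : ℕ, TensorPow H (Fin N) →L[ℂ] TensorPow H (Fin N)} (h_chaos : IsChaotic ρ₀ ϱ) :
    ∃ ρ : ℝ → H →L[ℂ] H, ρ 0 = ρ₀ ∧
      (∀ t, 0 ≤ t → IsChaotic (ρ t) fun N => S.kacSemigroup N t (ϱ N)) ∧
      S.SolvesQKBE ρ := by
  have hX := h_chaos.isSymmState_ofCLM
  choose! R hR using fun (t : ℝ) (ht : 0 ≤ t) => S.exists_chaotic hX h_chaos.chaotic_ofCLM ht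
  have hR0 : R 0 = TraceClass.ofCLM ρ₀ := by
    have hchaos := hR 0 le_rfl
    simp only [CollisionSpec.flow_zero] at hchaos
    exact hchaos.unique h_chaos.chaotic_ofCLM
  have hflow (t : ℝ) (N : ℕ) (hN : 2 ≤ N) :
      TraceClass.toCLM (S.flow N t (TraceClass.ofCLM (ϱ N))) = S.kacSemigroup N t (ϱ N) := by
    rw [S.toCLM_flow hN, h_chaos.toCLM_ofCLM hN]
  refine ⟨fun t => TraceClass.toCLM (R t), ?_, fun t ht => ?_, S.solvesQKBE_of_chaotic hX hR⟩
  · beta_reduce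
    rw [hR0, TraceClass.toCLM_ofCLM h_chaos.1.traceNorm_ne_top]
  · exact isChaotic_toCLM (hflow t) (S.isSymmState_flow hX ht) (hR t ht)

theorem mainTheorem2 {H : Type*} [NormedAddCommGroup H] [InnerProductSpace ℂ H] [CompleteSpace H]
    [TopologicalSpace.SeparableSpace H] (h : H →ₗ.[ℂ] H) (h_self : IsSelfAdjoint h)
    (h_res : HasCompactResolvent h)
    {C : Type*} [MetricSpace C] [CompactSpace C] [MeasurableSpace C] [BorelSpace C]
    (S : CollisionSpec h C) (ρ₀ : H →L[ℂ] H)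
    (ϱ : ∀ N : ℕ, TensorPow H (Fin N) →L[ℂ] TensorPow H (Fin N)) (h_chaos : IsChaotic ρ₀ ϱ) :
    ∃ ρ : ℝ → H →L[ℂ] H, ρ 0 = ρ₀ ∧
      (∀ t, 0 ≤ t → IsChaotic (ρ t) fun N => S.kacSemigroup N t (ϱ N)) ∧
      S.SolvesQKBE ρ :=
  mainTheorem2_general S h_chaos
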